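/- **Conventions.** Let $\mathcal V$ be a braided monoidal category with braiding $c$ and let $Q\mathcal V$ be its Cauchy completion (idempotent completion; objects are pairs $(X,e)$ with $e=e^2:X\to X$), with its induced braided monoidal structure. Associativity and unit constraints are suppressed, and composition is written right to left. For a monoid $(A,\mu,\eta)$ and comonoid $(A,\delta,\varepsilon)$, $\mu_3$ and $\delta_3$ are the iterated operations and $f*g=\mu(f\otimes g)\delta$ is convolution. The opposite of a comonoid $(C,\delta,\varepsilon)$ is $C^o=(C,c\delta,\varepsilon)$. *Frobenius monoids.* A Frobenius monoid is a monoid and comonoid $R$ with $(1\otimes\mu)(\delta\otimes1)=(\mu\otimes1)(1\otimes\delta)$; it is separable if $\mu\delta=1$. *Weak Hopf monoids.* A weak bimonoid is a monoid and comonoid $A$ with (b) $\delta\mu=(\mu\otimes\mu)(1\otimes c\otimes1)(\delta\otimes\delta)$; (v) $\varepsilon\mu_3=(\varepsilon\mu\otimes\varepsilon\mu)(1\otimes\delta\otimes1)=(\varepsilon\mu\otimes\varepsilon\mu)(1\otimes c^{-1}\delta\otimes1)$; (w) $\delta_3\eta=(1\otimes\mu\otimes1)(\delta\eta\otimes\delta\eta)=(1\otimes\mu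 c^{-1}\otimes1)(\delta\eta\otimes\delta\eta)$. Its source and target morphisms $A\to A$, and the morphism $r$, are $$s=(1\otimes\varepsilon\mu)(\delta\eta\otimes1),\quad t=(1\otimes\varepsilon\mu)(c\otimes1)(1\otimes\delta\eta),\quad r=(\varepsilon\mu\otimes1)(1\otimes c)(\delta\eta\otimes1).$$ An antipode is a morphism $\nu:A\to A$ with $\nu*1=t$, $1*\nu=r$, $\nu*1*\nu=\nu$; a weak Hopf monoid is a weak bimonoid with an antipode. *Quantum categories.* For a comonoid $C$, the tensor product $M\otimes_CN$ of a right $C$-comodule $M$ and a left $C$-comodule $N$ is the equalizer of the two induced morphisms $M\otimes N\to M\otimes C\otimes N$, required to be preserved by all functors $X\otimes-$. A quantum category with comonoid of arrows $A$ and comonoid of objects $C$ consists of comonoid morphisms $s:A\to C^o$ and $t:A\to C$ with $c(s\otimes t)\delta=(t\otimes s)\delta$, so that $A$ is a $C$-bicomodule with coactions $\gamma_l=c^{-1}(1\otimes s)\delta$ and $\gamma_r=(1\otimes t)\delta$; the tensor products $\iota:P=A\otimes_CA\to A\otimes A$ and $A\otimes_CA\otimes_CA$; and bicomodule morphisms $\mu:P\to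 A$, $\eta:C\to A$ (composition and unit), such that the following hold. Let $\delta_l:P\to A\otimes A\otimes P$ be the coaction induced by $(1\otimes c\otimes1)(\delta\otimes\delta):A\otimes A\to A\otimes A\otimes A\otimes A$. (B1) $(A,\mu,\eta)$ is a monoid in the category of $C$-bicomodules with $\otimes_C$. (B2) $(t\otimes\varepsilon\otimes\mu)\delta_l=(\varepsilon\otimes s\otimes\mu)\delta_l:P\to C\otimes A$; moreover $(1\otimes1\otimes\mu)\delta_l$ factors as $(\iota\otimes1)\delta_r$ for a (unique) $\delta_r:P\to P\otimes A$. (B3) $\delta\mu=(\mu\otimes1)\delta_r$. (B4) $\varepsilon\mu=(\varepsilon\otimes\varepsilon)\iota$. (B5) $\varepsilon\eta=\varepsilon$. (B6) $(\eta s\otimes1)\delta\eta=\delta\eta=(\eta t\otimes1)\delta\eta$. *Quantum groupoids.* Let $\delta_P=(1\otimes1\otimes\delta_r)\delta_l:P\to A\otimes A\otimes P\otimes A$. A quantum groupoid is a quantum category with comonoid isomorphisms $\upsilon:C^{oo}\to C$ and $\nu:A^o\to A$ and an isomorphism $\theta:P_l\to P_r$ of left $A\otimes A\otimes A$-comodules,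 where $P_l$ and $P_r$ are $P$ with the coactions $$(1\otimes1\otimes c_{P,A})(1\otimes1\otimes1\otimes\nu)\delta_P,\qquad c_{A,A\otimes A\otimes P}^{-1}(1\otimes1\otimes1\otimes\nu^{-1})\delta_P,$$ such that (G1) $s\nu=t$; (G2) $t\nu=\upsilon s$; (G3) $(1\otimes1\otimes\upsilon)\,c_{C,C\otimes C}\,\varsigma=\varsigma\,\theta$, where $\varsigma=(s\otimes1\otimes t)(\gamma_r\otimes1)\iota:P\to C\otimes C\otimes C$. **Theorem.** Let $R$ be a separable Frobenius monoid in $Q\mathcal V$. Let $A=R\otimes R$, with the monoid structure of $R^o\otimes R$, that is, with multiplication $(\mu c\otimes\mu)(1\otimes c\otimes1)$ and unit $\eta\otimes\eta$, and with comultiplication $1\otimes\delta\eta\otimes1$ and counit $\varepsilon\mu$. Then: 1. $A$ is a weak bimonoid, and $\nu=(\kappa\otimes1)\,c_{R,R}:A\to A$, where $\kappa=(\varepsilon\mu\otimes1)(1\otimes c)(\delta\eta\otimes1):R\to R$, is an antipode for it. Thus $A$ is a weak Hopf monoid. Moreover $\nu$ is invertible. 2. The target morphism $t$ of $A$ is idempotent.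 Let $A\xrightarrow{\,p\,}C\xrightarrow{\,i\,}A$ be a splitting of it ($ip=t$, $pi=1$). With comultiplication $(p\otimes p)\delta i$, counit $\varepsilon i$, multiplication $p\mu(i\otimes i)$ and unit $p\eta$, $C$ is a separable Frobenius monoid. 3. There is a quantum groupoid in $Q\mathcal V$ with comonoid of arrows $A$ and comonoid of objects $C$, whose source is $ps$ and target $pt$, whose composition is $\mu\iota$ (the restriction of the multiplication of $A$ to $A\otimes_CA$), whose unit is $i$, whose $\nu$ is the antipode, with $\upsilon=p\nu\nu i$ and with $\theta:A\otimes_CA\to A\otimes_CA$ the restriction of $(1\otimes\nu)(1\otimes\mu)(c\otimes1)(1\otimes\delta):A\otimes A\to A\otimes A$. Hence any separable Frobenius monoid in $Q\mathcal V$ yields a quantum groupoid. -/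

import Mathlib

open CategoryTheory MonoidalCategory Idempotents MonObj ComonObj

universe v u

namespace WeakHopf

/-! ### The Cauchy completion of a braided monoidal category -/

section Karoubi

variable {V : Type u} [Category.{v} V] [MonoidalCategory V]

/-- The tensor product `(X, e) ⊗ (X', e') = (X ⊗ X', e ⊗ e')` on the Cauchy completion
(Karoubi envelope) of a monoidal category. -/
instance karoubiStruct : MonoidalCategoryStruct (Karoubi V) where
  tensorObj P Q := ⟨P.X ⊗ Q.X, P.p ⊗ₘ Q.p, by simp⟩
  whiskerLeft P _ _ f := ⟨P.p ⊗ₘ f.f, by simp⟩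
  whiskerRight f Q := ⟨f.f ⊗ₘ Q.p, by simp⟩
  tensorHom f g := ⟨f.f ⊗ₘ g.f, by simp⟩
  tensorUnit := ⟨𝟙_ V, 𝟙 _, by simp⟩
  associator P Q S :=
    { hom := ⟨((P.p ⊗ₘ Q.p) ⊗ₘ S.p) ≫ (α_ P.X Q.X S.X).hom, by
        simp only [Category.assoc, ← associator_naturality, tensorHom_comp_tensorHom,
          tensorHom_comp_tensorHom_assoc, Karoubi.idem]⟩
      inv := ⟨(P.p ⊗ₘ (Q.p ⊗ₘ S.p)) ≫ (α_ P.X Q.X S.X).inv, by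
        simp only [Category.assoc, ← associator_inv_naturality, tensorHom_comp_tensorHom,
          tensorHom_comp_tensorHom_assoc,
          Karoubi.idem]⟩
      hom_inv_id := by
        ext
        simp only [Karoubi.comp_f, Category.assoc, ← associator_naturality_assoc,
          tensorHom_comp_tensorHom, Karoubi.idem, Iso.hom_inv_id, Category.comp_id,
          Karoubi.id_f]
      inv_hom_id := by
        ext
        simp only [Karoubi.comp_f, Category.assoc, ← associator_inv_naturality_assoc,
          tensorHom_comp_tensorHom, Karoubi.idem, Iso.inv_hom_id, Category.comp_id,
          Karoubi.id_f] }
  leftUnitor P :=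
    { hom := ⟨(𝟙 (𝟙_ V) ⊗ₘ P.p) ≫ (λ_ P.X).hom, by simp⟩
      inv := ⟨P.p ≫ (λ_ P.X).inv, by simp⟩
      hom_inv_id := by
        ext
        simp
      inv_hom_id := by
        ext
        simp }
  rightUnitor P :=
    { hom := ⟨(P.p ⊗ₘ 𝟙 (𝟙_ V)) ≫ (ρ_ P.X).hom, by simp⟩
      inv := ⟨P.p ≫ (ρ_ P.X).inv, by simp⟩
      hom_inv_id := by
        ext
        simp
      inv_hom_id := by
        ext
        simp }

section
variable (P Q S : Karoubi V) {P' Q' : Karoubi V} (f : P ⟶ P') (g : Q ⟶ Q')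
theorem karoubi_tensor_p : (P ⊗ Q).p = P.p ⊗ₘ Q.p := rfl
theorem karoubi_tensor_X : (P ⊗ Q).X = P.X ⊗ Q.X := rfl
theorem karoubi_whiskerLeft_f : (P ◁ g).f = P.p ⊗ₘ g.f := rfl
theorem karoubi_whiskerRight_f : (f ▷ Q).f = f.f ⊗ₘ Q.p := rfl
theorem karoubi_tensorHom_f : (f ⊗ₘ g).f = f.f ⊗ₘ g.f := rfl
theorem karoubi_associator_hom_f :
    (α_ P Q S).hom.f = ((P.p ⊗ₘ Q.p) ⊗ₘ S.p) ≫ (α_ P.X Q.X S.X).hom := rfl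
theorem karoubi_associator_inv_f :
    (α_ P Q S).inv.f = (P.p ⊗ₘ (Q.p ⊗ₘ S.p)) ≫ (α_ P.X Q.X S.X).inv := rfl
theorem karoubi_leftUnitor_hom_f :
    (λ_ P).hom.f = (𝟙 (𝟙_ V) ⊗ₘ P.p) ≫ (λ_ P.X).hom := rfl
theorem karoubi_rightUnitor_hom_f :
    (ρ_ P).hom.f = (P.p ⊗ₘ 𝟙 (𝟙_ V)) ≫ (ρ_ P.X).hom := rfl
theorem karoubi_unit_p : (𝟙_ (Karoubi V)).p = 𝟙 (𝟙_ V) := rfl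
theorem karoubi_unit_X : (𝟙_ (Karoubi V)).X = 𝟙_ V := rfl
end

instance karoubiMonoidal : MonoidalCategory (Karoubi V) := .ofTensorHom
  (id_tensorHom_id := fun _ _ => rfl)
  (id_tensorHom := fun _ _ _ _ => rfl)
  (tensorHom_id := fun _ _ => rfl)
  (tensorHom_comp_tensorHom := fun f₁ f₂ g₁ g₂ => by
    ext
    exact tensorHom_comp_tensorHom f₁.f f₂.f g₁.f g₂.f)
  (associator_naturality := fun f₁ f₂ f₃ => by
    ext
    simp only [Karoubi.comp_f, karoubi_tensorHom_f, karoubi_associator_hom_f, Category.assoc,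
      ← associator_naturality, tensorHom_comp_tensorHom,
      tensorHom_comp_tensorHom_assoc, Karoubi.p_comp, Karoubi.comp_p])
  (leftUnitor_naturality := fun f => by
    ext
    simp [karoubi_tensorHom_f, karoubi_leftUnitor_hom_f, karoubi_unit_p, karoubi_unit_X])
  (rightUnitor_naturality := fun f => by
    ext
    simp [karoubi_tensorHom_f, karoubi_rightUnitor_hom_f, karoubi_unit_p, karoubi_unit_X])
  (pentagon := fun W X Y Z => by
    ext
    change ((((W.p ⊗ₘ X.p) ⊗ₘ Y.p) ≫ (α_ W.X X.X Y.X).hom) ⊗ₘ Z.p) ≫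
        (((W.p ⊗ₘ (X.p ⊗ₘ Y.p)) ⊗ₘ Z.p) ≫ (α_ W.X (X.X ⊗ Y.X) Z.X).hom) ≫
          (W.p ⊗ₘ (((X.p ⊗ₘ Y.p) ⊗ₘ Z.p) ≫ (α_ X.X Y.X Z.X).hom)) =
      ((((W.p ⊗ₘ X.p) ⊗ₘ Y.p) ⊗ₘ Z.p) ≫ (α_ (W.X ⊗ X.X) Y.X Z.X).hom) ≫
        (((W.p ⊗ₘ X.p) ⊗ₘ (Y.p ⊗ₘ Z.p)) ≫ (α_ W.X X.X (Y.X ⊗ Z.X)).hom)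
    have h₁ : ((((W.p ⊗ₘ X.p) ⊗ₘ Y.p) ≫ (α_ W.X X.X Y.X).hom) ⊗ₘ Z.p) =
        (((W.p ⊗ₘ X.p) ⊗ₘ Y.p) ⊗ₘ Z.p) ≫ (α_ W.X X.X Y.X).hom ▷ Z.X := by
      rw [← tensorHom_id, tensorHom_comp_tensorHom, Category.comp_id]
    have h₂ : (W.p ⊗ₘ (((X.p ⊗ₘ Y.p) ⊗ₘ Z.p) ≫ (α_ X.X Y.X Z.X).hom)) =
        W.X ◁ (α_ X.X Y.X Z.X).hom ≫ (W.p ⊗ₘ (X.p ⊗ₘ (Y.p ⊗ₘ Z.p))) := by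
      rw [← id_tensorHom, tensorHom_comp_tensorHom, Category.id_comp, associator_naturality]
    have h₃ : ((W.p ⊗ₘ (X.p ⊗ₘ Y.p)) ⊗ₘ Z.p) ≫ (α_ W.X (X.X ⊗ Y.X) Z.X).hom ≫
          W.X ◁ (α_ X.X Y.X Z.X).hom =
        (α_ W.X (X.X ⊗ Y.X) Z.X).hom ≫ W.X ◁ (α_ X.X Y.X Z.X).hom ≫
          (W.p ⊗ₘ (X.p ⊗ₘ (Y.p ⊗ₘ Z.p))) := by
      rw [associator_naturality_assoc, ← h₂, ← id_tensorHom, tensorHom_comp_tensorHom,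
        Category.comp_id]
    have h₄ : (W.p ⊗ₘ (X.p ⊗ₘ (Y.p ⊗ₘ Z.p))) ≫ (W.p ⊗ₘ (X.p ⊗ₘ (Y.p ⊗ₘ Z.p))) =
        (W.p ⊗ₘ (X.p ⊗ₘ (Y.p ⊗ₘ Z.p))) := by
      simp only [tensorHom_comp_tensorHom, Karoubi.idem]
    rw [h₁, h₂, Category.assoc, Category.assoc, Category.assoc, reassoc_of% h₃, h₄,
      pentagon_assoc, associator_naturality, associator_naturality_assoc])
  (triangle := fun X Y => by
    ext
    change (((X.p ⊗ₘ 𝟙 (𝟙_ V)) ⊗ₘ Y.p) ≫ (α_ X.X (𝟙_ V) Y.X).hom) ≫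
        (X.p ⊗ₘ ((𝟙 (𝟙_ V) ⊗ₘ Y.p) ≫ (λ_ Y.X).hom)) =
      ((X.p ⊗ₘ 𝟙 (𝟙_ V)) ≫ (ρ_ X.X).hom) ⊗ₘ Y.p
    have h₁ : X.p ⊗ₘ ((𝟙 (𝟙_ V) ⊗ₘ Y.p) ≫ (λ_ Y.X).hom) =
        (X.p ⊗ₘ (𝟙 (𝟙_ V) ⊗ₘ Y.p)) ≫ X.X ◁ (λ_ Y.X).hom := by
      rw [← id_tensorHom X.X, tensorHom_comp_tensorHom, Category.comp_id]
    have h₂ : ((X.p ⊗ₘ 𝟙 (𝟙_ V)) ≫ (ρ_ X.X).hom) ⊗ₘ Y.p =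
        ((X.p ⊗ₘ 𝟙 (𝟙_ V)) ⊗ₘ Y.p) ≫ (ρ_ X.X).hom ▷ Y.X := by
      rw [← tensorHom_id _ Y.X, tensorHom_comp_tensorHom, Category.comp_id]
    rw [h₁, h₂, Category.assoc, ← associator_naturality_assoc, tensorHom_comp_tensorHom_assoc,
      tensorHom_comp_tensorHom, triangle, Karoubi.idem, Karoubi.idem, Category.comp_id])

variable [BraidedCategory V]

/-- The braiding of the Cauchy completion: the component at `(X, e), (Y, e')` is
`c_{X,Y} ∘ (e ⊗ e')`. -/
instance karoubiBraided : BraidedCategory (Karoubi V) where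
  braiding P Q :=
    { hom := ⟨(P.p ⊗ₘ Q.p) ≫ (β_ P.X Q.X).hom, by
        simp only [karoubi_tensor_p, Category.assoc, ← BraidedCategory.braiding_naturality,
          tensorHom_comp_tensorHom_assoc, Karoubi.idem]⟩
      inv := ⟨(Q.p ⊗ₘ P.p) ≫ (β_ P.X Q.X).inv, by
        simp only [karoubi_tensor_p, Category.assoc, ← BraidedCategory.braiding_inv_naturality,
          tensorHom_comp_tensorHom_assoc, Karoubi.idem]⟩
      hom_inv_id := by
        ext
        simp only [Karoubi.comp_f, Category.assoc, ← BraidedCategory.braiding_naturality_assoc,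
          tensorHom_comp_tensorHom_assoc, Karoubi.idem, Iso.hom_inv_id, Category.comp_id,
          Karoubi.id_f, karoubi_tensor_p, tensorHom_comp_tensorHom]
      inv_hom_id := by
        ext
        simp only [Karoubi.comp_f, Category.assoc, ← BraidedCategory.braiding_inv_naturality_assoc,
          tensorHom_comp_tensorHom_assoc, Karoubi.idem, Iso.inv_hom_id, Category.comp_id,
          Karoubi.id_f, karoubi_tensor_p, tensorHom_comp_tensorHom] }
  braiding_naturality_right X {Y Z} f := by
    ext
    change (X.p ⊗ₘ f.f) ≫ (X.p ⊗ₘ Z.p) ≫ (β_ X.X Z.X).hom =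
      ((X.p ⊗ₘ Y.p) ≫ (β_ X.X Y.X).hom) ≫ (f.f ⊗ₘ X.p)
    simp only [Category.assoc, ← BraidedCategory.braiding_naturality,
      tensorHom_comp_tensorHom_assoc, Karoubi.idem, Karoubi.p_comp, Karoubi.comp_p]
  braiding_naturality_left {X Y} f Z := by
    ext
    change (f.f ⊗ₘ Z.p) ≫ (Y.p ⊗ₘ Z.p) ≫ (β_ Y.X Z.X).hom =
      ((X.p ⊗ₘ Z.p) ≫ (β_ X.X Z.X).hom) ≫ (Z.p ⊗ₘ f.f)
    simp only [Category.assoc, ← BraidedCategory.braiding_naturality,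
      tensorHom_comp_tensorHom_assoc, Karoubi.idem, Karoubi.p_comp, Karoubi.comp_p]
  hexagon_forward X Y Z := by
    ext
    change (((X.p ⊗ₘ Y.p) ⊗ₘ Z.p) ≫ (α_ X.X Y.X Z.X).hom) ≫
        ((X.p ⊗ₘ (Y.p ⊗ₘ Z.p)) ≫ (β_ X.X (Y.X ⊗ Z.X)).hom) ≫
          (((Y.p ⊗ₘ Z.p) ⊗ₘ X.p) ≫ (α_ Y.X Z.X X.X).hom) =
      (((X.p ⊗ₘ Y.p) ≫ (β_ X.X Y.X).hom) ⊗ₘ Z.p) ≫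
        (((Y.p ⊗ₘ X.p) ⊗ₘ Z.p) ≫ (α_ Y.X X.X Z.X).hom) ≫
          (Y.p ⊗ₘ ((X.p ⊗ₘ Z.p) ≫ (β_ X.X Z.X).hom))
    have h₁ : ((X.p ⊗ₘ Y.p) ≫ (β_ X.X Y.X).hom) ⊗ₘ Z.p =
        ((X.p ⊗ₘ Y.p) ⊗ₘ Z.p) ≫ (β_ X.X Y.X).hom ▷ Z.X := by
      rw [← tensorHom_id, tensorHom_comp_tensorHom, Category.comp_id]
    have h₂ : Y.p ⊗ₘ ((X.p ⊗ₘ Z.p) ≫ (β_ X.X Z.X).hom) =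
        (Y.p ⊗ₘ (X.p ⊗ₘ Z.p)) ≫ Y.X ◁ (β_ X.X Z.X).hom := by
      rw [← id_tensorHom Y.X, tensorHom_comp_tensorHom, Category.comp_id]
    have h₃ : (β_ X.X Y.X).hom ▷ Z.X ≫ ((Y.p ⊗ₘ X.p) ⊗ₘ Z.p) =
        ((X.p ⊗ₘ Y.p) ⊗ₘ Z.p) ≫ (β_ X.X Y.X).hom ▷ Z.X := by
      rw [← tensorHom_id, tensorHom_comp_tensorHom, tensorHom_comp_tensorHom,
        BraidedCategory.braiding_naturality, Category.comp_id, Category.id_comp]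
    simp only [h₁, h₂, Category.assoc, ← associator_naturality_assoc, ← associator_naturality,
      ← BraidedCategory.braiding_naturality_assoc, tensorHom_comp_tensorHom_assoc, reassoc_of% h₃,
      tensorHom_comp_tensorHom, Karoubi.idem, BraidedCategory.hexagon_forward]
  hexagon_reverse X Y Z := by
    ext
    change ((X.p ⊗ₘ (Y.p ⊗ₘ Z.p)) ≫ (α_ X.X Y.X Z.X).inv) ≫
        (((X.p ⊗ₘ Y.p) ⊗ₘ Z.p) ≫ (β_ (X.X ⊗ Y.X) Z.X).hom) ≫
          ((Z.p ⊗ₘ (X.p ⊗ₘ Y.p)) ≫ (α_ Z.X X.X Y.X).inv) =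
      (X.p ⊗ₘ ((Y.p ⊗ₘ Z.p) ≫ (β_ Y.X Z.X).hom)) ≫
        ((X.p ⊗ₘ (Z.p ⊗ₘ Y.p)) ≫ (α_ X.X Z.X Y.X).inv) ≫
          (((X.p ⊗ₘ Z.p) ≫ (β_ X.X Z.X).hom) ⊗ₘ Y.p)
    have h₁ : X.p ⊗ₘ ((Y.p ⊗ₘ Z.p) ≫ (β_ Y.X Z.X).hom) =
        (X.p ⊗ₘ (Y.p ⊗ₘ Z.p)) ≫ X.X ◁ (β_ Y.X Z.X).hom := by
      rw [← id_tensorHom X.X, tensorHom_comp_tensorHom, Category.comp_id]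
    have h₂ : ((X.p ⊗ₘ Z.p) ≫ (β_ X.X Z.X).hom) ⊗ₘ Y.p =
        ((X.p ⊗ₘ Z.p) ⊗ₘ Y.p) ≫ (β_ X.X Z.X).hom ▷ Y.X := by
      rw [← tensorHom_id, tensorHom_comp_tensorHom, Category.comp_id]
    have h₃ : X.X ◁ (β_ Y.X Z.X).hom ≫ (X.p ⊗ₘ (Z.p ⊗ₘ Y.p)) =
        (X.p ⊗ₘ (Y.p ⊗ₘ Z.p)) ≫ X.X ◁ (β_ Y.X Z.X).hom := by
      rw [← id_tensorHom X.X, tensorHom_comp_tensorHom, tensorHom_comp_tensorHom,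
        BraidedCategory.braiding_naturality, Category.comp_id, Category.id_comp]
    simp only [h₁, h₂, Category.assoc, ← associator_inv_naturality_assoc,
      ← associator_inv_naturality, ← BraidedCategory.braiding_naturality_assoc,
      tensorHom_comp_tensorHom_assoc, reassoc_of% h₃,
      tensorHom_comp_tensorHom, Karoubi.idem, BraidedCategory.hexagon_reverse]

end Karoubi
/-! ### Frobenius monoids and the monoid and comonoid structures on `R ⊗ R` -/

section Frobenius

variable {𝒞 : Type u} [Category.{v} 𝒞] [MonoidalCategory 𝒞]

/-- Frobenius monoid: a monoid and comonoid with `(1 ⊗ μ)(δ ⊗ 1) = (μ ⊗ 1)(1 ⊗ δ)`. -/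
class IsFrobenius (R : 𝒞) [MonObj R] [ComonObj R] : Prop where
  frobenius : Δ[R] ▷ R ≫ (α_ R R R).hom ≫ R ◁ μ[R] = R ◁ Δ[R] ≫ (α_ R R R).inv ≫ μ[R] ▷ R

/-- Separable Frobenius monoid: a Frobenius monoid with `μ δ = 1`. -/
class IsSeparableFrobenius (R : 𝒞) [MonObj R] [ComonObj R] : Prop extends IsFrobenius R where
  comul_mul : Δ[R] ≫ μ[R] = 𝟙 R

theorem snake_left (R : 𝒞) [MonObj R] [ComonObj R] [IsFrobenius R] :
    (ρ_ R).inv ≫ R ◁ (η[R] ≫ Δ[R]) ≫ (α_ R R R).inv ≫ (μ[R] ≫ ε[R]) ▷ R = (λ_ R).inv := by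
  have h := IsFrobenius.frobenius (R := R)
  calc _ = (ρ_ R).inv ≫ R ◁ η ≫ (R ◁ Δ[R] ≫ (α_ R R R).inv ≫ μ[R] ▷ R) ≫ ε ▷ R := by simp
    _ = (ρ_ R).inv ≫ (R ◁ η ≫ Δ[R] ▷ R) ≫ (α_ R R R).hom ≫ R ◁ μ[R] ≫ ε ▷ R := by
      rw [← h]; simp
    _ = (ρ_ R).inv ≫ Δ[R] ▷ _ ≫ (α_ R R _).hom ≫ R ◁ (R ◁ η ≫ μ[R]) ≫ ε ▷ R := by
      rw [whisker_exchange]; monoidal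
    _ = Δ[R] ≫ ε ▷ R := by
      rw [MonObj.mul_one]
      monoidal
    _ = _ := ComonObj.counit_comul R

theorem snake_right (R : 𝒞) [MonObj R] [ComonObj R] [IsFrobenius R] :
    (λ_ R).inv ≫ (η[R] ≫ Δ[R]) ▷ R ≫ (α_ R R R).hom ≫ R ◁ (μ[R] ≫ ε[R]) = (ρ_ R).inv := by
  have h := IsFrobenius.frobenius (R := R)
  calc _ = (λ_ R).inv ≫ η ▷ R ≫ (Δ[R] ▷ R ≫ (α_ R R R).hom ≫ R ◁ μ[R]) ≫ R ◁ ε := by simp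
    _ = (λ_ R).inv ≫ (η ▷ R ≫ R ◁ Δ[R]) ≫ (α_ R R R).inv ≫ μ[R] ▷ R ≫ R ◁ ε := by
      rw [h]; simp
    _ = (λ_ R).inv ≫ _ ◁ Δ[R] ≫ (α_ _ R R).inv ≫ (η ▷ R ≫ μ[R]) ▷ R ≫ R ◁ ε := by
      rw [← whisker_exchange]; monoidal
    _ = Δ[R] ≫ R ◁ ε := by
      rw [MonObj.one_mul]
      monoidal
    _ = _ := ComonObj.comul_counit R

theorem op_mul_assoc [BraidedCategory 𝒞] (R : 𝒞) [MonObj R] :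
    ((β_ R R).hom ≫ μ[R]) ▷ R ≫ (β_ R R).hom ≫ μ[R] =
      (α_ R R R).hom ≫ R ◁ ((β_ R R).hom ≫ μ[R]) ≫ (β_ R R).hom ≫ μ[R] := by
  have h : (β_ R R).hom ▷ R ≫ (β_ (R ⊗ R) R).hom =
      (α_ R R R).hom ≫ R ◁ (β_ R R).hom ≫ (β_ R (R ⊗ R)).hom ≫ (α_ R R R).hom := by
    simp [BraidedCategory.braiding_tensor_left_hom, BraidedCategory.braiding_tensor_right_hom,
      ← BraidedCategory.yang_baxter]
  simp only [comp_whiskerRight, whiskerLeft_comp, Category.assoc,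
    BraidedCategory.braiding_naturality_left_assoc, BraidedCategory.braiding_naturality_right_assoc,
    MonObj.mul_assoc, reassoc_of% h]

/-- The opposite monoid `R^o` of a monoid `R` in a braided monoidal category: the multiplication
is `μ ∘ c`. -/
def OppositeMonoid (R : 𝒞) : 𝒞 := R

instance [BraidedCategory 𝒞] (R : 𝒞) [MonObj R] : MonObj (OppositeMonoid R) where
  one := (η[R] : 𝟙_ 𝒞 ⟶ R)
  mul := ((β_ R R).hom ≫ μ[R] : R ⊗ R ⟶ R)
  one_mul := by
    change η[R] ▷ R ≫ (β_ R R).hom ≫ μ[R] = (λ_ R).hom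
    simp
  mul_one := by
    change R ◁ η[R] ≫ (β_ R R).hom ≫ μ[R] = (ρ_ R).hom
    simp
  mul_assoc := op_mul_assoc R

theorem cup_cup {R : 𝒞} (c : 𝟙_ 𝒞 ⟶ R ⊗ R) :
    c ≫ (ρ_ _).inv ≫ (R ⊗ R) ◁ c = c ≫ (λ_ _).inv ≫ c ▷ (R ⊗ R) := by
  rw [rightUnitor_inv_naturality_assoc, leftUnitor_inv_naturality_assoc, whisker_exchange,
    unitors_inv_equal]

/-- The object `R ⊗ R`, to be equipped with the monoid structure of `R^o ⊗ R` and with the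
comonoid structure coming from the self-duality `R ⊣ R` of a Frobenius monoid. It is a separate
name for `R ⊗ R`, so that no other (co)monoid structure on `R ⊗ R` interferes. -/
def FrobeniusSquare (R : 𝒞) : 𝒞 := R ⊗ R

/-- The monoid `R^o ⊗ R`: unit `η ⊗ η`, multiplication
`(μ c ⊗ μ)(1 ⊗ c ⊗ 1) : R ⊗ R ⊗ R ⊗ R ⟶ R ⊗ R`. -/
instance [BraidedCategory 𝒞] (R : 𝒞) [MonObj R] : MonObj (FrobeniusSquare R) where
  one := ((λ_ (𝟙_ 𝒞)).inv ≫ (η[R] ⊗ₘ η[R]) : 𝟙_ 𝒞 ⟶ R ⊗ R)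
  mul := (tensorμ R R R R ≫ (((β_ R R).hom ≫ μ[R]) ⊗ₘ μ[R]) : (R ⊗ R) ⊗ (R ⊗ R) ⟶ R ⊗ R)
  one_mul := MonObj.one_mul (OppositeMonoid R ⊗ R)
  mul_one := MonObj.mul_one (OppositeMonoid R ⊗ R)
  mul_assoc := MonObj.mul_assoc (OppositeMonoid R ⊗ R)

/-- The comonoid `R ⊗ R`: counit `ε μ`, comultiplication `1 ⊗ δη ⊗ 1`. -/
instance (R : 𝒞) [MonObj R] [ComonObj R] [IsFrobenius R] : ComonObj (FrobeniusSquare R) where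
  counit := (μ[R] ≫ ε[R] : R ⊗ R ⟶ 𝟙_ 𝒞)
  comul := ((ρ_ R).inv ▷ R ≫ (R ◁ (η[R] ≫ Δ[R])) ▷ R ≫ (α_ R R R).inv ▷ R ≫
    (α_ (R ⊗ R) R R).hom : R ⊗ R ⟶ (R ⊗ R) ⊗ (R ⊗ R))
  counit_comul := by
    have h := congrArg (· ▷ R) (snake_left R)
    change ((ρ_ R).inv ▷ R ≫ (R ◁ (η[R] ≫ Δ[R])) ▷ R ≫ (α_ R R R).inv ▷ R ≫
      (α_ (R ⊗ R) R R).hom) ≫ (μ[R] ≫ ε[R]) ▷ (R ⊗ R) = (λ_ (R ⊗ R)).inv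
    generalize η[R] ≫ Δ[R] = c at *
    generalize μ[R] ≫ ε[R] = e at *
    calc _ = ((ρ_ R).inv ≫ R ◁ c ≫ (α_ R R R).inv ≫ e ▷ R) ▷ R ≫ (α_ _ R R).hom := by monoidal
      _ = (λ_ R).inv ▷ R ≫ (α_ _ R R).hom := by simp only [h]
      _ = _ := by monoidal
  comul_counit := by
    have h := congrArg (R ◁ ·) (snake_right R)
    change ((ρ_ R).inv ▷ R ≫ (R ◁ (η[R] ≫ Δ[R])) ▷ R ≫ (α_ R R R).inv ▷ R ≫
      (α_ (R ⊗ R) R R).hom) ≫ (R ⊗ R) ◁ (μ[R] ≫ ε[R]) = (ρ_ (R ⊗ R)).inv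
    generalize η[R] ≫ Δ[R] = c at *
    generalize μ[R] ≫ ε[R] = e at *
    calc _ = R ◁ ((λ_ R).inv ≫ c ▷ R ≫ (α_ R R R).hom ≫ R ◁ e) ≫ (α_ R R _).inv := by monoidal
      _ = R ◁ (ρ_ R).inv ≫ (α_ R R _).inv := by simp only [h]
      _ = _ := by monoidal
  comul_assoc := by
    change ((ρ_ R).inv ▷ R ≫ (R ◁ (η[R] ≫ Δ[R])) ▷ R ≫ (α_ R R R).inv ▷ R ≫
        (α_ (R ⊗ R) R R).hom) ≫ (R ⊗ R) ◁ ((ρ_ R).inv ▷ R ≫ (R ◁ (η[R] ≫ Δ[R])) ▷ R ≫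
        (α_ R R R).inv ▷ R ≫ (α_ (R ⊗ R) R R).hom) =
      ((ρ_ R).inv ▷ R ≫ (R ◁ (η[R] ≫ Δ[R])) ▷ R ≫ (α_ R R R).inv ▷ R ≫
        (α_ (R ⊗ R) R R).hom) ≫ ((ρ_ R).inv ▷ R ≫ (R ◁ (η[R] ≫ Δ[R])) ▷ R ≫
        (α_ R R R).inv ▷ R ≫ (α_ (R ⊗ R) R R).hom) ▷ (R ⊗ R) ≫
        (α_ (R ⊗ R) (R ⊗ R) (R ⊗ R)).hom
    generalize η[R] ≫ Δ[R] = c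
    calc _ = 𝟙 _ ⊗≫ R ◁ (c ≫ (ρ_ _).inv ≫ (R ⊗ R) ◁ c) ▷ R ⊗≫ 𝟙 _ := by monoidal
      _ = 𝟙 _ ⊗≫ R ◁ (c ≫ (λ_ _).inv ≫ c ▷ (R ⊗ R)) ▷ R ⊗≫ 𝟙 _ := by rw [cup_cup]
      _ = _ := by monoidal

/-- The endomorphism `(εμ ⊗ 1)(1 ⊗ c)(δη ⊗ 1)` of `R`. -/
def curl [BraidedCategory 𝒞] (R : 𝒞) [MonObj R] [ComonObj R] : R ⟶ R :=
  (λ_ R).inv ≫ (η[R] ≫ Δ[R]) ▷ R ≫ (α_ R R R).hom ≫ R ◁ (β_ R R).hom ≫ (α_ R R R).inv ≫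
    (μ[R] ≫ ε[R]) ▷ R ≫ (λ_ R).hom

/-- The antipode of `R ⊗ R`: the braiding followed by `curl` on the left factor. -/
def frobeniusAntipode [BraidedCategory 𝒞] (R : 𝒞) [MonObj R] [ComonObj R] :
    FrobeniusSquare R ⟶ FrobeniusSquare R :=
  ((β_ R R).hom ≫ curl R ▷ R : R ⊗ R ⟶ R ⊗ R)

end Frobenius

/-! ### Weak bimonoids and weak Hopf monoids -/

section WeakBimonoid

variable {𝒞 : Type u} [Category.{v} 𝒞] [MonoidalCategory 𝒞] [BraidedCategory 𝒞]

/-- Weak bimonoid: a monoid and comonoid satisfying the axioms (b), (v), (w). -/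
class IsWeakBimonoid (A : 𝒞) [MonObj A] [ComonObj A] : Prop where
  /-- (b): `δμ = (μ ⊗ μ)(1 ⊗ c ⊗ 1)(δ ⊗ δ)` -/
  mul_comul : μ[A] ≫ Δ[A] = (Δ[A] ⊗ₘ Δ[A]) ≫ tensorμ A A A A ≫ (μ[A] ⊗ₘ μ[A])
  /-- (v), first equation: `εμ₃ = (εμ ⊗ εμ)(1 ⊗ δ ⊗ 1)` -/
  mul_counit : μ[A] ▷ A ≫ μ[A] ≫ ε[A] =
    (A ◁ Δ[A]) ▷ A ≫ (α_ A A A).inv ▷ A ≫ (α_ (A ⊗ A) A A).hom ≫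
      ((μ[A] ≫ ε[A]) ⊗ₘ (μ[A] ≫ ε[A])) ≫ (λ_ (𝟙_ 𝒞)).hom
  /-- (v), second equation: `εμ₃ = (εμ ⊗ εμ)(1 ⊗ c⁻¹δ ⊗ 1)` -/
  mul_counit' : μ[A] ▷ A ≫ μ[A] ≫ ε[A] =
    (A ◁ (Δ[A] ≫ (β_ A A).inv)) ▷ A ≫ (α_ A A A).inv ▷ A ≫ (α_ (A ⊗ A) A A).hom ≫
      ((μ[A] ≫ ε[A]) ⊗ₘ (μ[A] ≫ ε[A])) ≫ (λ_ (𝟙_ 𝒞)).hom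
  /-- (w), first equation: `δ₃η = (1 ⊗ μ ⊗ 1)(δη ⊗ δη)` -/
  unit_comul : η[A] ≫ Δ[A] ≫ Δ[A] ▷ A =
    (λ_ (𝟙_ 𝒞)).inv ≫ ((η[A] ≫ Δ[A]) ⊗ₘ (η[A] ≫ Δ[A])) ≫ (α_ (A ⊗ A) A A).inv ≫
      (α_ A A A).hom ▷ A ≫ (A ◁ μ[A]) ▷ A
  /-- (w), second equation: `δ₃η = (1 ⊗ μc⁻¹ ⊗ 1)(δη ⊗ δη)` -/
  unit_comul' : η[A] ≫ Δ[A] ≫ Δ[A] ▷ A =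
    (λ_ (𝟙_ 𝒞)).inv ≫ ((η[A] ≫ Δ[A]) ⊗ₘ (η[A] ≫ Δ[A])) ≫ (α_ (A ⊗ A) A A).inv ≫
      (α_ A A A).hom ▷ A ≫ (A ◁ ((β_ A A).inv ≫ μ[A])) ▷ A

/-- The source morphism `s = (1 ⊗ εμ)(δη ⊗ 1)`. -/
def sourceMap (A : 𝒞) [MonObj A] [ComonObj A] : A ⟶ A :=
  (λ_ A).inv ≫ (η[A] ≫ Δ[A]) ▷ A ≫ (α_ A A A).hom ≫ A ◁ (μ[A] ≫ ε[A]) ≫ (ρ_ A).hom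

/-- The target morphism `t = (1 ⊗ εμ)(c ⊗ 1)(1 ⊗ δη)`. -/
def targetMap (A : 𝒞) [MonObj A] [ComonObj A] : A ⟶ A :=
  (ρ_ A).inv ≫ A ◁ (η[A] ≫ Δ[A]) ≫ (α_ A A A).inv ≫ (β_ A A).hom ▷ A ≫ (α_ A A A).hom ≫
    A ◁ (μ[A] ≫ ε[A]) ≫ (ρ_ A).hom

/-- The morphism `r = (εμ ⊗ 1)(1 ⊗ c)(δη ⊗ 1)`. -/
def rMap (A : 𝒞) [MonObj A] [ComonObj A] : A ⟶ A :=
  (λ_ A).inv ≫ (η[A] ≫ Δ[A]) ▷ A ≫ (α_ A A A).hom ≫ A ◁ (β_ A A).hom ≫ (α_ A A A).inv ≫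
    (μ[A] ≫ ε[A]) ▷ A ≫ (λ_ A).hom

/-- Antipode of a weak bimonoid: `ν * 1 = t`, `1 * ν = r` and `ν * 1 * ν = ν` for the
convolution product. A weak Hopf monoid is a weak bimonoid with an antipode. -/
structure IsAntipode {A : 𝒞} [MonObj A] [ComonObj A] (ν : A ⟶ A) : Prop where
  antipode_id : Δ[A] ≫ ν ▷ A ≫ μ[A] = targetMap A
  id_antipode : Δ[A] ≫ A ◁ ν ≫ μ[A] = rMap A
  antipode_id_antipode :
    Δ[A] ≫ Δ[A] ▷ A ≫ ((ν ⊗ₘ 𝟙 A) ⊗ₘ ν) ≫ μ[A] ▷ A ≫ μ[A] = ν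

/-- `C`, with `p : A ⟶ C` and `i : C ⟶ A`, is the object-of-objects of the weak bimonoid `A`:
a splitting of the idempotent `t`, with the monoid and comonoid structures induced from `A`. -/
structure IsObjectOfObjects {A C : 𝒞} [MonObj A] [ComonObj A] [MonObj C] [ComonObj C]
    (p : A ⟶ C) (i : C ⟶ A) : Prop where
  i_p : i ≫ p = 𝟙 C
  p_i : p ≫ i = targetMap A
  comul_eq : Δ[C] = i ≫ Δ[A] ≫ (p ⊗ₘ p)
  counit_eq : ε[C] = i ≫ ε[A]
  mul_eq : μ[C] = (i ⊗ₘ i) ≫ μ[A] ≫ p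
  one_eq : η[C] = η[A] ≫ p

end WeakBimonoid

/-! ### Quantum categories and quantum groupoids -/

section QuantumGroupoid

open Limits

variable {𝒞 : Type u} [Category.{v} 𝒞] [MonoidalCategory 𝒞]

/-- `incl : P ⟶ M ⊗ N` exhibits `P` as the tensor product over `C` of a right `C`-comodule `(M, r)`
and a left `C`-comodule `(N, l)`: it is an equalizer of `r ⊗ 1, 1 ⊗ l : M ⊗ N ⟶ M ⊗ C ⊗ N`, and
the functors `X ⊗ -` preserve this (coreflexive) equalizer. -/
structure IsCotensor {C M N P : 𝒞} (r : M ⟶ M ⊗ C) (l : N ⟶ C ⊗ N) (incl : P ⟶ M ⊗ N) : Prop where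
  condition : incl ≫ r ▷ N = incl ≫ M ◁ l ≫ (α_ M C N).inv
  isLimit : Nonempty (IsLimit (Fork.ofι incl condition))
  preserves : ∀ X : 𝒞,
    PreservesLimit (parallelPair (r ▷ N) (M ◁ l ≫ (α_ M C N).inv)) (tensorLeft X)

variable [BraidedCategory 𝒞]

/-- The left `C`-coaction `γ_l = c⁻¹(1 ⊗ s)δ` on `A`. -/
def leftCoaction {A C : 𝒞} [ComonObj A] (s : A ⟶ C) : A ⟶ C ⊗ A :=
  Δ[A] ≫ A ◁ s ≫ (β_ C A).inv

/-- The right `C`-coaction `γ_r = (1 ⊗ t)δ` on `A`. -/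
def rightCoaction {A C : 𝒞} [ComonObj A] (t : A ⟶ C) : A ⟶ A ⊗ C :=
  Δ[A] ≫ A ◁ t

/-- A quantum category with object-of-arrows `A` and object-of-objects `C`. The morphisms
`leftP`, `rightP`, `δl`, `δr`, `mulId`, `idMul`, `unitL`, `unitR` are induced ones: each is the
unique morphism satisfying the equation which follows it, because the tensor products over `C`
are equalizers preserved by tensoring. -/
structure QuantumCategory (A C : 𝒞) [ComonObj A] [ComonObj C] where
  /-- source, a comonoid morphism from `A` to the opposite comonoid of `C` -/
  s : A ⟶ C
  /-- target, a comonoid morphism -/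
  t : A ⟶ C
  s_counit : s ≫ ε[C] = ε[A]
  s_comul : s ≫ Δ[C] ≫ (β_ C C).hom = Δ[A] ≫ (s ⊗ₘ s)
  t_counit : t ≫ ε[C] = ε[A]
  t_comul : t ≫ Δ[C] = Δ[A] ≫ (t ⊗ₘ t)
  /-- `c(s ⊗ t)δ = (t ⊗ s)δ`; this makes `A` a `C`-bicomodule -/
  s_t : Δ[A] ≫ (s ⊗ₘ t) ≫ (β_ C C).hom = Δ[A] ≫ (t ⊗ₘ s)
  /-- `P = A ⊗_C A` -/
  P : 𝒞
  incl : P ⟶ A ⊗ A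
  isCotensor : IsCotensor (rightCoaction t) (leftCoaction s) incl
  /-- the left coaction of `C` on `P` -/
  leftP : P ⟶ C ⊗ P
  leftP_incl : leftP ≫ C ◁ incl = incl ≫ leftCoaction s ▷ A ≫ (α_ C A A).hom
  /-- the right coaction of `C` on `P` -/
  rightP : P ⟶ P ⊗ C
  rightP_incl : rightP ≫ incl ▷ C = incl ≫ A ◁ rightCoaction t ≫ (α_ A A C).inv
  /-- composition, a morphism of `C`-bicomodules -/
  comp : P ⟶ A
  comp_left : comp ≫ leftCoaction s = leftP ≫ C ◁ comp
  comp_right : comp ≫ rightCoaction t = rightP ≫ comp ▷ C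
  /-- unit, a morphism of `C`-bicomodules -/
  unit : C ⟶ A
  unit_left : unit ≫ leftCoaction s = Δ[C] ≫ C ◁ unit
  unit_right : unit ≫ rightCoaction t = Δ[C] ≫ unit ▷ C
  /-- `T`, with `j₁` and `j₂`, is both `P ⊗_C A` and `A ⊗_C P`, identified by the associativity
  constraint of the tensor product over `C` -/
  T : 𝒞
  j₁ : T ⟶ P ⊗ A
  j₂ : T ⟶ A ⊗ P
  isCotensor₁ : IsCotensor rightP (leftCoaction s) j₁
  isCotensor₂ : IsCotensor (rightCoaction t) leftP j₂
  j₁_j₂ : j₁ ≫ incl ▷ A ≫ (α_ A A A).hom = j₂ ≫ A ◁ incl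
  /-- `comp ⊗_C 1` -/
  mulId : T ⟶ P
  mulId_incl : mulId ≫ incl = j₁ ≫ comp ▷ A
  /-- `1 ⊗_C comp` -/
  idMul : T ⟶ P
  idMul_incl : idMul ≫ incl = j₂ ≫ A ◁ comp
  /-- (B1), associativity -/
  assoc : mulId ≫ comp = idMul ≫ comp
  /-- `unit ⊗_C 1`, precomposed with the isomorphism of `A` with `C ⊗_C A` -/
  unitL : A ⟶ P
  unitL_incl : unitL ≫ incl = leftCoaction s ≫ unit ▷ A
  /-- (B1), left unit law -/
  unitL_comp : unitL ≫ comp = 𝟙 A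
  /-- `1 ⊗_C unit`, precomposed with the isomorphism of `A` with `A ⊗_C C` -/
  unitR : A ⟶ P
  unitR_incl : unitR ≫ incl = rightCoaction t ≫ A ◁ unit
  /-- (B1), right unit law -/
  unitR_comp : unitR ≫ comp = 𝟙 A
  /-- the left coaction of `A ⊗ A` on `P` -/
  δl : P ⟶ (A ⊗ A) ⊗ P
  δl_incl : δl ≫ (A ⊗ A) ◁ incl = incl ≫ (Δ[A] ⊗ₘ Δ[A]) ≫ tensorμ A A A A
  /-- (B2) -/
  b2 : δl ≫ (t ⊗ₘ ε[A]) ▷ P ≫ (ρ_ C).hom ▷ P ≫ C ◁ comp =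
    δl ≫ (ε[A] ⊗ₘ s) ▷ P ≫ (λ_ C).hom ▷ P ≫ C ◁ comp
  /-- the right coaction of `A` on `P` -/
  δr : P ⟶ P ⊗ A
  δr_incl : δr ≫ incl ▷ A = δl ≫ (A ⊗ A) ◁ comp
  /-- (B3) -/
  b3 : comp ≫ Δ[A] = δr ≫ comp ▷ A
  /-- (B4) -/
  b4 : comp ≫ ε[A] = incl ≫ (ε[A] ⊗ₘ ε[A]) ≫ (λ_ (𝟙_ 𝒞)).hom
  /-- (B5) -/
  b5 : unit ≫ ε[A] = ε[C]
  /-- (B6), the part with `s` -/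
  b6_s : unit ≫ Δ[A] ≫ s ▷ A ≫ unit ▷ A = unit ≫ Δ[A]
  /-- (B6), the part with `t` -/
  b6_t : unit ≫ Δ[A] ≫ t ▷ A ≫ unit ▷ A = unit ≫ Δ[A]

namespace QuantumCategory

variable {A C : 𝒞} [ComonObj A] [ComonObj C] (Q : QuantumCategory A C)

/-- The coaction `P ⟶ A ⊗ A ⊗ P ⊗ A` of `A ⊗ A` on the left and of `A` on the right. -/
def coaction : Q.P ⟶ (A ⊗ A) ⊗ (Q.P ⊗ A) :=
  Q.δl ≫ (A ⊗ A) ◁ Q.δr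

/-- The coaction `(1 ⊗ 1 ⊗ c_{P,A})(1 ⊗ 1 ⊗ 1 ⊗ ν)δ` of the left `A ⊗ A ⊗ A`-comodule `P_l`. -/
def coactionPl (ν : A ≅ A) : Q.P ⟶ ((A ⊗ A) ⊗ A) ⊗ Q.P :=
  Q.coaction ≫ (A ⊗ A) ◁ (Q.P ◁ ν.hom) ≫ (A ⊗ A) ◁ (β_ Q.P A).hom ≫ (α_ (A ⊗ A) A Q.P).inv

/-- The coaction of the left `A ⊗ A ⊗ A`-comodule `P_r`: apply `1 ⊗ 1 ⊗ 1 ⊗ ν⁻¹` after `δ` and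
then move the last factor `A` to the front by the inverse braiding. -/
def coactionPr (ν : A ≅ A) : Q.P ⟶ ((A ⊗ A) ⊗ A) ⊗ Q.P :=
  Q.coaction ≫ (A ⊗ A) ◁ (Q.P ◁ ν.inv) ≫ (α_ (A ⊗ A) Q.P A).inv ≫
    (β_ A ((A ⊗ A) ⊗ Q.P)).inv ≫ (α_ A (A ⊗ A) Q.P).inv ≫ (α_ A A A).inv ▷ Q.P

/-- The morphism `ς = (s ⊗ 1 ⊗ t)(γ_r ⊗ 1)incl : P ⟶ C ⊗ C ⊗ C`. -/
def ς : Q.P ⟶ (C ⊗ C) ⊗ C :=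
  Q.incl ≫ rightCoaction Q.t ▷ A ≫ ((Q.s ⊗ₘ 𝟙 C) ⊗ₘ Q.t)

end QuantumCategory

/-- A quantum groupoid with object-of-arrows `A` and object-of-objects `C`. -/
structure QuantumGroupoid (A C : 𝒞) [ComonObj A] [ComonObj C] extends QuantumCategory A C where
  /-- a comonoid isomorphism from the twofold opposite of `C` to `C` -/
  υ : C ≅ C
  υ_counit : υ.hom ≫ ε[C] = ε[C]
  υ_comul : υ.hom ≫ Δ[C] = (Δ[C] ≫ (β_ C C).hom ≫ (β_ C C).hom) ≫ (υ.hom ⊗ₘ υ.hom)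
  /-- a comonoid isomorphism from the opposite of `A` to `A` -/
  ν : A ≅ A
  ν_counit : ν.hom ≫ ε[A] = ε[A]
  ν_comul : ν.hom ≫ Δ[A] = (Δ[A] ≫ (β_ A A).hom) ≫ (ν.hom ⊗ₘ ν.hom)
  /-- an isomorphism of left `A ⊗ A ⊗ A`-comodules from `P_l` to `P_r` -/
  θ : P ≅ P
  θ_coaction : θ.hom ≫ toQuantumCategory.coactionPr ν =
    toQuantumCategory.coactionPl ν ≫ ((A ⊗ A) ⊗ A) ◁ θ.hom
  /-- (G1) -/
  g1 : ν.hom ≫ s = t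
  /-- (G2) -/
  g2 : ν.hom ≫ t = s ≫ υ.hom
  /-- (G3): `(1 ⊗ 1 ⊗ υ) c_{C, C ⊗ C} ς = ς θ` -/
  g3 : toQuantumCategory.ς ≫ (α_ C C C).hom ≫ (β_ C (C ⊗ C)).hom ≫ (C ⊗ C) ◁ υ.hom =
    θ.hom ≫ toQuantumCategory.ς

/-- The morphism `(1 ⊗ ν)(1 ⊗ μ)(c ⊗ 1)(1 ⊗ δ) : A ⊗ A ⟶ A ⊗ A`. -/
def thetaMap {A : 𝒞} [MonObj A] [ComonObj A] (ν : A ⟶ A) : A ⊗ A ⟶ A ⊗ A :=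
  A ◁ Δ[A] ≫ (α_ A A A).inv ≫ (β_ A A).hom ▷ A ≫ (α_ A A A).hom ≫ A ◁ μ[A] ≫ A ◁ ν

/-- The quantum groupoid `G` is the one obtained from the monoid and comonoid `A` with its source
and target morphisms, the endomorphism `ν` and the splitting `p : A ⟶ C`, `i : C ⟶ A` of `t`:
its source and target are those of `A` (followed by `p`), its composition is the restriction of
the multiplication of `A`, its unit is `i`, its `υ` is `tννt`, its `ν` is the given one, and its
`θ` is the restriction of `thetaMap ν`. -/
structure QuantumGroupoid.IsInducedBy {A C : 𝒞} [MonObj A] [ComonObj A] [ComonObj C]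
    (G : QuantumGroupoid A C) (ν : A ⟶ A) (p : A ⟶ C) (i : C ⟶ A) : Prop where
  s_eq : G.s = sourceMap A ≫ p
  t_eq : G.t = targetMap A ≫ p
  comp_eq : G.comp = G.incl ≫ μ[A]
  unit_eq : G.unit = i
  υ_eq : G.υ.hom = i ≫ ν ≫ ν ≫ p
  ν_eq : G.ν.hom = ν
  θ_eq : G.θ.hom ≫ G.incl = G.incl ≫ thetaMap ν

end QuantumGroupoid

end WeakHopf

open WeakHopf

set_option linter.unusedSimpArgs false
set_option linter.unusedSectionVars false

namespace WeakHopf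

/-! ### Words for string diagrams -/

/-! The Frobenius law makes `R` its own dual, with copairing δη and pairing εμ, and expresses δ
through μ and the copairing. Comultiplication in `R ⊗ R` inserts a copairing between the two
strands. Two mechanisms do most of the work: the copairing is central (a factor multiplied onto one
leg may be moved to the other leg), and separability contracts a copairing whose legs are multiplied
together to the unit.

The morphism κ = `curl R` is the braided Nakayama automorphism of `R`: it satisfies εμc⁻¹ = εμ(κ ⊗
1). It is invertible, fixes the unit and the counit, and is multiplicative up to a double braiding,
κμ = μ(κ ⊗ κ)c². This last law makes κ a comonoid morphism from the twofold opposite and yields (G2)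
with υ = κ.

The target of `A = R ⊗ R` is μ followed by η ⊗ 1 (`proj_incl`), so `R` itself serves as `C`, with p
= μ and i = η ⊗ 1, and the induced structure is the original one. The source is μc⁻¹(κ⁻¹ ⊗ 1). As a
right comodule `A = R ⊗ C` is cofree, whence `A ⊗_C A` is `R ⊗ A` and the object of composable
triples is `R ⊗ (R ⊗ A)`. The forks defining them split, so they are equalizers preserved by every
functor (`isCotensor_of_splitting`). On the three strands of `R ⊗ A`, θ is a cyclic rotation
together with κ on one strand.

What is left is a finite list of equations between morphisms of tensor powers of `R`, each a string
diagram calculation from the Frobenius axioms and naturality of the braiding. These calculations are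
done by reflection. A diagram is a list of layers, which `ev` interprets on tensor powers; the
`HasWord` instances read the list off a morphism; replacing an instance of a valid rule preserves
the meaning (`sameFrom_run`). By `eq_of_check` an equation then follows from evaluating a recorded
derivation. -/

/-- The generators of the string diagrams of a Frobenius monoid in a braided monoidal category:
the monoid and comonoid operations, the copairing `δη`, the pairing `εμ`, the braiding, and the
two curls of a strand, each with its inverse. -/
inductive Gen
  | mul | unit | comul | counit | cup | cap | braid | braidInv | curl | curlInv | loop | loopInv

namespace Gen

/-- The number of incoming strands. -/
def dom : Gen → ℕ
  | mul => 2
  | unit => 0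
  | comul => 1
  | counit => 1
  | cup => 0
  | cap => 2
  | braid => 2
  | braidInv => 2
  | curl => 1
  | curlInv => 1
  | loop => 1
  | loopInv => 1

/-- The number of outgoing strands. -/
def cod : Gen → ℕ
  | mul => 1
  | unit => 1
  | comul => 2
  | counit => 0
  | cup => 2
  | cap => 0
  | braid => 2
  | braidInv => 2
  | curl => 1
  | curlInv => 1
  | loop => 1
  | loopInv => 1

/-- A numbering of the generators. -/
def code : Gen → ℕ
  | mul => 0
  | unit => 1
  | comul => 2
  | counit => 3
  | cup => 4
  | cap => 5
  | braid => 6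
  | braidInv => 7
  | curl => 8
  | curlInv => 9
  | loop => 10
  | loopInv => 11

theorem code_injective {g h : Gen} (e : g.code = h.code) : g = h := by
  cases g <;> cases h <;> first | rfl | simp [code] at e

end Gen

/-- A layer `(k, g)` of a string diagram: the generator `g`, with `k` strands to its left. -/
abbrev Layer := ℕ × Gen

/-- A string diagram, as the list of its layers. -/
abbrev Word := List Layer

namespace Word

/-- The word with `k` additional strands on the left. -/
def shift (k : ℕ) (w : Word) : Word := w.map fun x => (x.1 + k, x.2)

theorem shift_zero (w : Word) : shift 0 w = w := by simp [shift]

theorem shift_add (k l : ℕ) (w : Word) : shift (k + l) w = shift k (shift l w) := by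
  simp [shift, Function.comp_def]; intros; omega

/-- The number of outgoing strands of a word with `n` incoming strands. -/
def out : ℕ → Word → ℕ
  | n, [] => n
  | n, x :: w => out (n - x.2.dom + x.2.cod) w

/-- A strand count tested on a word with `n` incoming strands thereby bounds the count for every
larger number, which is the range over which `SameFrom` quantifies. -/
theorem out_mono {m n : ℕ} (h : m ≤ n) (w : Word) : out m w ≤ out n w := by
  induction w generalizing m n with
  | nil => exact h
  | cons x w ih => exact ih (by omega)

end Word

/-! ### Evaluation of words on tensor powers -/

section Semantics

variable {𝒞 : Type u} [Category.{v} 𝒞] [MonoidalCategory 𝒞] (R : 𝒞)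

/-- The tensor power `R ⊗ (R ⊗ ... (R ⊗ 𝟙))`. -/
def pow : ℕ → 𝒞
  | 0 => 𝟙_ 𝒞
  | n + 1 => R ⊗ pow n

/-- Morphisms out of the `n`-th tensor power to some tensor power. -/
abbrev PowHom (n : ℕ) := Σ m, pow R n ⟶ pow R m

variable {R}

/-- Here and in the lemmas that follow, a morphism on the leftmost strands is interchanged with one
on the remaining strands. The coherence isomorphisms in `act` depend on the two arities, hence one
square for each pair. -/
theorem naturality_zero_one (m : 𝟙_ 𝒞 ⟶ R) {X Y : 𝒞} (f : X ⟶ Y) :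
    f ≫ (λ_ Y).inv ≫ m ▷ Y = ((λ_ X).inv ≫ m ▷ X) ≫ R ◁ f := by
  simp only [Category.assoc, leftUnitor_inv_naturality_assoc,
    associator_inv_naturality_right_assoc, whisker_exchange, whisker_exchange_assoc,
    associator_naturality_right, leftUnitor_naturality]

theorem naturality_zero_two (m : 𝟙_ 𝒞 ⟶ R ⊗ R) {X Y : 𝒞} (f : X ⟶ Y) :
    f ≫ (λ_ Y).inv ≫ m ▷ Y ≫ (α_ R R Y).hom = ((λ_ X).inv ≫ m ▷ X ≫ (α_ R R X).hom) ≫ R ◁ R ◁ f :=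
        by
  simp only [Category.assoc, leftUnitor_inv_naturality_assoc,
    associator_inv_naturality_right_assoc, whisker_exchange, whisker_exchange_assoc,
    associator_naturality_right, leftUnitor_naturality]

theorem naturality_one_zero (m : R ⟶ 𝟙_ 𝒞) {X Y : 𝒞} (f : X ⟶ Y) :
    R ◁ f ≫ m ▷ Y ≫ (λ_ Y).hom = (m ▷ X ≫ (λ_ X).hom) ≫ f := by
  simp only [Category.assoc, leftUnitor_inv_naturality_assoc,
    associator_inv_naturality_right_assoc, whisker_exchange, whisker_exchange_assoc,
    associator_naturality_right, leftUnitor_naturality]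

theorem naturality_one_one (m : R ⟶ R) {X Y : 𝒞} (f : X ⟶ Y) :
    R ◁ f ≫ m ▷ Y = (m ▷ X) ≫ R ◁ f := by
  simp only [Category.assoc, leftUnitor_inv_naturality_assoc,
    associator_inv_naturality_right_assoc, whisker_exchange, whisker_exchange_assoc,
    associator_naturality_right, leftUnitor_naturality]

theorem naturality_one_two (m : R ⟶ R ⊗ R) {X Y : 𝒞} (f : X ⟶ Y) :
    R ◁ f ≫ m ▷ Y ≫ (α_ R R Y).hom = (m ▷ X ≫ (α_ R R X).hom) ≫ R ◁ R ◁ f := by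
  simp only [Category.assoc, leftUnitor_inv_naturality_assoc,
    associator_inv_naturality_right_assoc, whisker_exchange, whisker_exchange_assoc,
    associator_naturality_right, leftUnitor_naturality]

theorem naturality_two_zero (m : R ⊗ R ⟶ 𝟙_ 𝒞) {X Y : 𝒞} (f : X ⟶ Y) :
    R ◁ R ◁ f ≫ (α_ R R Y).inv ≫ m ▷ Y ≫ (λ_ Y).hom = ((α_ R R X).inv ≫ m ▷ X ≫ (λ_ X).hom) ≫ f :=
        by
  simp only [Category.assoc, leftUnitor_inv_naturality_assoc,
    associator_inv_naturality_right_assoc, whisker_exchange, whisker_exchange_assoc,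
    associator_naturality_right, leftUnitor_naturality]

theorem naturality_two_one (m : R ⊗ R ⟶ R) {X Y : 𝒞} (f : X ⟶ Y) :
    R ◁ R ◁ f ≫ (α_ R R Y).inv ≫ m ▷ Y = ((α_ R R X).inv ≫ m ▷ X) ≫ R ◁ f := by
  simp only [Category.assoc, leftUnitor_inv_naturality_assoc,
    associator_inv_naturality_right_assoc, whisker_exchange, whisker_exchange_assoc,
    associator_naturality_right, leftUnitor_naturality]

theorem naturality_two_two (m : R ⊗ R ⟶ R ⊗ R) {X Y : 𝒞} (f : X ⟶ Y) :
    R ◁ R ◁ f ≫ (α_ R R Y).inv ≫ m ▷ Y ≫ (α_ R R Y).hom = ((α_ R R X).inv ≫ m ▷ X ≫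
        (α_ R R X).hom) ≫ R ◁ R ◁ f := by
  simp only [Category.assoc, leftUnitor_inv_naturality_assoc,
    associator_inv_naturality_right_assoc, whisker_exchange, whisker_exchange_assoc,
    associator_naturality_right, leftUnitor_naturality]

namespace PowHom

/-- Composition. -/
def comp {n : ℕ} (f : PowHom R n) (g : PowHom R f.1) : PowHom R n := ⟨g.1, f.2 ≫ g.2⟩

/-- Tensoring on the left. -/
def whisker {n : ℕ} (f : PowHom R n) : PowHom R (n + 1) := ⟨f.1 + 1, R ◁ f.2⟩

theorem comp_assoc {n : ℕ} (f : PowHom R n) (g : PowHom R f.1) (h : PowHom R g.1) :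
    (f.comp g).comp h = f.comp (g.comp h) := by
  simp [comp]

theorem whisker_comp {n : ℕ} (f : PowHom R n) (g : PowHom R f.1) :
    (f.comp g).whisker = f.whisker.comp g.whisker := by
  simp [comp, whisker]
  rfl

end PowHom

variable [BraidedCategory 𝒞] [MonObj R] [ComonObj R]

variable (R) in
/-- The inverse of `curl R`. -/
def curlInv : R ⟶ R :=
  (ρ_ R).inv ≫ R ◁ (η[R] ≫ Δ[R]) ≫ (α_ R R R).inv ≫ (β_ R R).inv ▷ R ≫ (α_ R R R).hom ≫
    R ◁ (μ[R] ≫ ε[R]) ≫ (ρ_ R).hom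

variable (R) in
/-- The curl of a strand with the other crossing. -/
def loop : R ⟶ R :=
  (λ_ R).inv ≫ (η[R] ≫ Δ[R]) ▷ R ≫ (α_ R R R).hom ≫ R ◁ (β_ R R).inv ≫ (α_ R R R).inv ≫
    (μ[R] ≫ ε[R]) ▷ R ≫ (λ_ R).hom

variable (R) in
/-- The inverse of `loop R`. -/
def loopInv : R ⟶ R :=
  (ρ_ R).inv ≫ R ◁ (η[R] ≫ Δ[R]) ≫ (α_ R R R).inv ≫ (β_ R R).hom ▷ R ≫ (α_ R R R).hom ≫
    R ◁ (μ[R] ≫ ε[R]) ≫ (ρ_ R).hom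

variable (R) in
/-- The object `X` with `k` copies of `R` on the left. -/
def iter : ℕ → 𝒞 → 𝒞
  | 0, X => X
  | k + 1, X => R ⊗ iter k X

variable (R) in
/-- The functoriality of `iter`. -/
def iterMap {X Y : 𝒞} (f : X ⟶ Y) : (k : ℕ) → (iter R k X ⟶ iter R k Y)
  | 0 => f
  | k + 1 => R ◁ iterMap f k

variable (R) in
/-- The generator `g` applied to strands on the left of `X`. -/
def act (g : Gen) (X : 𝒞) : iter R g.dom X ⟶ iter R g.cod X :=
  match g with
  | .mul => (α_ R R X).inv ≫ μ[R] ▷ X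
  | .unit => (λ_ X).inv ≫ η[R] ▷ X
  | .comul => Δ[R] ▷ X ≫ (α_ R R X).hom
  | .counit => ε[R] ▷ X ≫ (λ_ X).hom
  | .cup => (λ_ X).inv ≫ (η[R] ≫ Δ[R]) ▷ X ≫ (α_ R R X).hom
  | .cap => (α_ R R X).inv ≫ (μ[R] ≫ ε[R]) ▷ X ≫ (λ_ X).hom
  | .braid => (α_ R R X).inv ≫ (β_ R R).hom ▷ X ≫ (α_ R R X).hom
  | .braidInv => (α_ R R X).inv ≫ (β_ R R).inv ▷ X ≫ (α_ R R X).hom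
  | .curl => curl R ▷ X
  | .curlInv => curlInv R ▷ X
  | .loop => loop R ▷ X
  | .loopInv => loopInv R ▷ X

theorem act_naturality (g : Gen) {X Y : 𝒞} (f : X ⟶ Y) :
    iterMap R f g.dom ≫ act R g Y = act R g X ≫ iterMap R f g.cod := by
  cases g
  · exact naturality_two_one _ f
  · exact naturality_zero_one _ f
  · exact naturality_one_two _ f
  · exact naturality_one_zero _ f
  · exact naturality_zero_two _ f
  · exact naturality_two_zero _ f
  · exact naturality_two_two _ f
  · exact naturality_two_two _ f
  · exact naturality_one_one _ f
  · exact naturality_one_one _ f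
  · exact naturality_one_one _ f
  · exact naturality_one_one _ f

variable (R) in
/-- The generator `g` applied to the leftmost of `n` strands, if there are enough of them. -/
def evGen (g : Gen) (n : ℕ) : Option (PowHom R n) :=
  match g, n with
  | .mul, n + 2 => some ⟨n + 1, act R .mul (pow R n)⟩
  | .unit, n => some ⟨n + 1, act R .unit (pow R n)⟩
  | .comul, n + 1 => some ⟨n + 2, act R .comul (pow R n)⟩
  | .counit, n + 1 => some ⟨n, act R .counit (pow R n)⟩
  | .cup, n => some ⟨n + 2, act R .cup (pow R n)⟩
  | .cap, n + 2 => some ⟨n, act R .cap (pow R n)⟩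
  | .braid, n + 2 => some ⟨n + 2, act R .braid (pow R n)⟩
  | .braidInv, n + 2 => some ⟨n + 2, act R .braidInv (pow R n)⟩
  | .curl, n + 1 => some ⟨n + 1, act R .curl (pow R n)⟩
  | .curlInv, n + 1 => some ⟨n + 1, act R .curlInv (pow R n)⟩
  | .loop, n + 1 => some ⟨n + 1, act R .loop (pow R n)⟩
  | .loopInv, n + 1 => some ⟨n + 1, act R .loopInv (pow R n)⟩
  | _, _ => none

variable (R) in
/-- The layer `(k, g)` applied to `n` strands, if there are enough of them. -/
def evLayer : (n k : ℕ) → Gen → Option (PowHom R n)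
  | n, 0, g => evGen R g n
  | 0, _ + 1, _ => none
  | n + 1, k + 1, g => (evLayer n k g).map PowHom.whisker

variable (R) in
/-- The morphism described by a word with `n` incoming strands. -/
def ev : (n : ℕ) → Word → Option (PowHom R n)
  | n, [] => some ⟨n, 𝟙 _⟩
  | n, x :: w => (evLayer R n x.1 x.2).bind fun f => (ev f.1 w).map f.comp

theorem evGen_eq_some {g : Gen} {n : ℕ} {f : PowHom R n} (h : evGen R g n = some f) :
    g.dom ≤ n ∧ f.1 = n - g.dom + g.cod := by
  -- No generator has more than two inputs, so 0, 1 and n + 2 are the cases in which `evGen`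
  -- reduces.
  rcases n with _ | _ | n <;> cases g <;> simp [evGen] at h <;> subst h <;> simp [Gen.dom, Gen.cod]

theorem evLayer_eq_some {n k : ℕ} {g : Gen} {f : PowHom R n} (h : evLayer R n k g = some f) :
    k + g.dom ≤ n ∧ f.1 = n - g.dom + g.cod := by
  induction k generalizing n with
  | zero => simpa using evGen_eq_some (by cases n <;> exact h)
  | succ k ih =>
    cases n with
    | zero => simp [evLayer] at h
    | succ n =>
      obtain ⟨f', hf, rfl⟩ := Option.map_eq_some_iff.1 h
      have := ih hf
      simp only [PowHom.whisker]
      omega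

theorem ev_eq_some {n : ℕ} {w : Word} {f : PowHom R n} (h : ev R n w = some f) :
    f.1 = Word.out n w := by
  induction w generalizing n with
  | nil => simp only [ev, Option.some.injEq] at h; subst h; rfl
  | cons x w ih =>
    obtain ⟨a, ha, hb⟩ := Option.bind_eq_some_iff.1 h
    obtain ⟨b, hc, rfl⟩ := Option.map_eq_some_iff.1 hb
    rw [Word.out, ← (evLayer_eq_some ha).2]
    exact ih hc

theorem ev_append (n : ℕ) (w w' : Word) :
    ev R n (w ++ w') = (ev R n w).bind fun f => (ev R f.1 w').map f.comp := by
  induction w generalizing n with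
  | nil =>
    have : PowHom.comp (⟨n, 𝟙 (pow R n)⟩ : PowHom R n) = id := by
      funext g
      simp [PowHom.comp]
    simp [ev, this]
  | cons x w ih =>
    simp only [List.cons_append, ev, ih, Option.map_bind, Option.bind_assoc]
    congr 1
    funext f
    rw [Option.bind_map]
    congr 1
    funext g
    rw [Function.comp_apply, Option.map_map]
    exact congrArg (Option.map · _) (funext fun h => (PowHom.comp_assoc f g h).symm)

theorem ev_shift_one (n : ℕ) (w : Word) :
    ev R (n + 1) (Word.shift 1 w) = (ev R n w).map PowHom.whisker := by
  induction w generalizing n with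
  | nil => exact congrArg some (Sigma.ext rfl (heq_of_eq (whiskerLeft_id _ _).symm))
  | cons x w ih =>
    have : Word.shift 1 (x :: w) = (x.1 + 1, x.2) :: Word.shift 1 w := rfl
    simp only [this, ev, evLayer, Option.map_bind, Option.bind_map]
    congr 1
    funext f
    refine (congrArg (Option.map f.whisker.comp) (ih f.1)).trans ?_
    change _ = Option.map PowHom.whisker (Option.map f.comp (ev R f.1 w))
    rcases ev R f.1 w with _ | g
    · rfl
    · exact congrArg some (PowHom.whisker_comp f g).symm

/-! ### Interchange -/

/-- `evLayer` inspects the number of strands together with the offset, so the case split is needed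
before anything reduces. -/
theorem evLayer_zero (n : ℕ) (g : Gen) : evLayer R n 0 g = evGen R g n := by cases n <;> rfl

theorem ev_pair (n : ℕ) (x y : Layer) :
    ev R n [x, y] = (evLayer R n x.1 x.2).bind fun f => (evLayer R f.1 y.1 y.2).map f.comp := by
  simp only [ev]
  congr 1
  funext f
  rcases evLayer R f.1 y.1 y.2 with _ | g <;> simp [PowHom.comp]

/-- Once `h` is a concrete generator its arities are numerals and both sides unfold. With too few
strands both are `none`; otherwise the equation is the naturality square of `h` at the morphism
given by `g`. -/
theorem ev_interchange_zero (h : Gen) (j : ℕ) (g : Gen) (n : ℕ) :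
    ev R n [(j + h.dom, g), (0, h)] = ev R n [(0, h), (j + h.cod, g)] := by
  rw [ev_pair, ev_pair]
  cases h
  case mul =>
    rcases n with _ | _ | n
    · rfl
    · rfl
    · change ((((evLayer R n j g).map PowHom.whisker).map PowHom.whisker).bind _) =
        Option.map _ ((evLayer R n j g).map PowHom.whisker)
      rcases evLayer R n j g with _ | f
      · rfl
      · exact congrArg some (Sigma.ext rfl (heq_of_eq (act_naturality .mul f.2)))
  case unit =>
    simp only [evLayer_zero]
    change ((evLayer R n j g).bind _) =
        Option.map _ ((evLayer R n j g).map PowHom.whisker)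
    rcases evLayer R n j g with _ | f
    · rfl
    · exact congrArg some (Sigma.ext rfl (heq_of_eq (act_naturality .unit f.2)))
  case comul =>
    rcases n with _ | n
    · rfl
    · change (((evLayer R n j g).map PowHom.whisker).bind _) =
        Option.map _ (((evLayer R n j g).map PowHom.whisker).map PowHom.whisker)
      rcases evLayer R n j g with _ | f
      · rfl
      · exact congrArg some (Sigma.ext rfl (heq_of_eq (act_naturality .comul f.2)))
  case counit =>
    rcases n with _ | n
    · rfl
    · change (((evLayer R n j g).map PowHom.whisker).bind _) =
        Option.map _ (evLayer R n j g)
      rcases evLayer R n j g with _ | f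
      · rfl
      · exact congrArg some (Sigma.ext rfl (heq_of_eq (act_naturality .counit f.2)))
  case cup =>
    simp only [evLayer_zero]
    change ((evLayer R n j g).bind _) =
        Option.map _ (((evLayer R n j g).map PowHom.whisker).map PowHom.whisker)
    rcases evLayer R n j g with _ | f
    · rfl
    · exact congrArg some (Sigma.ext rfl (heq_of_eq (act_naturality .cup f.2)))
  case cap =>
    rcases n with _ | _ | n
    · rfl
    · rfl
    · change ((((evLayer R n j g).map PowHom.whisker).map PowHom.whisker).bind _) =
        Option.map _ (evLayer R n j g)
      rcases evLayer R n j g with _ | f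
      · rfl
      · exact congrArg some (Sigma.ext rfl (heq_of_eq (act_naturality .cap f.2)))
  case braid | braidInv =>
    rcases n with _ | _ | n
    · rfl
    · rfl
    · change ((((evLayer R n j g).map PowHom.whisker).map PowHom.whisker).bind _) =
        Option.map _ (((evLayer R n j g).map PowHom.whisker).map PowHom.whisker)
      rcases evLayer R n j g with _ | f
      · rfl
      · exact congrArg some (Sigma.ext rfl (heq_of_eq (naturality_two_two _ f.2)))
  case curl | curlInv | loop | loopInv =>
    rcases n with _ | n
    · rfl
    · change (((evLayer R n j g).map PowHom.whisker).bind _) =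
        Option.map _ ((evLayer R n j g).map PowHom.whisker)
      rcases evLayer R n j g with _ | f
      · rfl
      · exact congrArg some (Sigma.ext rfl (heq_of_eq (naturality_one_one _ f.2)))

end Semantics

/-! ### Rewriting of words -/

namespace Word

/-- Exchange of two consecutive layers: `x` then `y` becomes `y'` then `x'`. -/
def exchange (x y : Layer) : Option (Layer × Layer) :=
  bif Nat.ble (y.1 + y.2.dom) x.1 then some (y, (x.1 - y.2.dom + y.2.cod, x.2))
  else bif Nat.ble (x.1 + x.2.cod) y.1 then some ((y.1 - x.2.cod + x.2.dom, y.2), x)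
  else none

/-- Moving a layer that follows `u` to the front. -/
def pull : Word → Layer → Option (Layer × Word)
  | [], a => some (a, [])
  | x :: u, a => (pull u a).bind fun b => (exchange x b.1).map fun c => (c.1, c.2 :: b.2)

/-- Insertion of a layer in front of a word, moved down as far as possible. -/
def insert : Layer → Word → Word
  | x, [] => [x]
  | x, y :: w => bif Nat.ble (y.1 + y.2.dom) x.1 then
      y :: insert (x.1 - y.2.dom + y.2.cod, x.2) w
    else x :: y :: w

/-- A normal form of a word with respect to the exchange of layers. -/
def canon : Word → Word
  | [] => []
  | x :: w => insert x (canon w)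

/-- Equality test for layers. -/
def eqLayer (x y : Layer) : Bool := Nat.beq x.1 y.1 && Nat.beq x.2.code y.2.code

/-- Equality test for words. -/
def eqWord : Word → Word → Bool
  | [], [] => true
  | x :: w, y :: w' => eqLayer x y && eqWord w w'
  | _, _ => false

/-- The number of strands to the left of the first layer. -/
def start : Word → ℕ
  | [] => 0
  | x :: _ => x.1

/-- Search for the pattern with first layer at `p`, whose remaining layers are given by the second
argument. The layers read so far are arranged as `pre ++ block ++ after`, and `block` is the part
of the pattern which is already found. -/
def search (p : ℕ) : Word → Word → Word → Word → Word → Option (Word × Word × Word)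
  | [], pre, block, after, rest => some (pre, block, after ++ rest)
  | _ :: _, _, _, _, [] => none
  | q :: ps, pre, block, after, a :: rest =>
    match pull after a with
    | none => search p (q :: ps) pre block (after ++ [a]) rest
    | some (b, after') =>
      bif eqLayer b (q.1 + (start block - p), q.2) then search p ps pre (block ++ [b]) after' rest
      else match pull block b with
        | none => search p (q :: ps) pre block (after ++ [a]) rest
        | some (c, block') => search p (q :: ps) (pre ++ [c]) block' after' rest
-- Structural recursion lets the kernel evaluate the search.
termination_by structural _ _ _ _ rest => rest

/-- A rewriting rule, with its number of incoming strands. -/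
structure Rule where
  /-- the number of incoming strands -/
  arity : ℕ
  /-- the left-hand side -/
  lhs : Word
  /-- the right-hand side -/
  rhs : Word

/-- The replacement of an instance of `l` (with `m` incoming strands) by `r`, in a word with `n`
incoming strands; the instance starts with the first layer of `rest`. -/
def replace (n m : ℕ) (l r pre rest : Word) : Option Word :=
  match l, rest with
  | q :: ps, a :: rest =>
    (search q.1 ps pre [a] [] rest).bind fun d =>
      bif eqWord d.2.1 (shift (start d.2.1 - q.1) l) &&
        Nat.ble (start d.2.1 - q.1 + m) (out n d.1) then
      some (canon (d.1 ++ (shift (start d.2.1 - q.1) r ++ d.2.2))) else none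
  | _, _ => none

/-- One rewriting step, in a word with `n` incoming strands. Step `(2 * j, i)` applies rule `j`
at layer `i`, and `(2 * j + 1, i)` applies it from right to left. -/
def step (rules : List Rule) (n : ℕ) (w : Word) (s : ℕ × ℕ) : Option Word :=
  (rules[s.1 / 2]?).bind fun r =>
    bif Nat.beq (s.1 % 2) 0 then replace n r.arity r.lhs r.rhs (w.take s.2) (w.drop s.2)
    else replace n r.arity r.rhs r.lhs (w.take s.2) (w.drop s.2)

/-- A sequence of rewriting steps. -/
def run (rules : List Rule) (n : ℕ) : Word → List (ℕ × ℕ) → Option Word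
  | w, [] => some w
  | w, s :: l => (step rules n w s).bind fun w' => run rules n w' l

/-- The test that two words with `n` incoming strands become equal by the given steps. -/
def check (rules : List Rule) (n : ℕ) (w w' : Word) (l l' : List (ℕ × ℕ)) : Bool :=
  match run rules n (canon w) l, run rules n (canon w') l' with
  | some a, some b => eqWord a b
  | _, _ => false

/-- The test that each rule in a list follows, by the given steps, from the given rules and the
preceding ones. -/
def checkRules (rules : List Rule) : List (Rule × List (ℕ × ℕ) × List (ℕ × ℕ)) → Bool
  | [] => true
  | d :: l => check rules d.1.arity d.1.lhs d.1.rhs d.2.1 d.2.2 && checkRules (rules ++ [d.1]) l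

theorem eq_of_eqLayer {x y : Layer} (h : eqLayer x y = true) : x = y := by
  rw [eqLayer, Bool.and_eq_true] at h
  exact Prod.ext (Nat.eq_of_beq_eq_true h.1) (Gen.code_injective (Nat.eq_of_beq_eq_true h.2))

theorem eq_of_eqWord {w w' : Word} (h : eqWord w w' = true) : w = w' := by
  induction w generalizing w' with
  | nil => cases w' <;> simp_all [eqWord]
  | cons x w ih =>
    cases w' with
    | nil => simp [eqWord] at h
    | cons y w' =>
      rw [eqWord, Bool.and_eq_true] at h
      rw [eq_of_eqLayer h.1, ih h.2]

end Word

/-! ### Soundness of rewriting -/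

section Soundness

variable {𝒞 : Type u} [Category.{v} 𝒞] [MonoidalCategory 𝒞] (R : 𝒞)
variable [BraidedCategory 𝒞] [MonObj R] [ComonObj R]

theorem ev_interchange (h : Gen) (k j : ℕ) (g : Gen) (n : ℕ) :
    ev R n [(k + (j + h.dom), g), (k, h)] = ev R n [(k, h), (k + (j + h.cod), g)] := by
  induction k generalizing n with
  | zero => simpa using ev_interchange_zero h j g n
  | succ k ih =>
    cases n with
    | zero =>
      rw [Nat.succ_add, Nat.succ_add]
      rfl
    | succ n =>
      rw [Nat.succ_add, Nat.succ_add]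
      exact (ev_shift_one n [(k + (j + h.dom), g), (k, h)]).trans
        ((congrArg _ (ih n)).trans (ev_shift_one n [(k, h), (k + (j + h.cod), g)]).symm)

/-- Two words denote the same morphism, for each number of incoming strands `≥ n`. -/
def SameFrom (n : ℕ) (w w' : Word) : Prop := ∀ N, n ≤ N → ev R N w = ev R N w'

/-- Two words denote the same morphism. -/
def Same (w w' : Word) : Prop := ∀ N, ev R N w = ev R N w'

variable {R}

theorem Same.trans {w w' w'' : Word} (h : Same R w w') (h' : Same R w' w'') : Same R w w'' :=
  fun N => (h N).trans (h' N)

theorem Same.refl (w : Word) : Same R w w := fun _ => rfl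

theorem Same.append {w w' v v' : Word} (h : Same R w w') (h' : Same R v v') :
    Same R (w ++ v) (w' ++ v') := by
  intro N
  rw [ev_append, ev_append, h N]
  congr 1
  funext f
  rw [h' f.1]

theorem Same.cons (x : Layer) {w w' : Word} (h : Same R w w') : Same R (x :: w) (x :: w') :=
  Same.append (Same.refl [x]) h

theorem Same.swap_cons {x y x' y' : Layer} (h : Same R [x, y] [y', x']) (w : Word) :
    Same R (x :: y :: w) (y' :: x' :: w) :=
  Same.append h (Same.refl w)

/-- The layer `y` lies entirely to the left of `x`, so it may act first, and the offset of `x`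
changes by the number of strands that `y` adds or removes. The hypothesis makes the truncated
subtraction exact. -/
theorem same_down {x y : Layer} (h : y.1 + y.2.dom ≤ x.1) :
    Same R [x, y] [y, (x.1 - y.2.dom + y.2.cod, x.2)] := by
  intro n
  have := ev_interchange R y.2 y.1 (x.1 - (y.1 + y.2.dom)) x.2 n
  convert this using 3
  · exact Prod.ext (by simp; omega) rfl
  · congr 1
    exact Prod.ext (by simp; omega) rfl

theorem same_up {x y : Layer} (h : x.1 + x.2.cod ≤ y.1) :
    Same R [x, y] [(y.1 - x.2.cod + x.2.dom, y.2), x] := by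
  intro n
  have := ev_interchange R x.2 x.1 (y.1 - (x.1 + x.2.cod)) y.2 n
  symm
  convert this using 3
  · exact Prod.ext (by simp; omega) rfl
  · congr 1
    exact Prod.ext (by simp; omega) rfl

theorem same_exchange {x y : Layer} {c : Layer × Layer} (h : Word.exchange x y = some c) :
    Same R [x, y] [c.1, c.2] := by
  rw [Word.exchange] at h
  cases h₁ : Nat.ble (y.1 + y.2.dom) x.1 with
  | true =>
    simp only [h₁, cond_true, Option.some.injEq] at h
    subst h
    exact same_down (Nat.le_of_ble_eq_true h₁)
  | false =>
    cases h₂ : Nat.ble (x.1 + x.2.cod) y.1 with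
    | true =>
      simp only [h₁, h₂, cond_true, cond_false, Option.some.injEq] at h
      subst h
      exact same_up (Nat.le_of_ble_eq_true h₂)
    | false => simp [h₁, h₂] at h

theorem same_pull {u : Word} {a : Layer} {b : Layer × Word} (h : Word.pull u a = some b) :
    Same R (u ++ [a]) (b.1 :: b.2) := by
  induction u generalizing b with
  | nil =>
    simp only [Word.pull, Option.some.injEq] at h
    subst h
    exact Same.refl _
  | cons x u ih =>
    obtain ⟨b', hb, h⟩ := Option.bind_eq_some_iff.1 h
    obtain ⟨c, hc, rfl⟩ := Option.map_eq_some_iff.1 h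
    exact ((ih hb).cons x).trans ((same_exchange hc).swap_cons _)

theorem same_insert (x : Layer) (w : Word) : Same R (x :: w) (Word.insert x w) := by
  induction w generalizing x with
  | nil => exact Same.refl _
  | cons y w ih =>
    rw [Word.insert]
    cases h : Nat.ble (y.1 + y.2.dom) x.1 with
    | true =>
      simp only [cond_true]
      exact ((same_down (Nat.le_of_ble_eq_true h)).swap_cons w).trans ((ih _).cons y)
    | false => exact Same.refl _

theorem same_canon (w : Word) : Same R w (Word.canon w) := by
  induction w with
  | nil => exact Same.refl _
  | cons x w ih => exact (ih.cons x).trans (same_insert x _)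

/-- The search only exchanges layers, so its result denotes the same morphism whether or not the
block found is the wanted one. That it is an instance of the pattern is tested afterwards, in
`replace`. -/
theorem same_search {p : ℕ} {ps pre block after rest : Word} {d : Word × Word × Word}
    (h : Word.search p ps pre block after rest = some d) :
    Same R (pre ++ (block ++ (after ++ rest))) (d.1 ++ (d.2.1 ++ d.2.2)) := by
  induction rest generalizing ps pre block after with
  | nil =>
    cases ps with
    | nil =>
      simp only [Word.search, Option.some.injEq] at h
      subst h
      exact Same.refl _
    | cons q ps => simp [Word.search] at h
  | cons a rest ih =>
    cases ps with
    | nil =>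
      simp only [Word.search, Option.some.injEq] at h
      subst h
      exact Same.refl _
    | cons q ps =>
      have skip : ∀ h : Word.search p (q :: ps) pre block (after ++ [a]) rest = some d,
          Same R (pre ++ (block ++ (after ++ a :: rest))) (d.1 ++ (d.2.1 ++ d.2.2)) := by
        intro h
        simpa using ih h
      rw [Word.search] at h
      cases h₁ : Word.pull after a with
      | none =>
        simp only [h₁] at h
        exact skip h
      | some b =>
        simp only [h₁] at h
        have e₁ : Same R (pre ++ (block ++ (after ++ a :: rest)))
            (pre ++ (block ++ (b.1 :: b.2 ++ rest))) := by
          refine (Same.refl pre).append ((Same.refl block).append ?_)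
          simpa using (same_pull h₁).append (Same.refl rest)
        cases h₂ : Word.eqLayer b.1 (q.1 + (Word.start block - p), q.2) with
        | true =>
          simp only [h₂, cond_true] at h
          refine e₁.trans ?_
          simpa using ih h
        | false =>
          simp only [h₂, cond_false] at h
          cases h₃ : Word.pull block b.1 with
          | none =>
            simp only [h₃] at h
            exact skip h
          | some c =>
            simp only [h₃] at h
            refine e₁.trans (Same.trans ?_ (ih h))
            have := (Same.refl pre).append ((same_pull h₃).append (Same.refl (R :=
                R) (b.2 ++ rest)))
            simpa using this

theorem Same.sameFrom {w w' : Word} (h : Same R w w') (n : ℕ) : SameFrom R n w w' :=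
  fun N _ => h N

theorem SameFrom.trans {n : ℕ} {w w' w'' : Word} (h : SameFrom R n w w')
    (h' : SameFrom R n w' w'') : SameFrom R n w w'' :=
  fun N hN => (h N hN).trans (h' N hN)

theorem SameFrom.symm {n : ℕ} {w w' : Word} (h : SameFrom R n w w') : SameFrom R n w' w :=
  fun N hN => (h N hN).symm

theorem SameFrom.shift {m : ℕ} {w w' : Word} (h : SameFrom R m w w') (k : ℕ) :
    SameFrom R (k + m) (Word.shift k w) (Word.shift k w') := by
  induction k with
  | zero => simpa [Word.shift_zero] using h
  | succ k ih =>
    intro N hN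
    obtain ⟨N, rfl⟩ : ∃ M, N = M + 1 := ⟨N - 1, by omega⟩
    rw [Nat.add_comm k 1, Word.shift_add, Word.shift_add, ev_shift_one, ev_shift_one,
      ih N (by omega)]

/-- Rules hold only from their arity on: cancelling a unit, for example, removes the need for an
incoming strand. The bound on `pre` guarantees enough strands at the place of use; if `pre` itself
cannot be evaluated, both sides are `none`. -/
theorem SameFrom.congr {n k : ℕ} {w w' : Word} (h : SameFrom R k w w') (pre after : Word)
    (hk : k ≤ Word.out n pre) : SameFrom R n (pre ++ (w ++ after)) (pre ++ (w' ++ after)) := by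
  intro N hN
  rw [ev_append, ev_append]
  cases hf : ev R N pre with
  | none => rfl
  | some f =>
    have : k ≤ f.1 := by
      rw [ev_eq_some hf]
      exact hk.trans (Word.out_mono hN pre)
    simp only [Option.bind_some, ev_append, h f.1 this]

variable (R) in
/-- A rule is valid if its two sides denote the same morphism. -/
def Word.Rule.Valid (r : Word.Rule) : Prop := SameFrom R r.arity r.lhs r.rhs

theorem sameFrom_replace {n m : ℕ} {l r pre rest w : Word} (hlr : SameFrom R m l r)
    (h : Word.replace n m l r pre rest = some w) : SameFrom R n (pre ++ rest) w := by
  rcases l with _ | ⟨q, ps⟩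
  · simp [Word.replace] at h
  rcases rest with _ | ⟨a, rest⟩
  · simp [Word.replace] at h
  obtain ⟨d, hd, h⟩ := Option.bind_eq_some_iff.1 h
  cases h₁ : Word.eqWord d.2.1 (Word.shift (Word.start d.2.1 - q.1) (q :: ps)) &&
      Nat.ble (Word.start d.2.1 - q.1 + m) (Word.out n d.1) with
  | false => simp [h₁] at h
  | true =>
    simp only [h₁, cond_true, Option.some.injEq] at h
    subst h
    rw [Bool.and_eq_true] at h₁
    refine SameFrom.trans ?_ ((same_canon _).sameFrom n)
    have e := same_search (R := R) hd
    -- The block is literally the left-hand side, moved to the right by the offset named `k` below.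
    rw [Word.eq_of_eqWord h₁.1] at e
    generalize Word.start d.2.1 - q.1 = k at *
    refine SameFrom.trans (e.sameFrom n) ?_
    exact (hlr.shift _).congr _ _ (Nat.le_of_ble_eq_true h₁.2)

theorem sameFrom_step {rules : List Word.Rule} (hr : ∀ r ∈ rules, r.Valid R) {n : ℕ} {w w' : Word}
    {s : ℕ × ℕ} (h : Word.step rules n w s = some w') : SameFrom R n w w' := by
  obtain ⟨r, hs, h⟩ := Option.bind_eq_some_iff.1 h
  have hv := hr r (List.mem_of_getElem? hs)
  cases h₁ : Nat.beq (s.1 % 2) 0 with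
  | true =>
    simp only [h₁, cond_true] at h
    simpa using sameFrom_replace hv h
  | false =>
    simp only [h₁, cond_false] at h
    simpa using sameFrom_replace hv.symm h

theorem sameFrom_run {rules : List Word.Rule} (hr : ∀ r ∈ rules, r.Valid R) {n : ℕ} {w w' : Word}
    {l : List (ℕ × ℕ)} (h : Word.run rules n w l = some w') : SameFrom R n w w' := by
  induction l generalizing w with
  | nil =>
    simp only [Word.run, Option.some.injEq] at h
    subst h
    exact (Same.refl _).sameFrom n
  | cons s l ih =>
    obtain ⟨v, hv, h⟩ := Option.bind_eq_some_iff.1 h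
    exact (sameFrom_step hr hv).trans (ih h)

theorem sameFrom_of_check {rules : List Word.Rule} (hr : ∀ r ∈ rules, r.Valid R) {n : ℕ}
    {w w' : Word} {l l' : List (ℕ × ℕ)} (h : Word.check rules n w w' l l' = true) :
    SameFrom R n w w' := by
  rw [Word.check] at h
  cases h₁ : Word.run rules n (Word.canon w) l with
  | none => simp [h₁] at h
  | some a =>
    cases h₂ : Word.run rules n (Word.canon w') l' with
    | none => simp [h₁, h₂] at h
    | some b =>
      simp only [h₁, h₂] at h
      rw [← Word.eq_of_eqWord h] at h₂
      exact (((same_canon w).sameFrom n).trans (sameFrom_run hr h₁)).trans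
        (((same_canon w').sameFrom n).trans (sameFrom_run hr h₂)).symm

/-- A derived rule joins the list only after its own derivation has been checked, so a derivation
may use earlier derived rules but not itself. -/
theorem valid_of_checkRules {rules : List Word.Rule} (hr : ∀ r ∈ rules, r.Valid R)
    {l : List (Word.Rule × List (ℕ × ℕ) × List (ℕ × ℕ))}
    (h : Word.checkRules rules l = true) : ∀ r ∈ rules ++ l.map Prod.fst, r.Valid R := by
  induction l generalizing rules with
  | nil => simpa using hr
  | cons d l ih =>
    rw [Word.checkRules, Bool.and_eq_true] at h
    have := ih (rules := rules ++ [d.1]) (by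
      intro r hm
      rcases List.mem_append.1 hm with hm | hm
      · exact hr r hm
      · rw [List.mem_singleton.1 hm]
        exact sameFrom_of_check hr h.1) h.2
    simpa using this

end Soundness

/-! ### Words of morphisms -/

/-- Bracketings of tensor products of strands. -/
inductive Shape
  | unit | one | tensor (a b : Shape)

namespace Shape

/-- The number of strands, added to `n`. -/
def len : Shape → ℕ → ℕ
  | unit, n => n
  | one, n => n + 1
  | tensor a b, n => a.len (b.len n)

/-- The number of strands. -/
def size : Shape → ℕ
  | unit => 0
  | one => 1
  | tensor a b => b.size + a.size

/-- Tensoring on the left with the tensor product of the given shape. -/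
def map {𝒞 : Type u} [Category.{v} 𝒞] [MonoidalCategory 𝒞] {R : 𝒞} :
    (a : Shape) → {m n : ℕ} → (pow R m ⟶ pow R n) → (pow R (a.len m) ⟶ pow R (a.len n))
  | unit, _, _, f => f
  | one, _, _, f => R ◁ f
  | tensor a b, _, _, f => a.map (b.map f)

end Shape

section Words

variable {𝒞 : Type u} [Category.{v} 𝒞] [MonoidalCategory 𝒞]

/-- The isomorphism `Flat.iso` of a tensor product is an associator followed by the isomorphisms of
the factors. With arbitrary morphisms in place of the latter, the compatibility of flattening with
whiskering is just the exchange law; the next lemma does the same on the other side. -/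
theorem whiskerRight_coherence {X Y Z P Q S T : 𝒞} (f : X ⟶ Y) (z : Z ⊗ P ⟶ Q) (x : X ⊗ Q ⟶ S)
    (y : Y ⊗ Q ⟶ T) (φ : S ⟶ T) (h : x ≫ φ = f ▷ Q ≫ y) :
    ((α_ X Z P).hom ≫ X ◁ z ≫ x) ≫ φ = f ▷ Z ▷ P ≫ (α_ Y Z P).hom ≫ Y ◁ z ≫ y := by
  rw [Category.assoc, Category.assoc, h, whisker_exchange_assoc]
  simp

theorem whiskerLeft_coherence {X Y Z P Q S T U : 𝒞} (f : X ⟶ Y) (x : X ⊗ P ⟶ Q) (y : Y ⊗ P ⟶ S)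
    {φ : Q ⟶ S} (h : x ≫ φ = f ▷ P ≫ y) (z : Z ⊗ Q ⟶ T) (z' : Z ⊗ S ⟶ U) (ψ : T ⟶ U)
    (h' : Z ◁ φ ≫ z' = z ≫ ψ) :
    ((α_ Z X P).hom ≫ Z ◁ x ≫ z) ≫ ψ = (Z ◁ f) ▷ P ≫ (α_ Z Y P).hom ≫ Z ◁ y ≫ z' := by
  rw [Category.assoc, Category.assoc, ← h', ← whiskerLeft_comp_assoc, h]
  simp

/-- Both bracketings are flattened by the same underlying composite, so an associator becomes an
identity and its word is empty. The same holds for the inverse associator and the unitors below. -/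
theorem associatorHom_coherence {X Y Z P Q S T : 𝒞} (z : Z ⊗ P ⟶ Q) (y : Y ⊗ Q ⟶ S)
    (x : X ⊗ S ⟶ T) :
    ((α_ (X ⊗ Y) Z P).hom ≫ (X ⊗ Y) ◁ z ≫ (α_ X Y Q).hom ≫ X ◁ y ≫ x) ≫ 𝟙 T =
      (α_ X Y Z).hom ▷ P ≫ (α_ X (Y ⊗ Z) P).hom ≫ X ◁ ((α_ Y Z P).hom ≫ Y ◁ z ≫ y) ≫ x := by
  simp

theorem associatorInv_coherence {X Y Z P Q S T : 𝒞} (z : Z ⊗ P ⟶ Q) (y : Y ⊗ Q ⟶ S)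
    (x : X ⊗ S ⟶ T) :
    ((α_ X (Y ⊗ Z) P).hom ≫ X ◁ ((α_ Y Z P).hom ≫ Y ◁ z ≫ y) ≫ x) ≫ 𝟙 T =
      (α_ X Y Z).inv ▷ P ≫
        (α_ (X ⊗ Y) Z P).hom ≫ (X ⊗ Y) ◁ z ≫ (α_ X Y Q).hom ≫ X ◁ y ≫ x := by
  simp

theorem leftUnitorHom_coherence {X P Q : 𝒞} (x : X ⊗ P ⟶ Q) :
    ((α_ (𝟙_ 𝒞) X P).hom ≫ 𝟙_ 𝒞 ◁ x ≫ (λ_ Q).hom) ≫ 𝟙 Q = (λ_ X).hom ▷ P ≫ x := by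
  simp

theorem leftUnitorInv_coherence {X P Q : 𝒞} (x : X ⊗ P ⟶ Q) :
    x ≫ 𝟙 Q = (λ_ X).inv ▷ P ≫ (α_ (𝟙_ 𝒞) X P).hom ≫ 𝟙_ 𝒞 ◁ x ≫ (λ_ Q).hom := by
  simp

theorem rightUnitorHom_coherence {X P Q : 𝒞} (x : X ⊗ P ⟶ Q) :
    ((α_ X (𝟙_ 𝒞) P).hom ≫ X ◁ (λ_ P).hom ≫ x) ≫ 𝟙 Q = (ρ_ X).hom ▷ P ≫ x := by
  simp

theorem rightUnitorInv_coherence {X P Q : 𝒞} (x : X ⊗ P ⟶ Q) :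
    x ≫ 𝟙 Q = (ρ_ X).inv ▷ P ≫ (α_ X (𝟙_ 𝒞) P).hom ≫ X ◁ (λ_ P).hom ≫ x := by
  simp

/-- `X` is a bracketed tensor product of copies of `R`. -/
class Flat (R X : 𝒞) (a : outParam Shape) where
  /-- the coherence isomorphism with a tensor power -/
  iso (n : ℕ) : X ⊗ pow R n ≅ pow R (a.len n)
  natural {m n : ℕ} (f : pow R m ⟶ pow R n) : X ◁ f ≫ (iso n).hom = (iso m).hom ≫ a.map f


variable (R : 𝒞)

instance flatUnit : Flat R (𝟙_ 𝒞) .unit where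
  iso n := λ_ (pow R n)
  natural f := leftUnitor_naturality f

instance flatOne : Flat R R .one where
  iso n := Iso.refl (R ⊗ pow R n)
  natural f := (Category.comp_id (R ◁ f)).trans (Category.id_comp (R ◁ f)).symm

instance flatTensor {X Y : 𝒞} {a b : Shape} [Flat R X a] [Flat R Y b] :
    Flat R (X ⊗ Y) (.tensor a b) where
  iso n := α_ X Y (pow R n) ≪≫ whiskerLeftIso X (Flat.iso n) ≪≫
    (Flat.iso (b.len n) : X ⊗ pow R (b.len n) ≅ pow R (a.len (b.len n)))
  natural {m n} f := by
    change (X ⊗ Y) ◁ f ≫ (α_ X Y (pow R n)).hom ≫ X ◁ (Flat.iso n).hom ≫ (Flat.iso (b.len n)).hom =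
      ((α_ X Y (pow R m)).hom ≫ X ◁ (Flat.iso m).hom ≫ (Flat.iso (b.len m)).hom) ≫ a.map (b.map f)
    rw [associator_naturality_right_assoc, ← whiskerLeft_comp_assoc, Flat.natural f,
      whiskerLeft_comp_assoc, Flat.natural, Category.assoc, Category.assoc]

/-- The morphism `f ⊗ 1`, transported to tensor powers. -/
def flatten {X Y : 𝒞} {a b : Shape} [Flat R X a] [Flat R Y b] (f : X ⟶ Y) (n : ℕ) :
    pow R (a.len n) ⟶ pow R (b.len n) :=
  (Flat.iso n).inv ≫ f ▷ pow R n ≫ (Flat.iso n).hom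

theorem flatten_spec {X Y : 𝒞} {a b : Shape} [Flat R X a] [Flat R Y b] (f : X ⟶ Y) (n : ℕ) :
    (Flat.iso n).hom ≫ flatten R f n = f ▷ pow R n ≫ (Flat.iso n).hom := by
  simp [flatten]

/-- Recognizes a flattened morphism without inverting the coherence isomorphism; the coherence
lemmas supply exactly this hypothesis. -/
theorem eq_flatten {X Y : 𝒞} {a b : Shape} [Flat R X a] [Flat R Y b] (f : X ⟶ Y) {n : ℕ}
    (φ : pow R (a.len n) ⟶ pow R (b.len n))
    (h : (Flat.iso n : X ⊗ pow R n ≅ pow R (a.len n)).hom ≫ φ =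
      f ▷ pow R n ≫ (Flat.iso n : Y ⊗ pow R n ≅ pow R (b.len n)).hom) : φ = flatten R f n := by
  rw [flatten, ← h, Iso.inv_hom_id_assoc]

variable [BraidedCategory 𝒞] [MonObj R] [ComonObj R]

/-- The word `w` describes the morphism `f` between tensor products of copies of `R`. -/
class HasWord {X Y : 𝒞} {a b : Shape} [Flat R X a] [Flat R Y b] (f : X ⟶ Y)
    (w : outParam Word) : Prop where
  ev_eq (n : ℕ) : ev R (a.len n) w = some ⟨b.len n, flatten R f n⟩

theorem ev_shift_size (a : Shape) (n : ℕ) (w : Word) :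
    ev R (a.len n) (Word.shift a.size w) =
      (ev R n w).map fun f => (⟨a.len f.1, a.map f.2⟩ : PowHom R (a.len n)) := by
  induction a generalizing n w with
  | unit =>
    rw [Shape.size, Word.shift_zero]
    exact Option.map_id.symm ▸ rfl
  | one => exact ev_shift_one n w
  | tensor a b iha ihb =>
    rw [Shape.size, Nat.add_comm, Word.shift_add]
    refine (iha _ _).trans ?_
    rw [ihb, Option.map_map]
    rfl

variable {X Y Z W : 𝒞} {a b c d : Shape} [Flat R X a] [Flat R Y b] [Flat R Z c] [Flat R W d]

/-- With no extra strands, flattening is whiskering by the unit object up to isomorphism, and that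
is faithful. -/
theorem eq_of_flatten {f g : X ⟶ Y} (h : flatten R f 0 = flatten R g 0) : f = g := by
  have : f ▷ pow R 0 = g ▷ pow R 0 := by
    simpa [flatten] using h
  exact whiskerRight_iff f g |>.1 this

/-- Morphisms are equal if their words are related by valid rules. -/
theorem eq_of_check {rules : List Word.Rule} (hr : ∀ r ∈ rules, r.Valid R) {f g : X ⟶ Y}
    {w w' : Word} [hf : HasWord R f w] [hg : HasWord R g w'] (l l' : List (ℕ × ℕ))
    (h : Word.check rules (a.len 0) w w' l l' = true) : f = g := by
  have := sameFrom_of_check hr h _ le_rfl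
  rw [hf.ev_eq, hg.ev_eq, Option.some.injEq, Sigma.mk.injEq] at this
  exact eq_of_flatten R (eq_of_heq this.2)

instance hasWordId : HasWord R (𝟙 X) [] where
  ev_eq n := by
    simp only [ev, flatten, id_whiskerRight, Category.id_comp, Iso.inv_hom_id]

theorem flatten_comp (f : X ⟶ Y) (g : Y ⟶ Z) (n : ℕ) :
    flatten R (f ≫ g) n = flatten R f n ≫ flatten R g n := by
  simp [flatten]

instance hasWordComp (f : X ⟶ Y) (g : Y ⟶ Z) {w w' : Word} [hf : HasWord R f w]
    [hg : HasWord R g w'] : HasWord R (f ≫ g) (w ++ w') where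
  ev_eq n := by
    rw [ev_append, hf.ev_eq, Option.bind_some, hg.ev_eq, flatten_comp]
    rfl

instance hasWordWhiskerRight (f : X ⟶ Y) {w : Word} [hf : HasWord R f w] :
    HasWord R (f ▷ Z) w where
  ev_eq n := by
    refine (hf.ev_eq (c.len n)).trans (congrArg some (Sigma.ext rfl (heq_of_eq ?_)))
    exact eq_flatten (a := .tensor a c) (b := .tensor b c) (n := n) R (f ▷ Z) _
      (whiskerRight_coherence f (Flat.iso n).hom _ _ _ (flatten_spec R f (c.len n)))

instance hasWordWhiskerLeft (f : X ⟶ Y) {w : Word} [hf : HasWord R f w] :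
    HasWord R (Z ◁ f) (Word.shift c.size w) where
  ev_eq n := by
    refine (ev_shift_size R c _ w).trans ?_
    rw [hf.ev_eq]
    refine congrArg some (Sigma.ext rfl (heq_of_eq ?_))
    exact eq_flatten (a := .tensor c a) (b := .tensor c b) (n := n) R (Z ◁ f) _
      (whiskerLeft_coherence f _ _ (flatten_spec R f n) _ _ _
      (Flat.natural (flatten R f n)))

instance hasWordTensorHom (f : X ⟶ Y) (g : Z ⟶ W) {w w' : Word} [hf : HasWord R f w]
    [hg : HasWord R g w'] : HasWord R (f ⊗ₘ g) (w ++ Word.shift b.size w') := by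
  rw [MonoidalCategory.tensorHom_def]
  infer_instance

instance hasWordAssociatorHom : HasWord R (α_ X Y Z).hom [] where
  ev_eq n := congrArg some (Sigma.ext rfl (heq_of_eq
    (eq_flatten (a := .tensor (.tensor a b) c) (b := .tensor a (.tensor b c)) (n :=
        n) R (α_ X Y Z).hom (𝟙 (pow R (a.len (b.len (c.len n)))))
      (associatorHom_coherence (Flat.iso n).hom (Flat.iso (c.len n)).hom (Flat.iso (b.len (c.len
          n))).hom))))

instance hasWordAssociatorInv : HasWord R (α_ X Y Z).inv [] where
  ev_eq n := congrArg some (Sigma.ext rfl (heq_of_eq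
    (eq_flatten (a := .tensor a (.tensor b c)) (b := .tensor (.tensor a b) c) (n :=
        n) R (α_ X Y Z).inv (𝟙 (pow R (a.len (b.len (c.len n)))))
      (associatorInv_coherence (Flat.iso n).hom (Flat.iso (c.len n)).hom (Flat.iso (b.len (c.len
          n))).hom))))

instance hasWordLeftUnitorHom : HasWord R (λ_ X).hom [] where
  ev_eq n := congrArg some (Sigma.ext rfl (heq_of_eq
    (eq_flatten (a := .tensor .unit a) (b := a) (n := n) R (λ_ X).hom (𝟙 (pow R (a.len n)))
        (leftUnitorHom_coherence (Flat.iso n).hom))))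

instance hasWordLeftUnitorInv : HasWord R (λ_ X).inv [] where
  ev_eq n := congrArg some (Sigma.ext rfl (heq_of_eq
    (eq_flatten (a := a) (b := .tensor .unit a) (n := n) R (λ_ X).inv (𝟙 (pow R (a.len n)))
        (leftUnitorInv_coherence (Flat.iso n).hom))))

instance hasWordRightUnitorHom : HasWord R (ρ_ X).hom [] where
  ev_eq n := congrArg some (Sigma.ext rfl (heq_of_eq
    (eq_flatten (a := .tensor a .unit) (b := a) (n := n) R (ρ_ X).hom (𝟙 (pow R (a.len n)))
        (rightUnitorHom_coherence (Flat.iso n).hom))))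

instance hasWordRightUnitorInv : HasWord R (ρ_ X).inv [] where
  ev_eq n := congrArg some (Sigma.ext rfl (heq_of_eq
    (eq_flatten (a := a) (b := .tensor a .unit) (n := n) R (ρ_ X).inv (𝟙 (pow R (a.len n)))
        (rightUnitorInv_coherence (Flat.iso n).hom))))

end Words

/-! ### Words of the generators and of the braidings of tensor products -/

section Atoms

variable {𝒞 : Type u} [Category.{v} 𝒞] [MonoidalCategory 𝒞]

theorem coherence_zero_one {R : 𝒞} (m : 𝟙_ 𝒞 ⟶ R) (P : 𝒞) :
    (λ_ P).hom ≫ ((λ_ P).inv ≫ m ▷ P) ≫ 𝟙 (R ⊗ P) =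
      m ▷ P ≫ 𝟙 (R ⊗ P) := by
  simp

theorem coherence_zero_two {R : 𝒞} (m : 𝟙_ 𝒞 ⟶ R ⊗ R) (P : 𝒞) :
    (λ_ P).hom ≫ ((λ_ P).inv ≫ m ▷ P ≫ (α_ R R P).hom) ≫ 𝟙 (R ⊗ R ⊗ P) =
      m ▷ P ≫ ((α_ R R P).hom ≫ R ◁ 𝟙 (R ⊗ P) ≫ 𝟙 (R ⊗ R ⊗ P)) := by
  simp

theorem coherence_one_zero {R : 𝒞} (m : R ⟶ 𝟙_ 𝒞) (P : 𝒞) :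
    𝟙 (R ⊗ P) ≫ (m ▷ P ≫ (λ_ P).hom) ≫ 𝟙 (P) =
      m ▷ P ≫ (λ_ P).hom := by
  simp

theorem coherence_one_one {R : 𝒞} (m : R ⟶ R) (P : 𝒞) :
    𝟙 (R ⊗ P) ≫ (m ▷ P) ≫ 𝟙 (R ⊗ P) =
      m ▷ P ≫ 𝟙 (R ⊗ P) := by
  simp

theorem coherence_one_two {R : 𝒞} (m : R ⟶ R ⊗ R) (P : 𝒞) :
    𝟙 (R ⊗ P) ≫ (m ▷ P ≫ (α_ R R P).hom) ≫ 𝟙 (R ⊗ R ⊗ P) =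
      m ▷ P ≫ ((α_ R R P).hom ≫ R ◁ 𝟙 (R ⊗ P) ≫ 𝟙 (R ⊗ R ⊗ P)) := by
  simp

theorem coherence_two_zero {R : 𝒞} (m : R ⊗ R ⟶ 𝟙_ 𝒞) (P : 𝒞) :
    ((α_ R R P).hom ≫ R ◁ 𝟙 (R ⊗ P) ≫ 𝟙 (R ⊗ R ⊗ P)) ≫ ((α_ R R P).inv ≫ m ▷ P ≫ (λ_ P).hom) ≫
        𝟙 (P) =
      m ▷ P ≫ (λ_ P).hom := by
  simp

theorem coherence_two_one {R : 𝒞} (m : R ⊗ R ⟶ R) (P : 𝒞) :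
    ((α_ R R P).hom ≫ R ◁ 𝟙 (R ⊗ P) ≫ 𝟙 (R ⊗ R ⊗ P)) ≫ ((α_ R R P).inv ≫ m ▷ P) ≫ 𝟙 (R ⊗ P) =
      m ▷ P ≫ 𝟙 (R ⊗ P) := by
  simp

theorem coherence_two_two {R : 𝒞} (m : R ⊗ R ⟶ R ⊗ R) (P : 𝒞) :
    ((α_ R R P).hom ≫ R ◁ 𝟙 (R ⊗ P) ≫ 𝟙 (R ⊗ R ⊗ P)) ≫ ((α_ R R P).inv ≫ m ▷ P ≫ (α_ R R P).hom) ≫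
        𝟙 (R ⊗ R ⊗ P) =
      m ▷ P ≫ ((α_ R R P).hom ≫ R ◁ 𝟙 (R ⊗ P) ≫ 𝟙 (R ⊗ R ⊗ P)) := by
  simp

variable (R : 𝒞) [MonObj R] [ComonObj R]

/-- The copairing `δη` of a Frobenius monoid. -/
def copairing : 𝟙_ 𝒞 ⟶ R ⊗ R := η[R] ≫ Δ[R]

/-- The pairing `εμ` of a Frobenius monoid. -/
def pairing : R ⊗ R ⟶ 𝟙_ 𝒞 := μ[R] ≫ ε[R]

variable [BraidedCategory 𝒞]

instance hasWordMul : HasWord R μ[R] [(0, .mul)] where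
  ev_eq n := congrArg some (Sigma.ext rfl (heq_of_eq
    (eq_flatten (a := .tensor .one .one) (b := .one) (n := n) R μ[R] _
      (coherence_two_one μ[R] (pow R n)))))

instance hasWordUnit : HasWord R η[R] [(0, .unit)] where
  ev_eq n := by
    have h := congrArg (fun φ => some (⟨_, φ⟩ : PowHom R n))
      (eq_flatten (a := .unit) (b := .one) (n := n) R η[R] _ (coherence_zero_one η[R] (pow R n)))
    cases n <;> exact h

instance hasWordComul : HasWord R Δ[R] [(0, .comul)] where
  ev_eq n := congrArg some (Sigma.ext rfl (heq_of_eq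
    (eq_flatten (a := .one) (b := .tensor .one .one) (n := n) R Δ[R] _
      (coherence_one_two Δ[R] (pow R n)))))

instance hasWordCounit : HasWord R ε[R] [(0, .counit)] where
  ev_eq n := congrArg some (Sigma.ext rfl (heq_of_eq
    (eq_flatten (a := .one) (b := .unit) (n := n) R ε[R] _
      (coherence_one_zero ε[R] (pow R n)))))

instance hasWordCup : HasWord R (copairing R) [(0, .cup)] where
  ev_eq n := by
    have h := congrArg (fun φ => some (⟨_, φ⟩ : PowHom R n))
      (eq_flatten (a := .unit) (b := .tensor .one .one) (n :=
          n) R (copairing R) _ (coherence_zero_two (copairing R) (pow R n)))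
    cases n <;> exact h

instance hasWordCap : HasWord R (pairing R) [(0, .cap)] where
  ev_eq n := congrArg some (Sigma.ext rfl (heq_of_eq
    (eq_flatten (a := .tensor .one .one) (b := .unit) (n := n) R (pairing R) _
      (coherence_two_zero (pairing R) (pow R n)))))

instance hasWordBraid : HasWord R (β_ R R).hom [(0, .braid)] where
  ev_eq n := congrArg some (Sigma.ext rfl (heq_of_eq
    (eq_flatten (a := .tensor .one .one) (b := .tensor .one .one) (n := n) R (β_ R R).hom _
      (coherence_two_two (β_ R R).hom (pow R n)))))

instance hasWordBraidInv : HasWord R (β_ R R).inv [(0, .braidInv)] where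
  ev_eq n := congrArg some (Sigma.ext rfl (heq_of_eq
    (eq_flatten (a := .tensor .one .one) (b := .tensor .one .one) (n := n) R (β_ R R).inv _
      (coherence_two_two (β_ R R).inv (pow R n)))))

instance hasWordCurl : HasWord R (curl R) [(0, .curl)] where
  ev_eq n := congrArg some (Sigma.ext rfl (heq_of_eq
    (eq_flatten (a := .one) (b := .one) (n := n) R (curl R) _
      (coherence_one_one (curl R) (pow R n)))))

instance hasWordCurlInv : HasWord R (curlInv R) [(0, .curlInv)] where
  ev_eq n := congrArg some (Sigma.ext rfl (heq_of_eq
    (eq_flatten (a := .one) (b := .one) (n := n) R (curlInv R) _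
      (coherence_one_one (curlInv R) (pow R n)))))

instance hasWordLoop : HasWord R (loop R) [(0, .loop)] where
  ev_eq n := congrArg some (Sigma.ext rfl (heq_of_eq
    (eq_flatten (a := .one) (b := .one) (n := n) R (loop R) _
      (coherence_one_one (loop R) (pow R n)))))

instance hasWordLoopInv : HasWord R (loopInv R) [(0, .loopInv)] where
  ev_eq n := congrArg some (Sigma.ext rfl (heq_of_eq
    (eq_flatten (a := .one) (b := .one) (n := n) R (loopInv R) _
      (coherence_one_one (loopInv R) (pow R n)))))


variable {X Y Z W : 𝒞} {a b c d : Shape} [Flat R X a] [Flat R Y b] [Flat R Z c] [Flat R W d]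

theorem HasWord.of_eq {f g : X ⟶ Y} (h : f = g) {w : Word} [hg : HasWord R g w] : HasWord R f w :=
  h ▸ hg

/-- The hexagon splits the left factor until a single strand `R` is left; only then do the instances
for `β_ R (Y ⊗ Z)` split the right factor. This order expands a braiding of tensor products into
crossings of single strands. -/
instance hasWordBraidTensor {w w' : Word} [HasWord R (β_ X Z).hom w] [HasWord R (β_ Y Z).hom w'] :
    HasWord R (β_ (X ⊗ Y) Z).hom (Word.shift a.size w' ++ (w ++ [])) :=
  HasWord.of_eq R (BraidedCategory.braiding_tensor_left_hom _ _ _)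

instance hasWordBraidTensorInv {w w' : Word} [HasWord R (β_ X Z).inv w]
    [HasWord R (β_ Y Z).inv w'] :
    HasWord R (β_ (X ⊗ Y) Z).inv (w ++ (Word.shift a.size w' ++ [])) :=
  HasWord.of_eq R (BraidedCategory.braiding_tensor_left_inv _ _ _)

instance hasWordBraidOneTensor {w w' : Word} [HasWord R (β_ R Y).hom w]
    [HasWord R (β_ R Z).hom w'] :
    HasWord R (β_ R (Y ⊗ Z)).hom (w ++ (Word.shift b.size w' ++ [])) :=
  HasWord.of_eq R (BraidedCategory.braiding_tensor_right_hom _ _ _)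

instance hasWordBraidOneTensorInv {w w' : Word} [HasWord R (β_ R Y).inv w]
    [HasWord R (β_ R Z).inv w'] :
    HasWord R (β_ R (Y ⊗ Z)).inv (Word.shift b.size w' ++ (w ++ [])) :=
  HasWord.of_eq R (BraidedCategory.braiding_tensor_right_inv _ _ _)

instance hasWordBraidUnit : HasWord R (β_ (𝟙_ 𝒞) X).hom [] :=
  HasWord.of_eq R (braiding_tensorUnit_left _)

instance hasWordBraidUnitInv : HasWord R (β_ (𝟙_ 𝒞) X).inv [] :=
  HasWord.of_eq R (braiding_inv_tensorUnit_left _)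

instance hasWordBraidOneUnit : HasWord R (β_ R (𝟙_ 𝒞)).hom [] :=
  HasWord.of_eq R (braiding_tensorUnit_right _)

instance hasWordBraidOneUnitInv : HasWord R (β_ R (𝟙_ 𝒞)).inv [] :=
  HasWord.of_eq R (braiding_inv_tensorUnit_right _)

instance hasWordTensorMu {w : Word} [HasWord R (β_ Y Z).hom w] :
    HasWord R (tensorμ X Y Z W) (Word.shift a.size w ++ []) :=
  inferInstanceAs (HasWord R ((α_ X Y (Z ⊗ W)).hom ≫ X ◁ (α_ Y Z W).inv ≫
    X ◁ (β_ Y Z).hom ▷ W ≫ X ◁ (α_ Z Y W).hom ≫ (α_ X Z (Y ⊗ W)).inv)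
    ([] ++ (Word.shift a.size [] ++ (Word.shift a.size w ++ (Word.shift a.size [] ++ [])))))

/-- Every number from `a.len 0` on is thus of the form `a.len n`, as `valid_of_eq` needs in order to
pass from a morphism to a rule with an arity. -/
theorem Shape.len_eq (a : Shape) (n : ℕ) : a.len n = a.len 0 + n := by
  induction a generalizing n with
  | unit => simp [Shape.len]
  | one => simp [Shape.len, Nat.add_comm]
  | tensor a b iha ihb => rw [Shape.len, Shape.len, ihb, iha, iha (b.len 0)]; omega

/-- An equation between morphisms yields a valid rule. -/
theorem valid_of_eq {f g : X ⟶ Y} (h : f = g) {w w' : Word} [hf : HasWord R f w]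
    [hg : HasWord R g w'] : Word.Rule.Valid R ⟨a.len 0, w, w'⟩ := by
  subst h
  intro N hN
  obtain ⟨n, rfl⟩ : ∃ n, N = a.len n := ⟨N - a.len 0, by rw [Shape.len_eq]; exact
      (Nat.add_sub_of_le hN).symm⟩
  rw [hf.ev_eq, hg.ev_eq]

end Atoms

/-! ### The calculus of a separable Frobenius monoid with its curls -/

section Rules

variable {𝒞 : Type u} [Category.{v} 𝒞] [MonoidalCategory 𝒞]
variable (R : 𝒞) [MonObj R] [ComonObj R]

theorem mul_counit_eq : μ[R] ≫ ε[R] = pairing R := rfl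

theorem one_comul_eq : η[R] ≫ Δ[R] = copairing R := rfl

section

variable [IsFrobenius R]

theorem copairing_pairing :
    (λ_ R).inv ≫ copairing R ▷ R ≫ (α_ R R R).hom ≫ R ◁ pairing R ≫ (ρ_ R).hom = 𝟙 R := by
  have h := snake_right R
  rw [← copairing, ← pairing] at h
  rw [reassoc_of% h, Iso.inv_hom_id]

theorem pairing_copairing :
    (ρ_ R).inv ≫ R ◁ copairing R ≫ (α_ R R R).inv ≫ pairing R ▷ R ≫ (λ_ R).hom = 𝟙 R := by
  have h := snake_left R
  rw [← copairing, ← pairing] at h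
  rw [reassoc_of% h, Iso.inv_hom_id]

/-- Insert the unit on the right and apply the Frobenius law. Since δ is determined by μ and the
copairing, the derivations usually eliminate it at once. The mirror form follows, and comparing the
two makes the copairing central. -/
theorem comul_eq_left :
    Δ[R] = (ρ_ R).inv ≫ R ◁ copairing R ≫ (α_ R R R).inv ≫ μ[R] ▷ R := by
  have h := IsFrobenius.frobenius (R := R)
  rw [copairing, whiskerLeft_comp, Category.assoc, ← h, whisker_exchange_assoc,
    ← rightUnitor_inv_naturality_assoc]
  simp [← whiskerLeft_comp]

theorem comul_eq_right :
    Δ[R] = (λ_ R).inv ≫ copairing R ▷ R ≫ (α_ R R R).hom ≫ R ◁ μ[R] := by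
  have h := IsFrobenius.frobenius (R := R)
  rw [copairing, comp_whiskerRight, Category.assoc, h, ← whisker_exchange_assoc,
    ← leftUnitor_inv_naturality_assoc]
  simp [← comp_whiskerRight]

end

/-- Separability enters the rewriting only in this form. -/
theorem copairing_mul [IsSeparableFrobenius R] : copairing R ≫ μ[R] = η[R] := by
  rw [copairing, Category.assoc, IsSeparableFrobenius.comul_mul, Category.comp_id]

variable [BraidedCategory 𝒞]

theorem curl_eq : curl R = (λ_ R).inv ≫ copairing R ▷ R ≫ (α_ R R R).hom ≫
    R ◁ (β_ R R).hom ≫ (α_ R R R).inv ≫ pairing R ▷ R ≫ (λ_ R).hom := rfl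

theorem curlInv_eq : curlInv R = (ρ_ R).inv ≫ R ◁ copairing R ≫ (α_ R R R).inv ≫
    (β_ R R).inv ▷ R ≫ (α_ R R R).hom ≫ R ◁ pairing R ≫ (ρ_ R).hom := rfl

theorem loop_eq : loop R = (λ_ R).inv ≫ copairing R ▷ R ≫ (α_ R R R).hom ≫
    R ◁ (β_ R R).inv ≫ (α_ R R R).inv ≫ pairing R ▷ R ≫ (λ_ R).hom := rfl

theorem loopInv_eq : loopInv R = (ρ_ R).inv ≫ R ◁ copairing R ≫ (α_ R R R).inv ≫
    (β_ R R).hom ▷ R ≫ (α_ R R R).hom ≫ R ◁ pairing R ≫ (ρ_ R).hom := rfl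

/-- The axioms of separable Frobenius monoids in braided monoidal categories, and the naturality
of the braiding, as rewriting rules. -/
def basicRules : List Word.Rule := [
    ⟨1, [(0, .unit), (0, .mul)], []⟩,
    ⟨1, [(1, .unit), (0, .mul)], []⟩,
    ⟨3, [(0, .mul), (0, .mul)], [(1, .mul), (0, .mul)]⟩,
    ⟨1, [(0, .comul)], [(1, .cup), (0, .mul)]⟩,
    ⟨1, [(0, .comul)], [(0, .cup), (1, .mul)]⟩,
    ⟨2, [(0, .mul), (0, .counit)], [(0, .cap)]⟩,
    ⟨0, [(0, .unit), (0, .comul)], [(0, .cup)]⟩,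
    ⟨0, [(0, .cup), (0, .mul)], [(0, .unit)]⟩,
    ⟨1, [(0, .cup), (1, .cap)], []⟩,
    ⟨1, [(1, .cup), (0, .cap)], []⟩,
    ⟨2, [(0, .braid), (0, .braidInv)], []⟩,
    ⟨2, [(0, .braidInv), (0, .braid)], []⟩,
    ⟨1, [(0, .curl)], [(0, .cup), (1, .braid), (0, .cap)]⟩,
    ⟨1, [(0, .curlInv)], [(1, .cup), (0, .braidInv), (1, .cap)]⟩,
    ⟨1, [(0, .loop)], [(0, .cup), (1, .braidInv), (0, .cap)]⟩,
    ⟨1, [(0, .loopInv)], [(1, .cup), (0, .braid), (1, .cap)]⟩,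
    ⟨1, [(0, .unit), (0, .braid)], [(1, .unit)]⟩,
    ⟨1, [(1, .unit), (0, .braid)], [(0, .unit)]⟩,
    ⟨3, [(0, .mul), (0, .braid)], [(1, .braid), (0, .braid), (1, .mul)]⟩,
    ⟨3, [(1, .mul), (0, .braid)], [(0, .braid), (1, .braid), (0, .mul)]⟩,
    ⟨1, [(0, .unit), (0, .braidInv)], [(1, .unit)]⟩,
    ⟨1, [(1, .unit), (0, .braidInv)], [(0, .unit)]⟩,
    ⟨3, [(0, .mul), (0, .braidInv)], [(1, .braidInv), (0, .braidInv), (1, .mul)]⟩,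
    ⟨3, [(1, .mul), (0, .braidInv)], [(0, .braidInv), (1, .braidInv), (0, .mul)]⟩,
    ⟨1, [(1, .cup), (0, .braid), (1, .braid)], [(0, .cup)]⟩,
    ⟨1, [(1, .cup), (0, .braidInv), (1, .braidInv)], [(0, .cup)]⟩,
    ⟨3, [(1, .braid), (0, .braid), (1, .braid)], [(0, .braid), (1, .braid), (0, .braid)]⟩,
    ⟨1, [(0, .cup), (1, .braid), (0, .braid)], [(1, .cup)]⟩,
    ⟨1, [(0, .cup), (1, .braidInv), (0, .braidInv)], [(1, .cup)]⟩,
    ⟨3, [(1, .braid), (0, .braid), (1, .cap)], [(0, .cap)]⟩,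
    ⟨3, [(1, .braidInv), (0, .braidInv), (1, .cap)], [(0, .cap)]⟩,
    ⟨3, [(0, .braid), (1, .braid), (0, .cap)], [(1, .cap)]⟩,
    ⟨3, [(0, .braidInv), (1, .braidInv), (0, .cap)], [(1, .cap)]⟩,
    ⟨3, [(1, .braidInv), (0, .braidInv), (1, .braidInv)], [(0, .braidInv), (1, .braidInv), (0,
        .braidInv)]⟩,
    ⟨3, [(1, .braid), (0, .braid), (1, .braidInv)], [(0, .braidInv), (1, .braid), (0, .braid)]⟩,
    ⟨3, [(1, .braidInv), (0, .braidInv), (1, .braid)], [(0, .braid), (1, .braidInv), (0,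
        .braidInv)]⟩,
    ⟨3, [(1, .braid), (0, .braidInv), (1, .braidInv)], [(0, .braidInv), (1, .braidInv), (0,
        .braid)]⟩,
    ⟨3, [(1, .braidInv), (0, .braid), (1, .braid)], [(0, .braid), (1, .braid), (0, .braidInv)]⟩,
    ⟨2, [(0, .braid), (0, .curl)], [(1, .curl), (0, .braid)]⟩,
    ⟨2, [(0, .braid), (1, .curl)], [(0, .curl), (0, .braid)]⟩,
    ⟨2, [(0, .braid), (0, .curlInv)], [(1, .curlInv), (0, .braid)]⟩,
    ⟨2, [(0, .braid), (0, .loop)], [(1, .loop), (0, .braid)]⟩,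
    ⟨2, [(0, .braid), (1, .loop)], [(0, .loop), (0, .braid)]⟩,
    ⟨2, [(0, .braid), (1, .loopInv)], [(0, .loopInv), (0, .braid)]⟩,
    ⟨2, [(0, .braidInv), (0, .curl)], [(1, .curl), (0, .braidInv)]⟩,
    ⟨2, [(0, .braidInv), (1, .curl)], [(0, .curl), (0, .braidInv)]⟩,
    ⟨2, [(0, .braidInv), (1, .curlInv)], [(0, .curlInv), (0, .braidInv)]⟩,
    ⟨2, [(0, .braidInv), (0, .loop)], [(1, .loop), (0, .braidInv)]⟩,
    ⟨2, [(0, .braidInv), (1, .loop)], [(0, .loop), (0, .braidInv)]⟩,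
    ⟨2, [(0, .braidInv), (0, .loopInv)], [(1, .loopInv), (0, .braidInv)]⟩,
    ⟨2, [(0, .braidInv), (1, .loopInv)], [(0, .loopInv), (0, .braidInv)]⟩]

theorem basicRules_valid [IsSeparableFrobenius R] : ∀ r ∈ basicRules, r.Valid R := by
  simp only [basicRules, List.forall_mem_cons]
  -- Each entry is elaborated without its expected type, so that instance search computes the words
  -- of the two sides; they agree with the listed ones after unfolding shifts and concatenations.
  exact ⟨(valid_of_eq R (MonObj.one_mul R) :),
    (valid_of_eq R (MonObj.mul_one R) :),
    (valid_of_eq R (MonObj.mul_assoc R) :),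
    (valid_of_eq R (comul_eq_left R) :),
    (valid_of_eq R (comul_eq_right R) :),
    (valid_of_eq R (mul_counit_eq R) :),
    (valid_of_eq R (one_comul_eq R) :),
    (valid_of_eq R (copairing_mul R) :),
    (valid_of_eq R (copairing_pairing R) :),
    (valid_of_eq R (pairing_copairing R) :),
    (valid_of_eq R ((β_ R R).hom_inv_id) :),
    (valid_of_eq R ((β_ R R).inv_hom_id) :),
    (valid_of_eq R (curl_eq R) :),
    (valid_of_eq R (curlInv_eq R) :),
    (valid_of_eq R (loop_eq R) :),
    (valid_of_eq R (loopInv_eq R) :),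
    (valid_of_eq R (BraidedCategory.braiding_naturality_left η[R] R) :),
    (valid_of_eq R (BraidedCategory.braiding_naturality_right R η[R]) :),
    (valid_of_eq R (BraidedCategory.braiding_naturality_left μ[R] R) :),
    (valid_of_eq R (BraidedCategory.braiding_naturality_right R μ[R]) :),
    (valid_of_eq R (BraidedCategory.braiding_inv_naturality_left η[R] R) :),
    (valid_of_eq R (BraidedCategory.braiding_inv_naturality_right R η[R]) :),
    (valid_of_eq R (BraidedCategory.braiding_inv_naturality_left μ[R] R) :),
    (valid_of_eq R (BraidedCategory.braiding_inv_naturality_right R μ[R]) :),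
    (valid_of_eq R (BraidedCategory.braiding_naturality_right R (copairing R)) :),
    (valid_of_eq R (BraidedCategory.braiding_inv_naturality_right R (copairing R)) :),
    (valid_of_eq R (BraidedCategory.braiding_naturality_left (β_ R R).hom R).symm :),
    (valid_of_eq R (BraidedCategory.braiding_naturality_left (copairing R) R) :),
    (valid_of_eq R (BraidedCategory.braiding_inv_naturality_left (copairing R) R) :),
    (valid_of_eq R (BraidedCategory.braiding_naturality_left (pairing R) R).symm :),
    (valid_of_eq R (BraidedCategory.braiding_inv_naturality_left (pairing R) R).symm :),
    (valid_of_eq R (BraidedCategory.braiding_naturality_right R (pairing R)).symm :),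
    (valid_of_eq R (BraidedCategory.braiding_inv_naturality_right R (pairing R)).symm :),
    (valid_of_eq R (BraidedCategory.braiding_inv_naturality_left (β_ R R).inv R).symm :),
    (valid_of_eq R (BraidedCategory.braiding_naturality_left (β_ R R).inv R).symm :),
    (valid_of_eq R (BraidedCategory.braiding_inv_naturality_left (β_ R R).hom R).symm :),
    (valid_of_eq R (BraidedCategory.braiding_inv_naturality_right R (β_ R R).hom) :),
    (valid_of_eq R (BraidedCategory.braiding_naturality_right R (β_ R R).inv) :),
    (valid_of_eq R (BraidedCategory.braiding_naturality_right R (curl R)).symm :),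
    (valid_of_eq R (BraidedCategory.braiding_naturality_left (curl R) R).symm :),
    (valid_of_eq R (BraidedCategory.braiding_naturality_right R (curlInv R)).symm :),
    (valid_of_eq R (BraidedCategory.braiding_naturality_right R (loop R)).symm :),
    (valid_of_eq R (BraidedCategory.braiding_naturality_left (loop R) R).symm :),
    (valid_of_eq R (BraidedCategory.braiding_naturality_left (loopInv R) R).symm :),
    (valid_of_eq R (BraidedCategory.braiding_inv_naturality_right R (curl R)).symm :),
    (valid_of_eq R (BraidedCategory.braiding_inv_naturality_left (curl R) R).symm :),
    (valid_of_eq R (BraidedCategory.braiding_inv_naturality_left (curlInv R) R).symm :),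
    (valid_of_eq R (BraidedCategory.braiding_inv_naturality_right R (loop R)).symm :),
    (valid_of_eq R (BraidedCategory.braiding_inv_naturality_left (loop R) R).symm :),
    (valid_of_eq R (BraidedCategory.braiding_inv_naturality_right R (loopInv R)).symm :),
    (valid_of_eq R (BraidedCategory.braiding_inv_naturality_left (loopInv R) R).symm :),
    fun _ h => (List.not_mem_nil h).elim⟩

/-- Consequences of `basicRules`, with their derivations. -/
def derivedRules : List (Word.Rule × List (ℕ × ℕ) × List (ℕ × ℕ)) := [
    -- The copairing is central: both sides are the comultiplication.
    (⟨1, [(0, .cup), (1, .mul)], [(1, .cup), (0, .mul)]⟩, [(9, 0)], [(7, 0)]),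
    (⟨1, [(0, .cup), (1, .braid)], [(1, .cup), (0, .braidInv)]⟩, [(51, 0), (22, 2)], []),
    (⟨1, [(0, .cup), (1, .braidInv)], [(1, .cup), (0, .braid)]⟩, [(49, 0), (20, 2)], []),
    (⟨3, [(0, .braid), (1, .cap)], [(1, .braidInv), (0, .cap)]⟩, [], [(59, 1), (22, 0)]),
    (⟨3, [(0, .braidInv), (1, .cap)], [(1, .braid), (0, .cap)]⟩, [], [(61, 1), (20, 0)]),
    (⟨1, [(0, .unit), (0, .cap)], [(0, .counit)]⟩, [(11, 1), (0, 0)], []),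
    (⟨0, [(0, .cup), (0, .counit)], [(0, .unit)]⟩, [(113, 1), (18, 1)], []),
    (⟨3, [(0, .mul), (0, .cap)], [(1, .mul), (0, .cap)]⟩, [(11, 1), (4, 0)], [(11, 1)]),
    (⟨1, [(0, .curl), (0, .curlInv)], []⟩, [(24, 0), (104, 0), (26, 3), (106, 0), (16, 1), (55,
    0), (52, 1), (20, 3), (62, 1), (16, 0)], []),
    (⟨1, [(0, .curlInv), (0, .curl)], []⟩, [(24, 1), (104, 0), (26, 0), (110, 1), (105, 3), (25,
    0), (78, 1), (24, 1), (48, 1), (18, 1), (18, 0)], []),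
    (⟨1, [(0, .loop), (0, .loopInv)], []⟩, [(28, 0), (106, 0), (30, 3), (104, 0), (16, 1), (57,
    0), (66, 1), (22, 3), (64, 1), (16, 0)], []),
    (⟨1, [(0, .loopInv), (0, .loop)], []⟩, [(28, 1), (106, 0), (30, 0), (108, 1), (107, 3), (29,
    0), (96, 1), (28, 1), (50, 1), (18, 1), (18, 0)], []),
    (⟨0, [(0, .cup), (0, .braid)], [(0, .cup), (0, .loop)]⟩, [], [(28, 1), (106, 0), (49, 1),
    (54, 0), (18, 1)]),
    (⟨0, [(0, .cup), (0, .braidInv)], [(0, .cup), (0, .curl)]⟩, [], [(24, 1), (104, 0), (51, 1),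
    (56, 0), (18, 1)]),
    (⟨2, [(0, .braid), (0, .cap)], [(0, .loop), (0, .cap)]⟩, [], [(28, 0), (106, 0), (16, 0)]),
    -- The Nakayama property: κ measures the failure of the pairing to be symmetric with respect to
    -- c⁻¹.
    (⟨2, [(0, .braidInv), (0, .cap)], [(0, .curl), (0, .cap)]⟩, [], [(24, 0), (104, 0), (16, 0)]),
    -- `curl` and `loopInv` are transposes of each other under the self-duality; the neighbouring
    -- rules are variants for the copairing and the pairing.
    (⟨0, [(0, .cup), (1, .curl)], [(0, .cup), (0, .loopInv)]⟩, [(24, 1), (104, 1)], [(30, 1),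
    (107, 1)]),
    (⟨0, [(0, .cup), (1, .curlInv)], [(0, .cup), (0, .loop)]⟩, [(26, 1), (106, 0), (16, 1)],
    [(127, 0)]),
    (⟨0, [(0, .cup), (1, .loopInv)], [(0, .cup), (0, .curl)]⟩, [(30, 1), (104, 0), (16, 1)],
    [(129, 0)]),
    (⟨2, [(1, .curl), (0, .cap)], [(0, .loopInv), (0, .cap)]⟩, [(24, 0), (111, 1)], [(30, 0),
    (108, 1)]),
    (⟨2, [(1, .curlInv), (0, .cap)], [(0, .loop), (0, .cap)]⟩, [(26, 0), (105, 0), (18, 0)],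
    [(131, 0)]),
    (⟨0, [(0, .unit), (0, .curl)], [(0, .unit)]⟩, [(24, 1), (34, 1), (11, 2), (2, 1)], [(115,
    0)]),
    (⟨0, [(0, .unit), (0, .curlInv)], [(0, .unit)]⟩, [(26, 1), (40, 0), (112, 1), (13, 0), (8,
    1), (10, 2), (16, 0)], []),
    (⟨1, [(0, .curlInv), (0, .loopInv)], [(0, .loopInv), (0, .curlInv)]⟩, [(26, 0), (98, 1),
    (135, 0)], [(26, 1), (101, 0), (141, 2)]),
    (⟨1, [(0, .curlInv), (0, .loop)], [(0, .loop), (0, .curlInv)]⟩, [(26, 0), (94, 1), (137, 0)],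
    [(26, 1), (97, 0), (143, 2)]),
    (⟨0, [(0, .cup), (0, .curl), (0, .braid)], [(0, .cup), (0, .loop), (0, .loopInv)]⟩, [(24, 1),
    (104, 0), (104, 1), (106, 0), (20, 2), (18, 1)], [(122, 1)]),
    (⟨0, [(0, .cup), (0, .loop), (0, .braidInv)], [(0, .cup), (0, .curl), (0, .curlInv)]⟩, [(28,
    1), (106, 0), (106, 1), (104, 0), (22, 2), (18, 1)], [(118, 1)]),
    (⟨2, [(2, .cup), (2, .loop), (1, .braid), (0, .cap)], [(0, .braidInv), (1, .curlInv)]⟩,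
    [(111, 2), (127, 1)], [(26, 1), (110, 2)]),
    (⟨3, [(3, .cup), (2, .braid), (1, .mul), (0, .cap)], [(0, .mul), (0, .braidInv)]⟩, [(107, 0),
    (103, 0), (18, 0)], [(44, 0), (45, 0)]),
    (⟨2, [(2, .cup), (1, .braidInv), (1, .mul), (0, .cap)], [(0, .braid), (0, .curl), (0,
    .mul)]⟩, [(105, 0), (117, 2)], [(24, 1), (37, 1), (102, 0)]),
    (⟨3, [(1, .braidInv), (1, .mul), (0, .cap)], [(0, .braid), (0, .curl), (1, .mul), (0,
    .cap)]⟩, [], [(117, 2), (161, 0), (16, 0)]),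
    (⟨6, [(4, .braidInv), (4, .mul), (3, .mul), (2, .mul), (1, .mul), (0, .cap)], [(3, .braid),
    (2, .braid), (1, .braid), (0, .braid), (0, .curl), (4, .mul), (3, .mul), (2, .mul), (1,
    .mul), (0, .cap)]⟩, [(5, 2), (5, 3), (117, 4), (162, 3), (36, 2)], [(5, 5), (5, 6), (5, 7),
    (37, 0), (37, 1)]),
    (⟨1, [(1, .cup), (0, .braidInv), (1, .mul)], [(0, .curlInv), (1, .cup), (0, .braidInv), (0,
    .mul)]⟩, [], [(93, 0), (26, 2), (47, 1), (103, 1), (103, 2), (18, 2)]),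
    (⟨1, [(1, .cup), (1, .loop), (0, .braid), (1, .mul)], [(0, .loopInv), (1, .cup), (0, .braid),
    (0, .mul), (0, .loop)]⟩, [(83, 1)], [(87, 0), (30, 2), (39, 1), (103, 1), (103, 3), (18, 3)]),
    (⟨1, [(1, .cup), (1, .curl), (0, .braid), (0, .braid), (1, .braid)], [(1, .cup), (0,
    .braidInv), (0, .braidInv)]⟩, [(77, 1), (107, 0), (74, 2), (129, 0), (22, 1)], [(105, 0)]),
    (⟨2, [(2, .cup), (2, .curl), (1, .braidInv), (0, .braid), (0, .braid), (1, .braid)], [(2,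
    .cup), (2, .curl), (0, .braid), (1, .braid), (1, .braid), (0, .braidInv)]⟩, [(139, 0), (105,
    0), (107, 0)], [(139, 1), (107, 1), (55, 1), (68, 1), (52, 3), (20, 5)]),
    -- κ is multiplicative up to the double braiding; the next rule is the analogue for `loop`, with
    -- the inverse double braiding.
    (⟨2, [(0, .mul), (0, .curl)], [(0, .braid), (0, .braid), (0, .curl), (1, .curl), (0, .mul)]⟩,
    [(24, 1), (104, 0), (44, 0), (117, 3)], [(78, 1), (161, 2), (133, 1), (46, 3), (66, 2), (20,
    0)]),
    (⟨2, [(0, .mul), (0, .loop)], [(0, .braidInv), (0, .braidInv), (0, .loop), (1, .loop), (0,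
    .mul)]⟩, [(28, 1), (106, 0), (36, 0), (117, 3)], [(28, 2), (96, 2), (45, 3), (102, 0), (106,
    2), (116, 4), (131, 1), (38, 3), (52, 2), (22, 0)]),
    (⟨1, [(1, .cup), (1, .loop), (0, .braidInv), (1, .braidInv), (0, .braidInv)], [(1, .cup), (1,
    .curl), (1, .curlInv), (0, .braidInv), (1, .braidInv)]⟩, [(67, 2)], [(155, 0)]),
    (⟨1, [(1, .cup), (1, .curl), (0, .braid), (1, .braid), (0, .braid)], [(1, .cup), (1, .loop),
    (1, .loopInv), (0, .braid), (1, .braid)]⟩, [(53, 2)], [(153, 0)]),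
    (⟨6, [(4, .braid), (3, .braid), (2, .braid), (1, .braid), (0, .braid), (0, .curl), (4, .mul),
    (3, .mul), (2, .mul), (1, .mul), (0, .cap)], [(4, .mul), (3, .mul), (2, .mul), (1, .mul), (0,
    .cap)]⟩, [(165, 1), (20, 0)], []),
    (⟨0, [(0, .unit), (0, .loopInv)], [(0, .unit)]⟩, [(30, 1), (32, 0), (112, 1), (113, 1), (41,
    1)], [(147, 0), (26, 1)]),
    (⟨1, [(0, .curl), (0, .counit)], [(0, .counit)]⟩, [(113, 1), (140, 1), (184, 0), (112, 0)],
    [])]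

-- A single evaluation replays all the derivations above.
set_option maxRecDepth 100000 in
theorem checkRules_derivedRules : Word.checkRules basicRules derivedRules = true := by
  decide +kernel

/-- All rewriting rules. -/
def allRules : List Word.Rule := basicRules ++ derivedRules.map Prod.fst

theorem allRules_valid [IsSeparableFrobenius R] : ∀ r ∈ allRules, r.Valid R :=
  valid_of_checkRules (basicRules_valid R) checkRules_derivedRules

end Rules

section Square

variable {𝒞 : Type u} [Category.{v} 𝒞] [MonoidalCategory 𝒞] [BraidedCategory 𝒞]
variable (R : 𝒞) [MonObj R] [ComonObj R]

local notation "A" => FrobeniusSquare R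

/-! ### Words of the structure morphisms of `R ⊗ R` -/

/-- The separate name hides `R ⊗ R` from instance search, so the words of its structure morphisms
are obtained by unfolding the definitions. -/
instance flatSquare : Flat R A (.tensor .one .one) := inferInstanceAs (Flat R (R ⊗ R) _)

section

variable {Z : 𝒞} {c : Shape} [Flat R Z c] {w : Word}

instance hasWordBraidSquare [HasWord R (β_ R Z).hom w] :
    HasWord R (β_ A Z).hom (Word.shift 1 w ++ (w ++ [])) :=
  hasWordBraidTensor R (X := R) (Y := R)

instance hasWordBraidSquareInv [HasWord R (β_ R Z).inv w] :
    HasWord R (β_ A Z).inv (w ++ (Word.shift 1 w ++ [])) :=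
  hasWordBraidTensorInv R (X := R) (Y := R)

end

instance hasWordBraidOneSquare : HasWord R (β_ R A).hom [(0, .braid), (1, .braid)] :=
  hasWordBraidOneTensor R (Y := R) (Z := R)

instance hasWordBraidOneSquareInv : HasWord R (β_ R A).inv [(1, .braidInv), (0, .braidInv)] :=
  hasWordBraidOneTensorInv R (Y := R) (Z := R)

instance hasWordSquareUnit : HasWord R η[A] [(0, .unit), (1, .unit)] :=
  inferInstanceAs (HasWord R ((λ_ (𝟙_ 𝒞)).inv ≫ (η[R] ⊗ₘ η[R])) _)

instance hasWordSquareMul :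
    HasWord R μ[A] [(1, .braid), (0, .braid), (0, .mul), (1, .mul)] :=
  inferInstanceAs (HasWord R (tensorμ R R R R ≫ (((β_ R R).hom ≫ μ[R]) ⊗ₘ μ[R])) _)

section

variable [IsFrobenius R]

instance hasWordSquareCounit : HasWord R ε[A] [(0, .mul), (0, .counit)] :=
  inferInstanceAs (HasWord R (μ[R] ≫ ε[R]) _)

instance hasWordSquareComul : HasWord R Δ[A] [(1, .unit), (1, .comul)] :=
  inferInstanceAs (HasWord R ((ρ_ R).inv ▷ R ≫ (R ◁ (η[R] ≫ Δ[R])) ▷ R ≫ (α_ R R R).inv ▷ R ≫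
    (α_ (R ⊗ R) R R).hom) _)

end

instance hasWordAntipode : HasWord R (frobeniusAntipode R) [(0, .braid), (0, .curl)] :=
  inferInstanceAs (HasWord R ((β_ R R).hom ≫ curl R ▷ R) _)

/-! ### The structure morphisms of the quantum groupoid -/

namespace FrobeniusSquare

/-- The inverse of the antipode. -/
def antipodeInv : A ⟶ A :=
  (curlInv R ▷ R ≫ (β_ R R).inv : R ⊗ R ⟶ R ⊗ R)

instance hasWordAntipodeInv :
    HasWord R (antipodeInv R)
      [(0, .curlInv), (0, .braidInv)] :=
  inferInstanceAs (HasWord R (curlInv R ▷ R ≫ (β_ R R).inv : R ⊗ R ⟶ R ⊗ R) _)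

/-- The projection to the object of objects, which is also the target. -/
def proj : A ⟶ R :=
  (μ[R] : R ⊗ R ⟶ R)

instance hasWordProj :
    HasWord R (proj R)
      [(0, .mul)] :=
  inferInstanceAs (HasWord R (μ[R] : R ⊗ R ⟶ R) _)

/-- The inclusion of the object of objects. -/
def incl : R ⟶ A :=
  ((λ_ R).inv ≫ η[R] ▷ R : R ⟶ R ⊗ R)

instance hasWordIncl :
    HasWord R (incl R)
      [(0, .unit)] :=
  inferInstanceAs (HasWord R ((λ_ R).inv ≫ η[R] ▷ R : R ⟶ R ⊗ R) _)

/-- The source. -/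
def source : A ⟶ R :=
  (curlInv R ▷ R ≫ (β_ R R).inv ≫ μ[R] : R ⊗ R ⟶ R)

instance hasWordSource :
    HasWord R (source R)
      [(0, .curlInv), (0, .braidInv), (0, .mul)] :=
  inferInstanceAs (HasWord R (curlInv R ▷ R ≫ (β_ R R).inv ≫ μ[R] : R ⊗ R ⟶ R) _)

/-- The left coaction of the object of objects. -/
def lcoact : A ⟶ R ⊗ A :=
  (R ◁ Δ[R] ≫ (α_ R R R).inv ≫ (β_ R R).inv ▷ R ≫ (α_ R R R).hom : R ⊗ R ⟶ R ⊗ (R ⊗ R))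

instance hasWordLcoact :
    HasWord R (lcoact R)
      [(1, .comul), (0, .braidInv)] :=
  inferInstanceAs (HasWord R (R ◁ Δ[R] ≫ (α_ R R R).inv ≫ (β_ R R).inv ▷ R ≫ (α_ R R R).hom :
      R ⊗ R ⟶ R ⊗ (R ⊗ R)) _)

/-- The right coaction of the object of objects. -/
def rcoact : A ⟶ A ⊗ R :=
  (R ◁ Δ[R] ≫ (α_ R R R).inv : R ⊗ R ⟶ (R ⊗ R) ⊗ R)

instance hasWordRcoact :
    HasWord R (rcoact R)
      [(1, .comul)] :=
  inferInstanceAs (HasWord R (R ◁ Δ[R] ≫ (α_ R R R).inv : R ⊗ R ⟶ (R ⊗ R) ⊗ R) _)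

/-- A retraction of the left coaction. -/
def lmul : R ⊗ A ⟶ A :=
  ((α_ R R R).inv ≫ (β_ R R).hom ▷ R ≫ (α_ R R R).hom ≫ R ◁ μ[R] : R ⊗ (R ⊗ R) ⟶ R ⊗ R)

instance hasWordLmul :
    HasWord R (lmul R)
      [(0, .braid), (1, .mul)] :=
  inferInstanceAs (HasWord R ((α_ R R R).inv ≫ (β_ R R).hom ▷ R ≫ (α_ R R R).hom ≫ R ◁ μ[R] :
      R ⊗ (R ⊗ R) ⟶ R ⊗ R) _)

/-- A retraction of the right coaction. -/
def rmul : A ⊗ R ⟶ A :=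
  ((α_ R R R).hom ≫ R ◁ μ[R] : (R ⊗ R) ⊗ R ⟶ R ⊗ R)

instance hasWordRmul :
    HasWord R (rmul R)
      [(1, .mul)] :=
  inferInstanceAs (HasWord R ((α_ R R R).hom ≫ R ◁ μ[R] : (R ⊗ R) ⊗ R ⟶ R ⊗ R) _)

/-- The inclusion of the object of composable pairs. -/
def pairs : R ⊗ A ⟶ A ⊗ A :=
  (R ◁ lcoact R ≫ (α_ R R A).inv : R ⊗ A ⟶ (R ⊗ R) ⊗ A)

instance hasWordPairs :
    HasWord R (pairs R)
      [(2, .comul), (1, .braidInv)] :=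
  inferInstanceAs (HasWord R (R ◁ lcoact R ≫ (α_ R R A).inv : R ⊗ A ⟶ (R ⊗ R) ⊗ A) _)

/-- A retraction of `pairs`. -/
def pairsRetr : A ⊗ A ⟶ R ⊗ A :=
  ((α_ R R A).hom ≫ R ◁ lmul R : (R ⊗ R) ⊗ A ⟶ R ⊗ A)

instance hasWordPairsRetr :
    HasWord R (pairsRetr R)
      [(1, .braid), (2, .mul)] :=
  inferInstanceAs (HasWord R ((α_ R R A).hom ≫ R ◁ lmul R : (R ⊗ R) ⊗ A ⟶ R ⊗ A) _)

/-- The left coaction on composable pairs. -/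
def pairsLeft : R ⊗ A ⟶ R ⊗ (R ⊗ A) :=
  R ◁ lcoact R ≫ (α_ R R A).inv ≫ (β_ R R).inv ▷ A ≫ (α_ R R A).hom

instance hasWordPairsLeft :
    HasWord R (pairsLeft R)
      [(2, .comul), (1, .braidInv), (0, .braidInv)] :=
  inferInstanceAs (HasWord R (R ◁ lcoact R ≫ (α_ R R A).inv ≫ (β_ R R).inv ▷ A ≫ (α_ R R A).hom) _)

/-- The right coaction on composable pairs. -/
def pairsRight : R ⊗ A ⟶ (R ⊗ A) ⊗ R :=
  R ◁ rcoact R ≫ (α_ R A R).inv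

instance hasWordPairsRight :
    HasWord R (pairsRight R)
      [(2, .comul)] :=
  inferInstanceAs (HasWord R (R ◁ rcoact R ≫ (α_ R A R).inv) _)

/-- A retraction of `pairsRight`. -/
def pairsRmul : (R ⊗ A) ⊗ R ⟶ R ⊗ A :=
  (α_ R A R).hom ≫ R ◁ rmul R

instance hasWordPairsRmul :
    HasWord R (pairsRmul R)
      [(2, .mul)] :=
  inferInstanceAs (HasWord R ((α_ R A R).hom ≫ R ◁ rmul R) _)

/-- The composition. -/
def compose : R ⊗ A ⟶ A :=
  ((α_ R R R).inv ≫ ((β_ R R).hom ≫ μ[R]) ▷ R : R ⊗ (R ⊗ R) ⟶ R ⊗ R)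

instance hasWordCompose :
    HasWord R (compose R)
      [(0, .braid), (0, .mul)] :=
  inferInstanceAs (HasWord R ((α_ R R R).inv ≫ ((β_ R R).hom ≫ μ[R]) ▷ R : R ⊗ (R ⊗ R) ⟶ R ⊗ R) _)

/-- The inclusion of composable triples. -/
def triples₁ : R ⊗ (R ⊗ A) ⟶ (R ⊗ A) ⊗ A :=
  R ◁ pairs R ≫ (α_ R A A).inv

instance hasWordTriples₁ :
    HasWord R (triples₁ R)
      [(3, .comul), (2, .braidInv)] :=
  inferInstanceAs (HasWord R (R ◁ pairs R ≫ (α_ R A A).inv) _)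

/-- The other inclusion of composable triples. -/
def triples₂ : R ⊗ (R ⊗ A) ⟶ A ⊗ (R ⊗ A) :=
  (R ◁ pairsLeft R ≫ (α_ R R (R ⊗ A)).inv : R ⊗ (R ⊗ A) ⟶ (R ⊗ R) ⊗ (R ⊗ A))

instance hasWordTriples₂ :
    HasWord R (triples₂ R)
      [(3, .comul), (2, .braidInv), (1, .braidInv)] :=
  inferInstanceAs (HasWord R (R ◁ pairsLeft R ≫ (α_ R R (R ⊗ A)).inv :
      R ⊗ (R ⊗ A) ⟶ (R ⊗ R) ⊗ (R ⊗ A)) _)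

/-- A retraction of `triples₁`. -/
def triplesRetr₁ : (R ⊗ A) ⊗ A ⟶ R ⊗ (R ⊗ A) :=
  (α_ R A A).hom ≫ R ◁ pairsRetr R

instance hasWordTriplesRetr₁ :
    HasWord R (triplesRetr₁ R)
      [(2, .braid), (3, .mul)] :=
  inferInstanceAs (HasWord R ((α_ R A A).hom ≫ R ◁ pairsRetr R) _)

/-- A retraction of `triples₂`. -/
def triplesRetr₂ : A ⊗ (R ⊗ A) ⟶ R ⊗ (R ⊗ A) :=
  ((α_ R R (R ⊗ A)).hom ≫ R ◁ ((α_ R R A).inv ≫ (β_ R R).hom ▷ A ≫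
    (α_ R R A).hom ≫ R ◁ lmul R) : (R ⊗ R) ⊗ (R ⊗ A) ⟶ R ⊗ (R ⊗ A))

instance hasWordTriplesRetr₂ :
    HasWord R (triplesRetr₂ R)
      [(1, .braid), (2, .braid), (3, .mul)] :=
  inferInstanceAs (HasWord R ((α_ R R (R ⊗ A)).hom ≫ R ◁ ((α_ R R A).inv ≫ (β_ R R).hom ▷ A ≫
    (α_ R R A).hom ≫ R ◁ lmul R) : (R ⊗ R) ⊗ (R ⊗ A) ⟶ R ⊗ (R ⊗ A)) _)

/-- Composition of the first two arrows. -/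
def composeLeft : R ⊗ (R ⊗ A) ⟶ R ⊗ A :=
  (α_ R R A).inv ≫ ((β_ R R).hom ≫ μ[R]) ▷ A

instance hasWordComposeLeft :
    HasWord R (composeLeft R)
      [(0, .braid), (0, .mul)] :=
  inferInstanceAs (HasWord R ((α_ R R A).inv ≫ ((β_ R R).hom ≫ μ[R]) ▷ A) _)

/-- Insertion of an identity on the left. -/
def insertLeft : A ⟶ R ⊗ A :=
  (λ_ A).inv ≫ η[R] ▷ A

instance hasWordInsertLeft :
    HasWord R (insertLeft R)
      [(0, .unit)] :=
  inferInstanceAs (HasWord R ((λ_ A).inv ≫ η[R] ▷ A) _)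

/-- Insertion of an identity on the right. -/
def insertRight : A ⟶ R ⊗ A :=
  (R ◁ incl R : R ⊗ R ⟶ R ⊗ A)

instance hasWordInsertRight :
    HasWord R (insertRight R)
      [(1, .unit)] :=
  inferInstanceAs (HasWord R (R ◁ incl R : R ⊗ R ⟶ R ⊗ A) _)

/-- The isomorphism `θ`. -/
def shear : R ⊗ A ⟶ R ⊗ A :=
  ((α_ R R R).inv ≫ (β_ R R).hom ▷ R ≫ (α_ R R R).hom ≫ R ◁ (β_ R R).hom ≫
    R ◁ curl R ▷ R : R ⊗ (R ⊗ R) ⟶ R ⊗ (R ⊗ R))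

instance hasWordShear :
    HasWord R (shear R)
      [(0, .braid), (1, .braid), (1, .curl)] :=
  inferInstanceAs (HasWord R ((α_ R R R).inv ≫ (β_ R R).hom ▷ R ≫ (α_ R R R).hom ≫
      R ◁ (β_ R R).hom ≫
    R ◁ curl R ▷ R : R ⊗ (R ⊗ R) ⟶ R ⊗ (R ⊗ R)) _)

/-- The inverse of `θ`. -/
def shearInv : R ⊗ A ⟶ R ⊗ A :=
  (R ◁ curlInv R ▷ R ≫ R ◁ (β_ R R).inv ≫ (α_ R R R).inv ≫ (β_ R R).inv ▷ R ≫
    (α_ R R R).hom : R ⊗ (R ⊗ R) ⟶ R ⊗ (R ⊗ R))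

instance hasWordShearInv :
    HasWord R (shearInv R)
      [(1, .curlInv), (1, .braidInv), (0, .braidInv)] :=
  inferInstanceAs (HasWord R (R ◁ curlInv R ▷ R ≫ R ◁ (β_ R R).inv ≫ (α_ R R R).inv ≫
      (β_ R R).inv ▷ R ≫
    (α_ R R R).hom : R ⊗ (R ⊗ R) ⟶ R ⊗ (R ⊗ R)) _)

/-- Insertion of a copairing. -/
def cupAt (Z : 𝒞) : Z ⟶ R ⊗ (R ⊗ Z) :=
  (λ_ Z).inv ≫ copairing R ▷ Z ≫ (α_ R R Z).hom

instance hasWordCupAt (Z : 𝒞) {c : Shape} [Flat R Z c] :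
    HasWord R (cupAt R Z) [(0, .cup)] :=
  inferInstanceAs (HasWord R ((λ_ Z).inv ≫ copairing R ▷ Z ≫ (α_ R R Z).hom) _)

/-- A crossing of the first two strands. -/
def swapAt (Z : 𝒞) : R ⊗ (R ⊗ Z) ⟶ R ⊗ (R ⊗ Z) :=
  (α_ R R Z).inv ≫ (β_ R R).hom ▷ Z ≫ (α_ R R Z).hom

instance hasWordSwapAt (Z : 𝒞) {c : Shape} [Flat R Z c] :
    HasWord R (swapAt R Z) [(0, .braid)] :=
  inferInstanceAs (HasWord R ((α_ R R Z).inv ≫ (β_ R R).hom ▷ Z ≫ (α_ R R Z).hom) _)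

/-- The left coaction of `A ⊗ A` on composable pairs. -/
def pairsComul : R ⊗ A ⟶ (A ⊗ A) ⊗ (R ⊗ A) :=
  (R ◁ cupAt R (R ⊗ R) ≫ R ◁ R ◁ R ◁ R ◁ cupAt R R ≫ R ◁ R ◁ swapAt R _ ≫
    R ◁ R ◁ R ◁ swapAt R _ ≫ (α_ R R _).inv ≫ (R ⊗ R) ◁ (α_ R R _).inv ≫
    (α_ (R ⊗ R) (R ⊗ R) _).inv : R ⊗ (R ⊗ R) ⟶ ((R ⊗ R) ⊗ (R ⊗ R)) ⊗ (R ⊗ (R ⊗ R)))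

instance hasWordPairsComul :
    HasWord R (pairsComul R)
      [(1, .cup), (4, .cup), (2, .braid), (3, .braid)] :=
  inferInstanceAs (HasWord R (R ◁ cupAt R (R ⊗ R) ≫ R ◁ R ◁ R ◁ R ◁ cupAt R R ≫ R ◁ R ◁ swapAt R _ ≫
    R ◁ R ◁ R ◁ swapAt R _ ≫ (α_ R R _).inv ≫ (R ⊗ R) ◁ (α_ R R _).inv ≫
    (α_ (R ⊗ R) (R ⊗ R) _).inv : R ⊗ (R ⊗ R) ⟶ ((R ⊗ R) ⊗ (R ⊗ R)) ⊗ (R ⊗ (R ⊗ R))) _)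

/-- The right coaction of `A` on composable pairs. -/
def pairsComulRight [IsFrobenius R] : R ⊗ A ⟶ (R ⊗ A) ⊗ A :=
  R ◁ Δ[A] ≫ (α_ R A A).inv

instance hasWordPairsComulRight [IsFrobenius R] :
    HasWord R (pairsComulRight R)
      [(2, .unit), (2, .comul)] :=
  inferInstanceAs (HasWord R (R ◁ Δ[A] ≫ (α_ R A A).inv) _)

end FrobeniusSquare

end Square

/-! ### The string diagram equations -/

section Equations

variable {𝒞 : Type u} [Category.{v} 𝒞] [MonoidalCategory 𝒞] [BraidedCategory 𝒞]
variable (R : 𝒞) [MonObj R] [ComonObj R] [IsSeparableFrobenius R]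

local notation "A" => FrobeniusSquare R

namespace FrobeniusSquare

/-- The right-hand side inserts two copairings, and the product of `A` multiplies their legs
crosswise. Centrality brings both legs of one copairing together, and separability contracts them to
a unit. -/
theorem mul_comul :
    μ[A] ≫ Δ[A] = (Δ[A] ⊗ₘ Δ[A]) ≫ tensorμ A A A A ≫ (μ[A] ⊗ₘ μ[A]) := by
  exact eq_of_check R (allRules_valid R)
    [(6, 4), (0, 3)] [(6, 1), (6, 9), (0, 0), (0, 6), (104, 0), (22, 2), (104, 3), (104, 5), (48,
    3), (106, 3), (20, 5), (102, 4), (102, 3), (4, 5), (14, 4), (2, 4)]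
    (by decide +kernel)

/-- Contracting the inserted copairing leaves a κ⁻¹ and crossings; moving a factor around the
pairing produces the κ that cancels it. -/
theorem mul_counit :
    μ[A] ▷ A ≫ μ[A] ≫ ε[A] =
      (A ◁ Δ[A]) ▷ A ≫ (α_ A A A).inv ▷ A ≫ (α_ (A ⊗ A) A A).hom ≫
        ((μ[A] ≫ ε[A]) ⊗ₘ (μ[A] ≫ ε[A])) ≫ (λ_ (𝟙_ 𝒞)).hom := by
  exact eq_of_check R (allRules_valid R)
    [(10, 8), (36, 2), (36, 2), (4, 8), (116, 7), (4, 6)] [(6, 4), (10, 7), (10, 12), (0, 3),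
    (104, 3), (116, 2), (116, 8), (102, 3), (110, 6), (36, 5), (126, 4), (36, 3), (4, 8), (62,
    2), (156, 2), (92, 2), (164, 3), (76, 6), (76, 5), (76, 4), (76, 3), (120, 2)]
    (by decide +kernel)

theorem mul_counit' :
    μ[A] ▷ A ≫ μ[A] ≫ ε[A] =
      (A ◁ (Δ[A] ≫ (β_ A A).inv)) ▷ A ≫ (α_ A A A).inv ▷ A ≫ (α_ (A ⊗ A) A A).hom ≫
        ((μ[A] ≫ ε[A]) ⊗ₘ (μ[A] ≫ ε[A])) ≫ (λ_ (𝟙_ 𝒞)).hom := by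
  exact eq_of_check R (allRules_valid R)
    [(10, 8), (36, 2), (36, 2), (4, 8), (116, 7), (4, 6), (183, 6), (76, 10), (76, 9), (76, 8),
    (76, 7), (76, 6)] [(6, 1), (10, 11), (10, 16), (0, 0), (128, 0), (106, 0), (104, 0), (102,
    0), (76, 3), (46, 1), (116, 9), (116, 14), (72, 5), (174, 4), (76, 5), (78, 4), (78, 6), (76,
    5), (46, 8), (38, 10), (38, 12), (38, 14), (88, 1), (88, 4), (116, 16), (72, 7), (52, 9),
    (52, 11), (52, 13), (72, 6), (52, 8), (52, 10), (52, 12), (70, 9), (110, 11), (38, 11), (22,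
    10), (70, 2), (110, 4), (38, 7), (22, 3), (152, 3), (122, 4), (158, 3), (44, 2), (38, 8),
    (38, 10), (38, 12), (38, 14), (36, 16), (4, 18), (74, 4), (74, 4), (52, 1), (22, 0), (74, 5),
    (74, 5), (52, 1), (74, 8), (22, 10), (74, 8), (22, 10), (52, 3)]
    (by decide +kernel)

/-- Comultiplying the unit of `A` gives η ⊗ δη ⊗ η, so the two factors multiplied in the middle each
have a unit in the slot where the other has a leg of a copairing. Only unit laws and naturality are
needed, also for the version with c⁻¹. -/
theorem unit_comul :
    η[A] ≫ Δ[A] ≫ Δ[A] ▷ A =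
      (λ_ (𝟙_ 𝒞)).inv ≫ ((η[A] ≫ Δ[A]) ⊗ₘ (η[A] ≫ Δ[A])) ≫ (α_ (A ⊗ A) A A).inv ≫
        (α_ A A A).hom ▷ A ≫ (A ◁ μ[A]) ▷ A := by
  exact eq_of_check R (allRules_valid R)
    [(6, 2), (6, 5), (0, 1), (0, 2)] [(6, 2), (6, 10), (0, 1), (0, 7), (32, 2), (0, 5), (34, 2),
    (0, 2)]
    (by decide +kernel)

theorem unit_comul' :
    η[A] ≫ Δ[A] ≫ Δ[A] ▷ A =
      (λ_ (𝟙_ 𝒞)).inv ≫ ((η[A] ≫ Δ[A]) ⊗ₘ (η[A] ≫ Δ[A])) ≫ (α_ (A ⊗ A) A A).inv ≫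
        (α_ A A A).hom ▷ A ≫ (A ◁ ((β_ A A).inv ≫ μ[A])) ▷ A := by
  exact eq_of_check R (allRules_valid R)
    [(6, 2), (6, 5), (0, 1), (0, 2)] [(6, 2), (6, 9), (0, 1), (0, 6), (40, 2), (40, 4), (2, 9),
    (42, 2), (32, 2), (2, 5), (22, 3)]
    (by decide +kernel)

/-- The two legs of the copairing inserted by the comultiplication get multiplied. The curl on one
leg cancels the self-crossings, and separability leaves μ followed by the insertion of a unit. -/
theorem antipode_id :
    Δ[A] ≫ frobeniusAntipode R ▷ A ≫ μ[A] = targetMap A := by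
  unfold targetMap
  exact eq_of_check R (allRules_valid R)
    [(6, 1), (0, 0), (76, 1), (180, 0), (122, 1), (48, 0), (14, 0)] [(6, 4), (10, 13), (0, 3),
    (2, 9), (34, 0), (34, 0), (116, 6), (48, 1), (48, 1), (16, 1)]
    (by decide +kernel)

theorem id_antipode :
    Δ[A] ≫ A ◁ frobeniusAntipode R ≫ μ[A] = rMap A := by
  unfold rMap
  exact eq_of_check R (allRules_valid R)
    [(6, 1), (0, 0), (104, 0), (90, 1), (22, 2), (14, 3)] [(6, 2), (10, 13), (0, 1), (32, 0), (2,
    5), (32, 1), (32, 3), (104, 0), (22, 1), (104, 0), (160, 0), (76, 0)]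
    (by decide +kernel)

theorem antipode_id_antipode :
    Δ[A] ≫ Δ[A] ▷ A ≫ ((frobeniusAntipode R ⊗ₘ 𝟙 A) ⊗ₘ frobeniusAntipode R) ≫
      μ[A] ▷ A ≫ μ[A] = frobeniusAntipode R := by
  exact eq_of_check R (allRules_valid R)
    [(6, 1), (6, 9), (0, 0), (0, 6), (104, 6), (36, 5), (36, 7), (76, 1), (90, 6), (22, 7), (4,
    12), (14, 11), (2, 11), (180, 0), (122, 1), (48, 0), (104, 0), (22, 3), (14, 2), (2, 2)]
    [(76, 0)]
    (by decide +kernel)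

theorem antipode_antipodeInv :
    frobeniusAntipode R ≫ antipodeInv R = 𝟙 A := by
  exact eq_of_check R (allRules_valid R)
    [(118, 1), (20, 0)] []
    (by decide +kernel)

theorem antipodeInv_antipode :
    antipodeInv R ≫ frobeniusAntipode R = 𝟙 A := by
  exact eq_of_check R (allRules_valid R)
    [(22, 1), (120, 0)] []
    (by decide +kernel)

/-! ### The splitting of the target, and the source and target as comonoid morphisms -/

theorem incl_proj :
    incl R ≫ proj R = 𝟙 R := by
  exact eq_of_check R (allRules_valid R)
    [(0, 0)] []
    (by decide +kernel)

/-- A snake contraction turns the target into multiplication followed by insertion of a unit, which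
exhibits its splitting through `R`. -/
theorem proj_incl :
    proj R ≫ incl R = targetMap A := by
  unfold targetMap
  exact eq_of_check R (allRules_valid R)
    [] [(6, 4), (10, 13), (0, 3), (2, 9), (34, 0), (34, 0), (116, 6), (48, 1), (48, 1), (16, 1)]
    (by decide +kernel)

/-- By this and the next three equations the structure induced on the splitting is the given one on
`R`, so its being separable Frobenius needs no further argument. -/
theorem comul_eq :
    Δ[R] = incl R ≫ Δ[A] ≫ (proj R ⊗ₘ proj R) := by
  exact eq_of_check R (allRules_valid R)
    [(6, 0)] [(6, 2), (0, 0), (0, 0), (102, 0)]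
    (by decide +kernel)

theorem counit_eq :
    ε[R] = incl R ≫ ε[A] := by
  exact eq_of_check R (allRules_valid R)
    [] [(10, 1), (112, 0)]
    (by decide +kernel)

theorem mul_eq :
    μ[R] = (incl R ⊗ₘ incl R) ≫ μ[A] ≫ proj R := by
  exact eq_of_check R (allRules_valid R)
    [] [(32, 0), (2, 2), (34, 0), (0, 0)]
    (by decide +kernel)

theorem one_eq :
    η[R] = η[A] ≫ proj R := by
  exact eq_of_check R (allRules_valid R)
    [] [(0, 0)]
    (by decide +kernel)

theorem source_counit :
    source R ≫ ε[R] = ε[A] := by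
  exact eq_of_check R (allRules_valid R)
    [(10, 2), (132, 1), (120, 0)] [(10, 0)]
    (by decide +kernel)

/-- The product rule of `loop`, with its inverse double braiding, accounts for the opposite
comultiplication. -/
theorem source_comul :
    source R ≫ Δ[R] ≫ (β_ R R).hom = Δ[A] ≫ (source R ⊗ₘ source R) := by
  exact eq_of_check R (allRules_valid R)
    [(6, 3), (36, 4), (126, 3), (36, 2), (4, 6), (168, 2), (100, 1), (148, 0), (176, 5), (20, 4),
    (38, 7), (94, 4), (96, 5), (96, 2), (74, 6), (22, 3), (150, 1), (124, 0), (168, 1), (176, 4),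
    (20, 3), (46, 6), (94, 3), (96, 4), (4, 8), (66, 5), (124, 1)] [(6, 2), (0, 1), (136, 1),
    (106, 1), (82, 2), (168, 1), (176, 4), (20, 3), (46, 6), (94, 3), (96, 4), (4, 8), (66, 5),
    (124, 1)]
    (by decide +kernel)

theorem target_counit :
    proj R ≫ ε[R] = ε[A] := by
  exact eq_of_check R (allRules_valid R)
    [(10, 0)] [(10, 0)]
    (by decide +kernel)

theorem target_comul :
    proj R ≫ Δ[R] = Δ[A] ≫ (proj R ⊗ₘ proj R) := by
  exact eq_of_check R (allRules_valid R)
    [(6, 1), (4, 0)] [(6, 1), (0, 0), (102, 0)]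
    (by decide +kernel)

theorem source_eq :
    source R = sourceMap A ≫ proj R := by
  unfold sourceMap
  exact eq_of_check R (allRules_valid R)
    [] [(6, 2), (10, 10), (0, 0), (0, 0), (32, 1), (0, 3), (104, 0), (116, 2), (102, 0), (110,
    2), (36, 1), (126, 0), (156, 0), (92, 0)]
    (by decide +kernel)

theorem source_target :
    Δ[A] ≫ (source R ⊗ₘ proj R) ≫ (β_ R R).hom = Δ[A] ≫ (proj R ⊗ₘ source R) := by
  rw [source_eq]
  unfold sourceMap
  exact eq_of_check R (allRules_valid R)
    [(6, 2), (6, 10), (10, 13), (0, 0), (0, 0), (0, 5), (32, 1), (0, 3), (18, 3), (104, 0), (38,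
    3), (38, 2), (22, 1), (126, 0), (104, 0), (94, 1), (4, 3)] [(6, 1), (6, 6), (10, 14), (0, 0),
    (0, 2), (0, 2), (32, 3), (0, 5), (104, 2), (106, 0), (102, 1), (16, 1), (102, 0), (36, 1),
    (126, 0), (168, 0), (176, 3), (20, 2), (94, 2), (96, 3), (124, 0)]
    (by decide +kernel)

/-- The copairing slides through the source, and the coaction becomes δ on the second strand with
one leg crossed to the front. The curl contained in the source cancels. -/
theorem leftCoaction_eq :
    leftCoaction (source R) = lcoact R := by
  unfold leftCoaction
  exact eq_of_check R (allRules_valid R)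
    [(6, 1), (0, 0), (46, 3), (46, 5), (66, 2), (66, 4), (136, 0), (154, 0), (118, 1), (106, 0),
    (72, 1), (20, 3)] [(6, 0), (46, 1)]
    (by decide +kernel)

theorem rightCoaction_eq :
    rightCoaction (proj R) = rcoact R := by
  unfold rightCoaction
  exact eq_of_check R (allRules_valid R)
    [(6, 1), (0, 0), (102, 0)] [(6, 0)]
    (by decide +kernel)

/-! ### Composable pairs and triples as split forks; composition and unit -/

theorem pairs_condition :
    pairs R ≫ rcoact R ▷ A = pairs R ≫ A ◁ lcoact R ≫ (α_ A R A).inv := by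
  exact eq_of_check R (allRules_valid R)
    [(6, 0), (6, 3), (46, 1), (4, 3)] [(6, 0), (6, 3), (102, 0), (46, 3), (46, 3), (50, 3)]
    (by decide +kernel)

/-- `A` is the cofree right comodule `R ⊗ C`, so `A ⊗_C A` is `R ⊗ A`, embedded by the left coaction
of `A`. Multiplying the copied strand back is a retraction because μδ = 1. -/
theorem pairs_retr :
    pairs R ≫ pairsRetr R = 𝟙 (R ⊗ A) := by
  exact eq_of_check R (allRules_valid R)
    [(6, 0), (22, 2), (4, 1), (14, 0), (2, 0)] []
    (by decide +kernel)

theorem rcoact_rmul :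
    rcoact R ≫ rmul R = 𝟙 A := by
  exact eq_of_check R (allRules_valid R)
    [(6, 0), (4, 1), (14, 0), (2, 0)] []
    (by decide +kernel)

/-- The last condition for a split fork: the second parallel morphism followed by the multiplication
is the idempotent whose image is `R ⊗ A`. Triples are treated in the same way. -/
theorem lcoact_rmul :
    A ◁ lcoact R ≫ (α_ A R A).inv ≫ rmul R ▷ A = pairsRetr R ≫ pairs R := by
  exact eq_of_check R (allRules_valid R)
    [(6, 0), (46, 1)] [(6, 2), (46, 3), (46, 1), (20, 0), (4, 1)]
    (by decide +kernel)

theorem pairsLeft_pairs :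
    pairsLeft R ≫ R ◁ pairs R = pairs R ≫ lcoact R ▷ A ≫ (α_ R A A).hom := by
  exact eq_of_check R (allRules_valid R)
    [(6, 0), (6, 4), (102, 0), (46, 3), (46, 3), (46, 6), (46, 6), (50, 5)] [(6, 0), (6, 3), (46,
    1), (46, 5), (46, 3), (4, 5)]
    (by decide +kernel)

theorem pairsRight_pairs :
    pairsRight R ≫ pairs R ▷ R = pairs R ≫ A ◁ rcoact R ≫ (α_ A A R).inv := by
  exact eq_of_check R (allRules_valid R)
    [(6, 0), (6, 2), (46, 3), (46, 1), (4, 3)] [(6, 0), (6, 3), (102, 0), (46, 3), (46, 3)]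
    (by decide +kernel)

theorem compose_left :
    compose R ≫ lcoact R = pairsLeft R ≫ R ◁ compose R := by
  exact eq_of_check R (allRules_valid R)
    [(6, 2), (44, 1), (46, 2), (46, 4)] [(6, 0), (46, 1), (46, 3), (70, 3), (70, 0)]
    (by decide +kernel)

theorem compose_right :
    compose R ≫ rcoact R = pairsRight R ≫ compose R ▷ R := by
  exact eq_of_check R (allRules_valid R)
    [(6, 2)] [(6, 2)]
    (by decide +kernel)

theorem incl_left :
    incl R ≫ lcoact R = Δ[R] ≫ R ◁ incl R := by
  exact eq_of_check R (allRules_valid R)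
    [(6, 1), (40, 0)] [(6, 0)]
    (by decide +kernel)

theorem incl_right :
    incl R ≫ rcoact R = Δ[R] ≫ incl R ▷ R := by
  exact eq_of_check R (allRules_valid R)
    [(6, 1)] [(6, 1)]
    (by decide +kernel)

theorem triples₁_condition :
    triples₁ R ≫ pairsRight R ▷ A =
      triples₁ R ≫ (R ⊗ A) ◁ lcoact R ≫ (α_ (R ⊗ A) R A).inv := by
  exact eq_of_check R (allRules_valid R)
    [(6, 0), (6, 3), (46, 1), (4, 3)] [(6, 0), (6, 3), (102, 0), (46, 3), (46, 3), (50, 3)]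
    (by decide +kernel)

theorem triples₂_condition :
    triples₂ R ≫ rcoact R ▷ (R ⊗ A) =
      triples₂ R ≫ A ◁ pairsLeft R ≫ (α_ A R (R ⊗ A)).inv := by
  exact eq_of_check R (allRules_valid R)
    [(6, 0), (6, 4), (46, 1), (46, 3), (4, 5)] [(6, 0), (6, 4), (102, 0), (46, 3), (46, 3), (46,
    6), (46, 6), (50, 5), (50, 5)]
    (by decide +kernel)

theorem triples₁_retr :
    triples₁ R ≫ triplesRetr₁ R = 𝟙 (R ⊗ (R ⊗ A)) := by
  exact eq_of_check R (allRules_valid R)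
    [(6, 0), (22, 2), (4, 1), (14, 0), (2, 0)] []
    (by decide +kernel)

theorem triples₂_retr :
    triples₂ R ≫ triplesRetr₂ R = 𝟙 (R ⊗ (R ⊗ A)) := by
  exact eq_of_check R (allRules_valid R)
    [(6, 0), (22, 3), (22, 2), (4, 1), (14, 0), (2, 0)] []
    (by decide +kernel)

theorem pairsRight_pairsRmul :
    pairsRight R ≫ pairsRmul R = 𝟙 (R ⊗ A) := by
  exact eq_of_check R (allRules_valid R)
    [(6, 0), (4, 1), (14, 0), (2, 0)] []
    (by decide +kernel)

theorem lcoact_pairsRmul :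
    (R ⊗ A) ◁ lcoact R ≫ (α_ (R ⊗ A) R A).inv ≫ pairsRmul R ▷ A =
      triplesRetr₁ R ≫ triples₁ R := by
  exact eq_of_check R (allRules_valid R)
    [(6, 0), (46, 1)] [(6, 2), (46, 3), (46, 1), (20, 0), (4, 1)]
    (by decide +kernel)

theorem pairsLeft_rmul :
    A ◁ pairsLeft R ≫ (α_ A R (R ⊗ A)).inv ≫ rmul R ▷ (R ⊗ A) =
      triplesRetr₂ R ≫ triples₂ R := by
  exact eq_of_check R (allRules_valid R)
    [(6, 0), (46, 1), (46, 3)] [(6, 3), (46, 4), (46, 2), (20, 1), (46, 5), (46, 2), (20, 0), (4,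
    2)]
    (by decide +kernel)

theorem triples₁_triples₂ :
    triples₁ R ≫ pairs R ▷ A ≫ (α_ A A A).hom = triples₂ R ≫ A ◁ pairs R := by
  exact eq_of_check R (allRules_valid R)
    [(6, 0), (6, 3), (46, 1), (46, 5), (46, 3), (4, 5)] [(6, 0), (6, 4), (102, 0), (46, 3), (46,
    3), (46, 6), (46, 6), (50, 5)]
    (by decide +kernel)

theorem composeLeft_pairs :
    composeLeft R ≫ pairs R = triples₁ R ≫ compose R ▷ A := by
  exact eq_of_check R (allRules_valid R)
    [(6, 2), (46, 3)] [(6, 2), (46, 3)]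
    (by decide +kernel)

theorem composeRight_pairs :
    R ◁ compose R ≫ pairs R = triples₂ R ≫ A ◁ compose R := by
  exact eq_of_check R (allRules_valid R)
    [(6, 2), (44, 1), (46, 2), (46, 4)] [(6, 0), (46, 1), (46, 3), (70, 3), (70, 0)]
    (by decide +kernel)

/-- Associativity of the opposite product; the two orders of crossing agree by Yang–Baxter. -/
theorem compose_assoc :
    composeLeft R ≫ compose R = R ◁ compose R ≫ compose R := by
  exact eq_of_check R (allRules_valid R)
    [(36, 1)] [(38, 1), (4, 3), (52, 0)]
    (by decide +kernel)

theorem insertLeft_pairs :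
    insertLeft R ≫ pairs R = lcoact R ≫ incl R ▷ A := by
  exact eq_of_check R (allRules_valid R)
    [(6, 1), (46, 2)] [(6, 1), (46, 2)]
    (by decide +kernel)

theorem insertLeft_compose :
    insertLeft R ≫ compose R = 𝟙 A := by
  exact eq_of_check R (allRules_valid R)
    [(32, 0), (2, 0)] []
    (by decide +kernel)

theorem insertRight_pairs :
    insertRight R ≫ pairs R = rcoact R ≫ A ◁ incl R := by
  exact eq_of_check R (allRules_valid R)
    [(6, 1), (40, 0)] [(6, 0)]
    (by decide +kernel)

theorem insertRight_compose :
    insertRight R ≫ compose R = 𝟙 A := by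
  exact eq_of_check R (allRules_valid R)
    [(34, 0), (0, 0)] []
    (by decide +kernel)

/-! ### Coactions on composable pairs and the axioms (B2)–(B6) -/

theorem pairsComul_pairs :
    pairsComul R ≫ (A ⊗ A) ◁ pairs R =
      pairs R ≫ (Δ[A] ⊗ₘ Δ[A]) ≫ tensorμ A A A A := by
  exact eq_of_check R (allRules_valid R)
    [(6, 4), (104, 0), (104, 0), (106, 0), (36, 1)] [(6, 1), (6, 3), (6, 9), (0, 0), (0, 6), (22,
    3), (104, 0), (104, 0), (36, 1)]
    (by decide +kernel)

theorem target_pairsComul :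
    pairsComul R ≫ (proj R ⊗ₘ ε[A]) ▷ (R ⊗ A) ≫ (ρ_ R).hom ▷ (R ⊗ A) ≫ R ◁ compose R =
      pairsComul R ≫ (ε[A] ⊗ₘ source R) ▷ (R ⊗ A) ≫ (λ_ R).hom ▷ (R ⊗ A) ≫
        R ◁ compose R := by
  exact eq_of_check R (allRules_valid R)
    [(10, 5), (104, 0), (104, 0), (104, 1), (106, 0), (20, 2), (18, 3), (166, 0)] [(10, 1), (18,
    0), (80, 0), (48, 2), (102, 2), (46, 3), (20, 1), (4, 3)]
    (by decide +kernel)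

theorem pairsComulRight_pairs :
    pairsComulRight R ≫ pairs R ▷ A = pairsComul R ≫ (A ⊗ A) ◁ compose R := by
  exact eq_of_check R (allRules_valid R)
    [(6, 1), (6, 3), (0, 0), (46, 2)] [(104, 0), (104, 0), (104, 1), (106, 0), (20, 2), (102, 2),
    (102, 0), (46, 2)]
    (by decide +kernel)

theorem compose_comul :
    compose R ≫ Δ[A] = pairsComulRight R ≫ compose R ▷ A := by
  exact eq_of_check R (allRules_valid R)
    [(6, 3), (0, 2)] [(6, 3), (0, 2)]
    (by decide +kernel)

/-- As in `mul_counit`, contraction leaves κ⁻¹, and the κ produced by the Nakayama property cancels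
it. -/
theorem compose_counit :
    compose R ≫ ε[A] = pairs R ≫ (ε[A] ⊗ₘ ε[A]) ≫ (λ_ (𝟙_ 𝒞)).hom := by
  exact eq_of_check R (allRules_valid R)
    [(10, 2), (116, 1)] [(6, 0), (10, 3), (10, 4), (110, 2), (36, 1), (126, 0), (156, 0), (92,
    0), (162, 1), (76, 1), (120, 0)]
    (by decide +kernel)

theorem incl_comul_source :
    incl R ≫ Δ[A] ≫ source R ▷ A ≫ incl R ▷ A = incl R ≫ Δ[A] := by
  exact eq_of_check R (allRules_valid R)
    [(6, 4), (0, 3), (146, 1), (40, 1), (2, 2)] [(6, 2), (0, 1)]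
    (by decide +kernel)

theorem incl_comul_target :
    incl R ≫ Δ[A] ≫ proj R ▷ A ≫ incl R ▷ A = incl R ≫ Δ[A] := by
  exact eq_of_check R (allRules_valid R)
    [(6, 3), (0, 1), (0, 1)] [(6, 2), (0, 1)]
    (by decide +kernel)

theorem pairs_mul :
    compose R = pairs R ≫ μ[A] := by
  exact eq_of_check R (allRules_valid R)
    [] [(6, 0), (22, 2), (4, 3), (14, 2), (2, 2)]
    (by decide +kernel)

/-! ### The comonoid isomorphisms υ and ν, and the rotation θ -/

theorem curl_curlInv :
    curl R ≫ curlInv R = 𝟙 R := by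
  exact eq_of_check R (allRules_valid R)
    [(118, 0)] []
    (by decide +kernel)

theorem curlInv_curl :
    curlInv R ≫ curl R = 𝟙 R := by
  exact eq_of_check R (allRules_valid R)
    [(120, 0)] []
    (by decide +kernel)

theorem curl_counit :
    curl R ≫ ε[R] = ε[R] := by
  exact eq_of_check R (allRules_valid R)
    [(186, 0)] []
    (by decide +kernel)

/-- Writing δ as a product with the copairing reduces this to the product rule of κ; its double
braiding is that of the twofold opposite. -/
theorem curl_comul :
    curl R ≫ Δ[R] = (Δ[R] ≫ (β_ R R).hom ≫ (β_ R R).hom) ≫ (curl R ⊗ₘ curl R) := by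
  exact eq_of_check R (allRules_valid R)
    [(6, 1)] [(6, 0), (36, 1), (126, 0), (38, 3), (78, 4), (78, 3), (76, 2), (174, 6), (76, 7),
    (78, 6), (76, 4), (78, 3), (78, 8), (76, 7), (76, 6), (134, 1), (124, 2), (170, 1), (22, 3),
    (22, 2)]
    (by decide +kernel)

/-- The first antipode takes η ⊗ x to κx ⊗ η, the second takes this to κη ⊗ κx, and κ fixes the
unit. -/
theorem curl_eq_antipode :
    curl R = incl R ≫ frobeniusAntipode R ≫ frobeniusAntipode R ≫ proj R := by
  exact eq_of_check R (allRules_valid R)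
    [] [(32, 0), (34, 1), (144, 0), (0, 0)]
    (by decide +kernel)

theorem antipode_counit :
    frobeniusAntipode R ≫ ε[A] = ε[A] := by
  exact eq_of_check R (allRules_valid R)
    [(10, 2), (76, 0), (130, 1), (140, 1), (122, 0)] [(10, 0)]
    (by decide +kernel)

theorem antipode_comul :
    frobeniusAntipode R ≫ Δ[A] =
      (Δ[A] ≫ (β_ A A).hom) ≫ (frobeniusAntipode R ⊗ₘ frobeniusAntipode R) := by
  exact eq_of_check R (allRules_valid R)
    [(6, 3), (0, 2), (76, 0)] [(6, 1), (0, 0), (126, 0), (104, 0), (76, 5), (76, 4), (76, 7),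
    (90, 1), (94, 2), (74, 3), (22, 5), (134, 2), (124, 3), (48, 2)]
    (by decide +kernel)

theorem shear_shearInv :
    shear R ≫ shearInv R = 𝟙 (R ⊗ A) := by
  exact eq_of_check R (allRules_valid R)
    [(118, 2), (20, 1), (20, 0)] []
    (by decide +kernel)

theorem shearInv_shear :
    shearInv R ≫ shear R = 𝟙 (R ⊗ A) := by
  exact eq_of_check R (allRules_valid R)
    [(22, 2), (22, 1), (120, 0)] []
    (by decide +kernel)

theorem shear_pairs :
    shear R ≫ pairs R = pairs R ≫ thetaMap (frobeniusAntipode R) := by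
  unfold thetaMap
  exact eq_of_check R (allRules_valid R)
    [(6, 3), (76, 1), (46, 4), (20, 2)] [(6, 0), (6, 6), (0, 5), (22, 2), (36, 2), (36, 6), (36,
    9), (38, 10), (38, 9), (38, 13), (38, 11), (4, 13), (52, 7), (52, 4), (52, 7), (52, 4), (48,
    4), (48, 2), (48, 3), (48, 2), (104, 1), (104, 2), (104, 3), (106, 2), (20, 4), (102, 2),
    (14, 5), (2, 5), (46, 3), (20, 1), (90, 2)]
    (by decide +kernel)

/-- The full coaction inserts three copairings. The rotation carries them along, and after
naturality only curls on their legs have to be matched, by transposing `curl` into `loopInv` and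
cancelling it against `loop`. -/
theorem shear_coaction :
    shear R ≫ (pairsComul R ≫ (A ⊗ A) ◁ pairsComulRight R) ≫
        (A ⊗ A) ◁ ((R ⊗ A) ◁ antipodeInv R) ≫ (α_ (A ⊗ A) (R ⊗ A) A).inv ≫
          (β_ A ((A ⊗ A) ⊗ (R ⊗ A))).inv ≫ (α_ A (A ⊗ A) (R ⊗ A)).inv ≫
            (α_ A A A).inv ▷ (R ⊗ A) =
      ((pairsComul R ≫ (A ⊗ A) ◁ pairsComulRight R) ≫
        (A ⊗ A) ◁ ((R ⊗ A) ◁ frobeniusAntipode R) ≫ (A ⊗ A) ◁ (β_ (R ⊗ A) A).hom ≫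
          (α_ (A ⊗ A) A (R ⊗ A)).inv) ≫ ((A ⊗ A) ⊗ A) ◁ shear R := by
  exact eq_of_check R (allRules_valid R)
    [(6, 8), (0, 7), (104, 1), (104, 3), (106, 3), (106, 7), (106, 11), (106, 11), (76, 1), (66,
    5), (72, 13), (20, 10), (72, 11), (20, 9), (72, 12), (20, 14), (72, 13), (20, 15), (66, 7),
    (66, 9), (136, 3), (154, 3), (118, 4), (106, 3), (72, 4), (20, 2), (72, 4), (20, 0), (20, 4)]
    [(6, 5), (0, 4), (104, 0), (104, 0), (104, 0), (104, 0), (104, 4), (104, 8), (104, 8), (104,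
    8), (104, 8), (106, 5), (90, 1), (22, 2), (126, 1), (106, 1), (82, 3), (72, 6), (20, 4), (72,
    6), (20, 8), (134, 4), (124, 5)]
    (by decide +kernel)

theorem antipode_source :
    frobeniusAntipode R ≫ source R = proj R := by
  exact eq_of_check R (allRules_valid R)
    [(118, 1), (20, 0)] []
    (by decide +kernel)

/-- The double braiding in the product rule of κ turns the c⁻¹ of the source into the c of the
antipode, and the curl on one factor cancels κ⁻¹. -/
theorem antipode_target :
    frobeniusAntipode R ≫ proj R = source R ≫ curl R := by
  exact eq_of_check R (allRules_valid R)
    [(76, 0)] [(174, 2), (22, 1), (76, 1), (78, 2), (120, 0)]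
    (by decide +kernel)

/-- The content of (G3), with the braiding moved in front of source and target and with υ after the
source rewritten as the target after ν. -/
theorem shear_boundary :
    pairs R ≫ rcoact R ▷ A ≫ (α_ A R A).hom ≫ (β_ A (R ⊗ A)).hom ≫
        (R ◁ proj R ⊗ₘ (frobeniusAntipode R ≫ proj R)) =
      shear R ≫ pairs R ≫ rcoact R ▷ A ≫ ((source R ⊗ₘ 𝟙 R) ⊗ₘ proj R) := by
  exact eq_of_check R (allRules_valid R)
    [(6, 0), (6, 3), (36, 4), (126, 3), (36, 7), (104, 3), (36, 10), (104, 3), (106, 0), (38,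
    14), (46, 3), (36, 5), (36, 10), (36, 13), (38, 17), (94, 5), (84, 3), (4, 19), (52, 14),
    (52, 11), (52, 8), (52, 14), (52, 11), (52, 8), (72, 5), (52, 7), (74, 7), (74, 4), (74, 0),
    (48, 7), (174, 19), (38, 18), (36, 20), (76, 21), (76, 20), (78, 19), (78, 17), (78, 15),
    (78, 13), (78, 11), (88, 2), (76, 1), (4, 25), (52, 15), (52, 13), (52, 11), (52, 10), (74,
    10), (74, 7), (22, 3), (48, 8), (174, 19), (76, 20), (78, 19), (78, 18), (78, 13), (78, 12),
    (78, 11), (76, 10), (78, 21), (76, 20), (78, 18), (76, 17), (76, 16), (88, 9), (4, 23), (52,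
    19), (52, 18), (134, 3), (124, 4), (48, 3), (172, 6), (22, 5), (170, 5), (104, 5), (104, 5),
    (106, 3), (68, 5), (20, 7), (48, 5), (104, 5), (104, 5), (106, 3), (102, 3), (102, 5), (102,
    3), (36, 6), (36, 5), (126, 4), (46, 10), (46, 10), (46, 13), (46, 13), (46, 16), (46, 16),
    (72, 7), (20, 2), (20, 7), (20, 0), (72, 4), (20, 6), (178, 4), (118, 5), (50, 4), (166, 1),
    (118, 0), (46, 2), (4, 4), (66, 1), (166, 4), (92, 2), (92, 0)] [(6, 4), (6, 7), (76, 2),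
    (80, 0), (46, 5), (20, 3), (46, 7), (46, 5), (20, 1), (4, 5), (4, 8), (4, 7), (166, 2), (118,
    1), (46, 3), (4, 5), (66, 2)]
    (by decide +kernel)

end FrobeniusSquare

end Equations

/-! ### Split forks are preserved equalizers -/

section Cotensor

open Limits

variable {𝒞 : Type u} [Category.{v} 𝒞]

/-- A fork with a splitting is an equalizer. -/
def isLimitOfSplitting {X Y P : 𝒞} {f g : X ⟶ Y} {e : P ⟶ X} (w : e ≫ f = e ≫ g)
    {r : X ⟶ P} {m : Y ⟶ X} (h₁ : e ≫ r = 𝟙 P) (h₂ : f ≫ m = 𝟙 X) (h₃ : g ≫ m = r ≫ e) :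
    IsLimit (Fork.ofι e w) :=
  Fork.IsLimit.mk' _ fun s => ⟨s.ι ≫ r, by
      change (s.ι ≫ r) ≫ e = s.ι
      -- In diagrammatic order, with ι the leg of the fork: ιre = ιgm = ιfm = ι.
      rw [Category.assoc, ← h₃, ← s.condition_assoc, h₂, Category.comp_id], fun {k} hk => by
      change k ≫ e = s.ι at hk
      rw [← hk, Category.assoc, h₁]
      exact (Category.comp_id k).symm⟩

variable [MonoidalCategory 𝒞]

/-- A fork with a splitting exhibits a cotensor product. -/
theorem isCotensor_of_splitting {C M N P : 𝒞} {r : M ⟶ M ⊗ C} {l : N ⟶ C ⊗ N} {e : P ⟶ M ⊗ N}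
    (w : e ≫ r ▷ N = e ≫ M ◁ l ≫ (α_ M C N).inv) {q : M ⊗ N ⟶ P} {m : M ⊗ C ⟶ M}
    (h₁ : e ≫ q = 𝟙 P) (h₂ : r ≫ m = 𝟙 M) (h₃ : M ◁ l ≫ (α_ M C N).inv ≫ m ▷ N = q ≫ e) :
    IsCotensor r l e := by
  have h₂' : r ▷ N ≫ m ▷ N = 𝟙 (M ⊗ N) := by rw [← comp_whiskerRight, h₂, id_whiskerRight]
  have h₃' : (M ◁ l ≫ (α_ M C N).inv) ≫ m ▷ N = q ≫ e := by rw [Category.assoc, h₃]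
  refine ⟨w, ⟨isLimitOfSplitting w h₁ h₂' h₃'⟩, fun X => ?_⟩
  refine preservesLimit_of_preserves_limit_cone (isLimitOfSplitting w h₁ h₂' h₃') ?_
  refine (isLimitMapConeForkEquiv (tensorLeft X) w).symm ?_
  -- A splitting consists of equations, so `X ⊗ -` carries it to a splitting of the image.
  refine isLimitOfSplitting (r := X ◁ q) (m := X ◁ m ▷ N) _ ?_ ?_ ?_
  · change X ◁ e ≫ X ◁ q = 𝟙 (X ⊗ P)
    rw [← whiskerLeft_comp, h₁, whiskerLeft_id]
  · change X ◁ r ▷ N ≫ X ◁ m ▷ N = 𝟙 (X ⊗ (M ⊗ N))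
    rw [← whiskerLeft_comp, h₂', whiskerLeft_id]
  · change X ◁ (M ◁ l ≫ (α_ M C N).inv) ≫ X ◁ m ▷ N = X ◁ q ≫ X ◁ e
    rw [← whiskerLeft_comp, ← whiskerLeft_comp, h₃']

end Cotensor

/-! ### Assembly of the weak Hopf monoid and the quantum groupoid -/

namespace FrobeniusSquare

variable {𝒞 : Type u} [Category.{v} 𝒞] [MonoidalCategory 𝒞] [BraidedCategory 𝒞]
variable (R : 𝒞) [MonObj R] [ComonObj R] [IsSeparableFrobenius R]

theorem isWeakBimonoid : IsWeakBimonoid (FrobeniusSquare R) where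
  mul_comul := mul_comul R
  mul_counit := mul_counit R
  mul_counit' := mul_counit' R
  unit_comul := unit_comul R
  unit_comul' := unit_comul' R

theorem isAntipode : IsAntipode (frobeniusAntipode R) where
  antipode_id := antipode_id R
  id_antipode := id_antipode R
  antipode_id_antipode := antipode_id_antipode R

/-- The antipode as an isomorphism. -/
def antipodeIso : FrobeniusSquare R ≅ FrobeniusSquare R where
  hom := frobeniusAntipode R
  inv := antipodeInv R
  hom_inv_id := antipode_antipodeInv R
  inv_hom_id := antipodeInv_antipode R

/-- The curl as an isomorphism. -/
def curlIso : R ≅ R where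
  hom := curl R
  inv := curlInv R
  hom_inv_id := curl_curlInv R
  inv_hom_id := curlInv_curl R

/-- The isomorphism `θ`. -/
def shearIso : R ⊗ FrobeniusSquare R ≅ R ⊗ FrobeniusSquare R where
  hom := shear R
  inv := shearInv R
  hom_inv_id := shear_shearInv R
  inv_hom_id := shearInv_shear R

theorem isObjectOfObjects : IsObjectOfObjects (proj R) (incl R) where
  i_p := incl_proj R
  p_i := proj_incl R
  comul_eq := comul_eq R
  counit_eq := counit_eq R
  mul_eq := mul_eq R
  one_eq := one_eq R

/-- The quantum category of a separable Frobenius monoid. -/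
def quantumCategory : QuantumCategory (FrobeniusSquare R) R where
  s := source R
  t := proj R
  s_counit := source_counit R
  s_comul := source_comul R
  t_counit := target_counit R
  t_comul := target_comul R
  s_t := source_target R
  P := R ⊗ FrobeniusSquare R
  incl := pairs R
  isCotensor := by
    rw [leftCoaction_eq, rightCoaction_eq]
    exact isCotensor_of_splitting (pairs_condition R) (pairs_retr R) (rcoact_rmul R)
      (lcoact_rmul R)
  leftP := pairsLeft R
  leftP_incl := by rw [leftCoaction_eq, pairsLeft_pairs]
  rightP := pairsRight R
  rightP_incl := by rw [rightCoaction_eq, pairsRight_pairs]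
  comp := compose R
  comp_left := by rw [leftCoaction_eq, compose_left]
  comp_right := by rw [rightCoaction_eq, compose_right]
  unit := incl R
  unit_left := by rw [leftCoaction_eq, incl_left]
  unit_right := by rw [rightCoaction_eq, incl_right]
  T := R ⊗ (R ⊗ FrobeniusSquare R)
  j₁ := triples₁ R
  j₂ := triples₂ R
  isCotensor₁ := by
    rw [leftCoaction_eq]
    exact isCotensor_of_splitting (triples₁_condition R) (triples₁_retr R)
      (pairsRight_pairsRmul R) (lcoact_pairsRmul R)
  isCotensor₂ := by
    rw [rightCoaction_eq]
    exact isCotensor_of_splitting (triples₂_condition R) (triples₂_retr R) (rcoact_rmul R)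
      (pairsLeft_rmul R)
  j₁_j₂ := triples₁_triples₂ R
  mulId := composeLeft R
  mulId_incl := composeLeft_pairs R
  idMul := R ◁ compose R
  idMul_incl := composeRight_pairs R
  assoc := compose_assoc R
  unitL := insertLeft R
  unitL_incl := by rw [leftCoaction_eq, insertLeft_pairs]
  unitL_comp := insertLeft_compose R
  unitR := insertRight R
  unitR_incl := by rw [rightCoaction_eq, insertRight_pairs]
  unitR_comp := insertRight_compose R
  δl := pairsComul R
  δl_incl := pairsComul_pairs R
  b2 := target_pairsComul R
  δr := pairsComulRight R
  δr_incl := pairsComulRight_pairs R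
  b3 := compose_comul R
  b4 := compose_counit R
  b5 := (counit_eq R).symm
  b6_s := incl_comul_source R
  b6_t := incl_comul_target R

/-- Naturality of the braiding brings the source next to κ, (G2) replaces the pair, and
`shear_boundary` remains. -/
theorem shear_ς :
    (quantumCategory R).ς ≫ (α_ R R R).hom ≫ (β_ R (R ⊗ R)).hom ≫ (R ⊗ R) ◁ curl R =
      shear R ≫ (quantumCategory R).ς := by
  change (pairs R ≫ rightCoaction (proj R) ▷ FrobeniusSquare R ≫
        ((source R ⊗ₘ 𝟙 R) ⊗ₘ proj R)) ≫ (α_ R R R).hom ≫ (β_ R (R ⊗ R)).hom ≫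
      (R ⊗ R) ◁ curl R =
    shear R ≫ pairs R ≫ rightCoaction (proj R) ▷ FrobeniusSquare R ≫
      ((source R ⊗ₘ 𝟙 R) ⊗ₘ proj R)
  rw [rightCoaction_eq, ← shear_boundary]
  simp only [Category.assoc, associator_naturality_assoc,
    BraidedCategory.braiding_naturality_assoc, antipode_target]
  rw [← id_tensorHom (R ⊗ R), tensorHom_comp_tensorHom, Category.comp_id, id_tensorHom]

/-- The quantum groupoid of a separable Frobenius monoid. -/
def quantumGroupoid : QuantumGroupoid (FrobeniusSquare R) R where
  toQuantumCategory := quantumCategory R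
  υ := curlIso R
  υ_counit := curl_counit R
  υ_comul := curl_comul R
  ν := antipodeIso R
  ν_counit := antipode_counit R
  ν_comul := antipode_comul R
  θ := shearIso R
  θ_coaction := shear_coaction R
  g1 := antipode_source R
  g2 := antipode_target R
  g3 := shear_ς R

theorem isInducedBy :
    (quantumGroupoid R).IsInducedBy (frobeniusAntipode R) (proj R) (incl R) where
  s_eq := source_eq R
  t_eq := by
    rw [← proj_incl, Category.assoc, incl_proj, Category.comp_id]
    rfl
  comp_eq := pairs_mul R
  unit_eq := rfl
  υ_eq := curl_eq_antipode R
  ν_eq := rfl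
  θ_eq := shear_pairs R

end FrobeniusSquare

end WeakHopf

/-- The construction, made in an arbitrary braided monoidal category, is applied to the Cauchy
completion; the witness for `C` is `R`, with p = μ and i = η ⊗ 1. -/
theorem mainTheorem10 {V : Type u} [Category.{v} V] [MonoidalCategory V] [BraidedCategory V]
    (R : Karoubi V) [MonObj R] [ComonObj R] [IsSeparableFrobenius R] :
    IsWeakBimonoid (FrobeniusSquare R) ∧
    IsAntipode (frobeniusAntipode R) ∧
    IsIso (frobeniusAntipode R) ∧
    ∃ (C : Karoubi V) (_ : MonObj C) (_ : ComonObj C)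
      (p : FrobeniusSquare R ⟶ C) (i : C ⟶ FrobeniusSquare R),
      IsObjectOfObjects p i ∧
      IsSeparableFrobenius C ∧
      ∃ G : QuantumGroupoid (FrobeniusSquare R) C,
        G.IsInducedBy (frobeniusAntipode R) p i :=
  ⟨FrobeniusSquare.isWeakBimonoid R, FrobeniusSquare.isAntipode R,
    (FrobeniusSquare.antipodeIso R).isIso_hom, R, inferInstance, inferInstance,
    FrobeniusSquare.proj R, FrobeniusSquare.incl R, FrobeniusSquare.isObjectOfObjects R,
    inferInstance, FrobeniusSquare.quantumGroupoid R, FrobeniusSquare.isInducedBy R⟩
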